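/- Let $k$ be a field. For $n\ge 0$, a rational function of degree $n$ is a pair $(A,B)\ne(0,0)$ of polynomials in $k[X]$ of degree at most $n$ with $\mathrm{res}_{n,n}(A,B)\neq 0$, taken up to a common non-zero scalar; here $\mathrm{res}_{n,n}$ is the resultant of $A$ and $B$ considered as polynomials of degree $\le n$. It defines the endomorphism $A/B$ of $\mathbf P^1$ over $k$ given on the affine line $\{[x:1]\}$ by $[x:1]\mapsto[A(x):B(x)]$, and every endomorphism of $\mathbf P^1$ over $k$ is of this form, with a unique degree $n$. Let $\{\mathbf P^1,\mathbf P^1\}^{\mathrm N}$ be the set of endomorphisms of $\mathbf P^1$ over $k$ modulo the equivalence relation generated by $F|_{\mathbf P^1\times\{0\}}\sim F|_{\mathbf P^1\times\{1\}}$ for all $k$-morphisms $F:\mathbf P^1\times\mathbf A^1\to\mathbf P^1$ (unpointed naive homotopies); it is graded by the degree. The Bézout form $\mathrm{B\acute ez}_n(A,B)$ is the symmetric bilinear form on $k^n$ whose Gram matrix $(c_{p,q})_{1\le p,q\le n}$ is given by $$\frac{A(X)B(Y)-A(Y)B(X)}{X-Y}=\sum_{1\le p,q\le n}c_{p,q}X^{p-1}Y^{q-1};$$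 it is non-degenerate. Let $\mathrm{MW}^{\mathrm s}_n(k)$ be the set of non-degenerate symmetric $k$-bilinear forms of rank $n$ modulo stable isomorphism ($b\sim b'$ if $b\oplus b''\simeq b'\oplus b''$ for some non-degenerate symmetric form $b''$). For $n\ge1$ form the fibre product $$\mathrm{MW}^{\mathrm s}_n(k)\times_{k^\times/k^{\times2}}k^\times/k^{\times 2n}$$ along the discriminant $\mathrm{MW}^{\mathrm s}_n(k)\to k^\times/k^{\times2}$ and the projection $k^\times/k^{\times2n}\to k^\times/k^{\times2}$, where $k^{\times m}$ denotes the group of $m$-th powers of elements of $k^\times$. For $n=0$ the component of the target is by convention the single element $(0,1)$ (the zero form, of determinant $1$). **Theorem.** The map of graded sets $$\{\mathbf P^1,\mathbf P^1\}^{\mathrm N}\longrightarrow\coprod_{n\ge0}\mathrm{MW}^{\mathrm s}_n(k)\times_{k^\times/k^{\times2}}k^\times/k^{\times2n},\qquad [A/B]\longmapsto\bigl[\mathrm{B\acute ez}_n(A,B),\ \det\mathrm{B\acute ez}_n(A,B)\bigr]\quad(n=\deg(A/B))$$ is well defined and is a bijection. -/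

import Mathlib

universe u

open AlgebraicGeometry CategoryTheory CategoryTheory.Limits

noncomputable section

namespace NaiveP1

/-! ### The projective line, its endomorphisms and their naive homotopies -/

section ProjectiveLine

attribute [local instance] MvPolynomial.gradedAlgebra

/-- The projective line `Proj k[x₀, x₁]` over `k`, with the standard grading of `k[x₀, x₁]`. -/
def P1 (k : Type u) [Field k] : Scheme.{u} :=
  Proj (MvPolynomial.homogeneousSubmodule (Fin 2) k)

/-- The structure morphism of the projective line. -/
def P1.str (k : Type u) [Field k] : P1 k ⟶ Spec (CommRingCat.of k) :=
  Proj.toSpecZero (MvPolynomial.homogeneousSubmodule (Fin 2) k) ≫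
    Spec.map (CommRingCat.ofHom
      (algebraMap k (MvPolynomial.homogeneousSubmodule (Fin 2) k 0)))

lemma map_irrelevant_eq_top {k : Type u} [Field k] {S : Type u} [CommRing S] [Algebra k S]
    {T : Type u} [CommRing T] (φ : S →+* T) (a b : S) (h : IsCoprime a b) :
    (HomogeneousIdeal.irrelevant (MvPolynomial.homogeneousSubmodule (Fin 2) k)).toIdeal.map
      (φ.comp (MvPolynomial.aeval (R := k) ![a, b]).toRingHom) = ⊤ := by
  have hX : ∀ i : Fin 2, (MvPolynomial.X i : MvPolynomial (Fin 2) k) ∈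
      (HomogeneousIdeal.irrelevant (MvPolynomial.homogeneousSubmodule (Fin 2) k)).toIdeal :=
    fun i => HomogeneousIdeal.mem_irrelevant_of_mem _ Nat.one_pos
      ((MvPolynomial.mem_homogeneousSubmodule 1 _).2 (MvPolynomial.isHomogeneous_X k i))
  have h0 := Ideal.mem_map_of_mem (φ.comp (MvPolynomial.aeval (R := k) ![a, b]).toRingHom) (hX 0)
  have h1 := Ideal.mem_map_of_mem (φ.comp (MvPolynomial.aeval (R := k) ![a, b]).toRingHom) (hX 1)
  simp only [AlgHom.toRingHom_eq_coe, RingHom.coe_comp, RingHom.coe_coe, Function.comp_apply,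
    MvPolynomial.aeval_X, Matrix.cons_val_zero, Matrix.cons_val_one] at h0 h1
  obtain ⟨x, y, hxy⟩ := h
  rw [Ideal.eq_top_iff_one, ← map_one φ, ← hxy, map_add, map_mul, map_mul]
  exact Ideal.add_mem _ (Ideal.mul_mem_left _ _ h0) (Ideal.mul_mem_left _ _ h1)

/-- The `S`-point `[a : b]` of the projective line, for a `k`-algebra `S` and elements `a`, `b`
generating the unit ideal of `S`. -/
def P1.point {k : Type u} [Field k] {S : Type u} [CommRing S] [Algebra k S]
    (a b : S) (h : IsCoprime a b) : Spec (CommRingCat.of S) ⟶ P1 k :=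
  Proj.fromOfGlobalSections (MvPolynomial.homogeneousSubmodule (Fin 2) k)
    ((Scheme.ΓSpecIso (CommRingCat.of S)).inv.hom.comp
      (MvPolynomial.aeval (R := k) ![a, b]).toRingHom)
    (map_irrelevant_eq_top _ a b h)

end ProjectiveLine

/-- The affine chart `𝔸¹ = Spec k[X] ⟶ ℙ¹`, `x ↦ [x : 1]`; it misses only `∞ = [1 : 0]`. -/
def P1.chart (k : Type u) [Field k] : Spec (CommRingCat.of (Polynomial k)) ⟶ P1 k :=
  P1.point (Polynomial.X : Polynomial k) 1 isCoprime_one_right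

/-- Endomorphisms of the projective line as a scheme over `k`. -/
def Endo (k : Type u) [Field k] : Type u :=
  {f : P1 k ⟶ P1 k // f ≫ P1.str k = P1.str k}

/-- The affine line `Spec k[T]` over `k`: its structure morphism. -/
def A1.str (k : Type u) [Field k] :
    Spec (CommRingCat.of (Polynomial k)) ⟶ Spec (CommRingCat.of k) :=
  Spec.map (CommRingCat.ofHom (Polynomial.C : k →+* Polynomial k))

/-- The rational point `t` of the affine line. -/
def A1.point {k : Type u} [Field k] (t : k) :
    Spec (CommRingCat.of k) ⟶ Spec (CommRingCat.of (Polynomial k)) :=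
  Spec.map (CommRingCat.ofHom (Polynomial.evalRingHom t))

lemma A1.point_str {k : Type u} [Field k] (t : k) :
    A1.point t ≫ A1.str k = 𝟙 (Spec (CommRingCat.of k)) := by
  rw [A1.point, A1.str, ← Spec.map_comp, ← CommRingCat.ofHom_comp]
  have : (Polynomial.evalRingHom t).comp Polynomial.C = RingHom.id k := by ext; simp
  rw [this]
  exact Spec.map_id _

/-- The fibre product `ℙ¹ × 𝔸¹` over `k`. -/
abbrev Cylinder (k : Type u) [Field k] : Scheme.{u} :=
  pullback (P1.str k) (A1.str k)

/-- The inclusion `ℙ¹ ≅ ℙ¹ × {t} ⟶ ℙ¹ × 𝔸¹`. -/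
def Cylinder.slice {k : Type u} [Field k] (t : k) : P1 k ⟶ Cylinder k :=
  pullback.lift (𝟙 (P1 k)) (P1.str k ≫ A1.point t)
    (by rw [Category.assoc, A1.point_str, Category.comp_id, Category.id_comp])

/-- There is an (unpointed) naive homotopy with source `f` and target `g`: a morphism
`F : ℙ¹ × 𝔸¹ ⟶ ℙ¹` over `k` restricting to `f` on `ℙ¹ × {0}` and to `g` on `ℙ¹ × {1}`. -/
def NaivelyHomotopic {k : Type u} [Field k] (f g : Endo k) : Prop :=
  ∃ F : Cylinder k ⟶ P1 k,
    F ≫ P1.str k = pullback.fst (P1.str k) (A1.str k) ≫ P1.str k ∧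
    Cylinder.slice 0 ≫ F = f.1 ∧ Cylinder.slice 1 ≫ F = g.1

/-- The equivalence relation generated by naive homotopies. -/
def naiveSetoid (k : Type u) [Field k] : Setoid (Endo k) :=
  Relation.EqvGen.setoid NaivelyHomotopic

/-- The set of unpointed naive homotopy classes of endomorphisms of the projective line. -/
def NaiveClasses (k : Type u) [Field k] : Type u := Quotient (naiveSetoid k)

/-- The naive homotopy class of an endomorphism. -/
def Endo.toClass {k : Type u} [Field k] (f : Endo k) : NaiveClasses k :=
  Quotient.mk (naiveSetoid k) f

/-! ### Rational functions -/

/-- A representative `(A, B)` of an unpointed rational function of degree `n`: polynomials of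
degree at most `n`, not both zero, whose resultant `res_{n,n}(A, B)` does not vanish. (The
condition that they are not both zero only matters for `n = 0`, where the resultant is `1`.) -/
structure RatFun (k : Type u) [Field k] (n : ℕ) where
  A : Polynomial k
  B : Polynomial k
  natDegree_A : A.natDegree ≤ n
  natDegree_B : B.natDegree ≤ n
  ne_zero : A ≠ 0 ∨ B ≠ 0
  resultant_ne_zero : Polynomial.resultant A B n n ≠ 0

lemma RatFun.isCoprime {k : Type u} [Field k] {n : ℕ} (r : RatFun k n) : IsCoprime r.A r.B := by
  rcases Nat.eq_zero_or_pos n with hn | hn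
  · have hA := Polynomial.eq_C_of_natDegree_le_zero (r.natDegree_A.trans hn.le)
    have hB := Polynomial.eq_C_of_natDegree_le_zero (r.natDegree_B.trans hn.le)
    rcases r.ne_zero with h | h
    · have hu : IsUnit r.A := by
        rw [hA] at h ⊢
        exact Polynomial.isUnit_C.2 (isUnit_iff_ne_zero.2 fun h0 => h (by rw [h0, map_zero]))
      obtain ⟨v, hv⟩ := hu.exists_left_inv
      exact ⟨v, 0, by rw [hv, zero_mul, add_zero]⟩
    · have hu : IsUnit r.B := by
        rw [hB] at h ⊢
        exact Polynomial.isUnit_C.2 (isUnit_iff_ne_zero.2 fun h0 => h (by rw [h0, map_zero]))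
      obtain ⟨v, hv⟩ := hu.exists_left_inv
      exact ⟨0, v, by rw [hv, zero_mul, zero_add]⟩
  · obtain ⟨p, q, -, -, h⟩ := Polynomial.exists_mul_add_mul_eq_C_resultant r.A r.B
      r.natDegree_A r.natDegree_B (Or.inl hn.ne')
    have hC : Polynomial.C (Polynomial.resultant r.A r.B n n)⁻¹ *
        Polynomial.C (Polynomial.resultant r.A r.B n n) = 1 := by
      rw [← map_mul, inv_mul_cancel₀ r.resultant_ne_zero, map_one]
    refine ⟨Polynomial.C (Polynomial.resultant r.A r.B n n)⁻¹ * p,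
      Polynomial.C (Polynomial.resultant r.A r.B n n)⁻¹ * q, ?_⟩
    rw [← hC, ← h]
    ring

/-- The endomorphism `f` of the projective line is the rational function `A / B`: on the affine
line it is `x ↦ [A(x) : B(x)]`. -/
def Endo.IsFraction {k : Type u} [Field k] (f : Endo k) {n : ℕ} (r : RatFun k n) : Prop :=
  P1.chart k ≫ f.1 = P1.point r.A r.B r.isCoprime

/-! ### The Bézout form -/

/-- The polynomial `δ(X, Y) = (A(X) B(Y) - A(Y) B(X)) / (X - Y)`, as a polynomial in `Y` with
coefficients in `R[X]`. The division is exact, see `bezoutian_mul`. -/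
def bezoutian {R : Type u} [CommRing R] (A B : Polynomial R) : Polynomial (Polynomial R) :=
  (A.map Polynomial.C * Polynomial.C B - Polynomial.C A * B.map Polynomial.C) /ₘ
    (Polynomial.X - Polynomial.C Polynomial.X)

lemma bezoutian_mul {R : Type u} [CommRing R] (A B : Polynomial R) :
    bezoutian A B * (Polynomial.C Polynomial.X - Polynomial.X) =
      Polynomial.C A * B.map Polynomial.C - A.map Polynomial.C * Polynomial.C B := by
  have h : (Polynomial.X - Polynomial.C (Polynomial.X : Polynomial R)) * bezoutian A B =
      A.map Polynomial.C * Polynomial.C B - Polynomial.C A * B.map Polynomial.C := by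
    rw [bezoutian, Polynomial.mul_divByMonic_eq_iff_isRoot]
    simp [Polynomial.IsRoot, Polynomial.eval_map, Polynomial.eval₂_C_X]
  linear_combination -h

/-- The Gram matrix of the Bézout form of `A / B` in degree `n`: its `(p, q)` entry is the
coefficient of `X ^ p * Y ^ q` in `δ(X, Y)`, for `0 ≤ p, q < n`. -/
def bezoutMatrix {R : Type u} [CommRing R] (n : ℕ) (A B : Polynomial R) :
    Matrix (Fin n) (Fin n) R :=
  Matrix.of fun p q => ((bezoutian A B).coeff q).coeff p

/-! ### The stable Witt monoid -/

/-- Non-degenerate symmetric bilinear forms on `kⁿ`, given by their Gram matrices. -/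
@[ext]
structure SymmForm (k : Type u) [Field k] (n : ℕ) where
  gram : Matrix (Fin n) (Fin n) k
  isSymm : gram.IsSymm
  isUnit_det : IsUnit gram.det

/-- The determinant of a non-degenerate form, as a unit. -/
def SymmForm.det {k : Type u} [Field k] {n : ℕ} (b : SymmForm k n) : kˣ := b.isUnit_det.unit

/-- Isomorphism of the bilinear forms with Gram matrices `M` and `N`. -/
def Congruent {k : Type u} [Field k] {ι : Type} [Fintype ι] [DecidableEq ι]
    (M N : Matrix ι ι k) : Prop :=
  ∃ P : Matrix ι ι k, IsUnit P.det ∧ P.transpose * M * P = N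

section Congruent

variable {k : Type u} [Field k] {ι κ : Type} [Fintype ι] [DecidableEq ι] [Fintype κ]
  [DecidableEq κ] {M N L : Matrix ι ι k}

lemma Congruent.refl (M : Matrix ι ι k) : Congruent M M := ⟨1, by simp, by simp⟩

lemma Congruent.symm (h : Congruent M N) : Congruent N M := by
  obtain ⟨P, hP, rfl⟩ := h
  have h1 : P * P⁻¹ = 1 := Matrix.mul_nonsing_inv P hP
  have h2 : P⁻¹.transpose * P.transpose = 1 := by
    rw [← Matrix.transpose_mul, h1, Matrix.transpose_one]
  refine ⟨P⁻¹, Matrix.isUnit_nonsing_inv_det P hP, ?_⟩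
  calc P⁻¹.transpose * (P.transpose * M * P) * P⁻¹
      = (P⁻¹.transpose * P.transpose) * M * (P * P⁻¹) := by simp only [Matrix.mul_assoc]
    _ = M := by rw [h1, h2, Matrix.one_mul, Matrix.mul_one]

lemma Congruent.trans (h : Congruent M N) (h' : Congruent N L) : Congruent M L := by
  obtain ⟨P, hP, rfl⟩ := h
  obtain ⟨Q, hQ, rfl⟩ := h'
  refine ⟨P * Q, by rw [Matrix.det_mul]; exact hP.mul hQ, ?_⟩
  simp only [Matrix.transpose_mul, Matrix.mul_assoc]

lemma Congruent.submatrix (e : κ ≃ ι) (h : Congruent M N) :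
    Congruent (M.submatrix e e) (N.submatrix e e) := by
  obtain ⟨P, hP, rfl⟩ := h
  refine ⟨P.submatrix e e, by rwa [Matrix.det_submatrix_equiv_self], ?_⟩
  rw [Matrix.transpose_submatrix, Matrix.submatrix_mul_equiv, Matrix.submatrix_mul_equiv]

lemma Congruent.sum (h : Congruent M N) (D : Matrix κ κ k) :
    Congruent (Matrix.fromBlocks M 0 0 D) (Matrix.fromBlocks N 0 0 D) := by
  obtain ⟨P, hP, rfl⟩ := h
  refine ⟨Matrix.fromBlocks P 0 0 1, by simpa using hP, ?_⟩
  simp [Matrix.fromBlocks_transpose, Matrix.fromBlocks_multiply]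

lemma Congruent.exists_det (h : Congruent M N) : ∃ s : kˣ, N.det = M.det * (s : k) ^ 2 := by
  obtain ⟨P, hP, rfl⟩ := h
  refine ⟨hP.unit, ?_⟩
  rw [Matrix.det_mul, Matrix.det_mul, Matrix.det_transpose, IsUnit.unit_spec]
  ring

end Congruent

/-- Stable isomorphism: `b ⊕ c ≅ b' ⊕ c` for some non-degenerate symmetric form `c`. -/
def SymmForm.StablyIso {k : Type u} [Field k] {n : ℕ} (b b' : SymmForm k n) : Prop :=
  ∃ (m : ℕ) (c : SymmForm k m),
    Congruent (Matrix.fromBlocks b.gram 0 0 c.gram) (Matrix.fromBlocks b'.gram 0 0 c.gram)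

/-- The orthogonal sum of two forms. -/
def SymmForm.sum {k : Type u} [Field k] {m n : ℕ} (c : SymmForm k m) (d : SymmForm k n) :
    SymmForm k (m + n) where
  gram := (Matrix.fromBlocks c.gram 0 0 d.gram).submatrix finSumFinEquiv.symm finSumFinEquiv.symm
  isSymm := (Matrix.IsSymm.fromBlocks c.isSymm (by simp) d.isSymm).submatrix _
  isUnit_det := by
    rw [Matrix.det_submatrix_equiv_self, Matrix.det_fromBlocks_zero₂₁]
    exact c.isUnit_det.mul d.isUnit_det

lemma SymmForm.StablyIso.trans {k : Type u} [Field k] {n : ℕ} {b b' b'' : SymmForm k n}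
    (h : b.StablyIso b') (h' : b'.StablyIso b'') : b.StablyIso b'' := by
  obtain ⟨m, c, hc⟩ := h
  obtain ⟨p, d, hd⟩ := h'
  refine ⟨m + p, c.sum d, ?_⟩
  let e : Fin n ⊕ Fin (m + p) ≃ (Fin n ⊕ Fin m) ⊕ Fin p :=
    (Equiv.sumCongr (Equiv.refl _) finSumFinEquiv.symm).trans (Equiv.sumAssoc _ _ _).symm
  let e' : Fin n ⊕ Fin (m + p) ≃ (Fin n ⊕ Fin p) ⊕ Fin m :=
    ((Equiv.sumCongr (Equiv.refl _) finSumFinEquiv.symm).trans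
      (Equiv.sumCongr (Equiv.refl _) (Equiv.sumComm _ _))).trans (Equiv.sumAssoc _ _ _).symm
  have he : ∀ a : SymmForm k n, Matrix.fromBlocks a.gram 0 0 (c.sum d).gram =
      (Matrix.fromBlocks (Matrix.fromBlocks a.gram 0 0 c.gram) 0 0 d.gram).submatrix e e := by
    intro a
    ext i j
    rcases i with i | i <;> rcases j with j | j <;>
      simp only [SymmForm.sum, e] <;>
      [skip; obtain ⟨j, rfl⟩ := finSumFinEquiv.surjective j;
       obtain ⟨i, rfl⟩ := finSumFinEquiv.surjective i;
       (obtain ⟨j, rfl⟩ := finSumFinEquiv.surjective j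
        obtain ⟨i, rfl⟩ := finSumFinEquiv.surjective i)] <;>
      (try rcases i with i | i) <;> (try rcases j with j | j) <;> simp
  have he' : ∀ a : SymmForm k n, Matrix.fromBlocks a.gram 0 0 (c.sum d).gram =
      (Matrix.fromBlocks (Matrix.fromBlocks a.gram 0 0 d.gram) 0 0 c.gram).submatrix e' e' := by
    intro a
    ext i j
    rcases i with i | i <;> rcases j with j | j <;>
      simp only [SymmForm.sum, e'] <;>
      [skip; obtain ⟨j, rfl⟩ := finSumFinEquiv.surjective j;
       obtain ⟨i, rfl⟩ := finSumFinEquiv.surjective i;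
       (obtain ⟨j, rfl⟩ := finSumFinEquiv.surjective j
        obtain ⟨i, rfl⟩ := finSumFinEquiv.surjective i)] <;>
      (try rcases i with i | i) <;> (try rcases j with j | j) <;> simp
  have h1 := (hc.sum d.gram).submatrix e
  have h2 := (hd.sum c.gram).submatrix e'
  rw [← he, ← he] at h1
  rw [← he', ← he'] at h2
  exact h1.trans h2

/-- The setoid of stable isomorphism on non-degenerate symmetric forms of rank `n`. -/
def stableSetoid (k : Type u) [Field k] (n : ℕ) : Setoid (SymmForm k n) where
  r := SymmForm.StablyIso
  iseqv :=
    { refl := fun b => ⟨n, b, Congruent.refl _⟩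
      symm := fun ⟨m, c, h⟩ => ⟨m, c, h.symm⟩
      trans := SymmForm.StablyIso.trans }

/-- The rank `n` component of the stable Witt monoid: stable isomorphism classes of
non-degenerate symmetric bilinear forms of rank `n`. -/
def MWs (k : Type u) [Field k] (n : ℕ) : Type u := Quotient (stableSetoid k n)

/-- The group `kˣ / (kˣ)ᵐ`. -/
abbrev UnitsModPow (k : Type u) [Field k] (m : ℕ) : Type u :=
  kˣ ⧸ (powMonoidHom m : kˣ →* kˣ).range

lemma SymmForm.StablyIso.det_eq {k : Type u} [Field k] {n : ℕ} {b b' : SymmForm k n}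
    (h : b.StablyIso b') : (b.det : UnitsModPow k 2) = (b'.det : UnitsModPow k 2) := by
  obtain ⟨m, c, h⟩ := h
  obtain ⟨s, hs⟩ := h.exists_det
  rw [Matrix.det_fromBlocks_zero₂₁, Matrix.det_fromBlocks_zero₂₁] at hs
  rw [QuotientGroup.eq]
  refine ⟨s, ?_⟩
  rw [eq_inv_mul_iff_mul_eq]
  ext
  apply mul_right_cancel₀ c.isUnit_det.ne_zero
  simp only [SymmForm.det, powMonoidHom_apply, Units.val_mul, IsUnit.unit_spec, Units.val_pow_eq_pow_val]
  rw [hs]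
  ring

/-- The discriminant of a stable class: the determinant of a Gram matrix modulo squares. -/
def MWs.disc {k : Type u} [Field k] {n : ℕ} : MWs k n → UnitsModPow k 2 :=
  Quotient.lift (s := stableSetoid k n) (fun b => (b.det : UnitsModPow k 2))
    (fun _ _ h => SymmForm.StablyIso.det_eq h)

/-- The canonical projection `kˣ / (kˣ)²ⁿ → kˣ / (kˣ)²`. -/
def UnitsModPow.proj (k : Type u) [Field k] (n : ℕ) :
    UnitsModPow k (2 * n) →* UnitsModPow k 2 :=
  QuotientGroup.map _ _ (MonoidHom.id kˣ) (by
    rintro _ ⟨x, rfl⟩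
    exact ⟨x ^ n, by simp [← pow_mul, mul_comm]⟩)

/-- The fibre product of the rank `n` stable classes with `kˣ / (kˣ)²ⁿ` over `kˣ / (kˣ)²`. In
rank `0` the only form is the zero form, whose determinant is `1`, and the second component is
required to be `1`. -/
def Target (k : Type u) [Field k] (n : ℕ) : Type u :=
  {p : MWs k n × UnitsModPow k (2 * n) //
    MWs.disc p.1 = UnitsModPow.proj k n p.2 ∧ (n = 0 → p.2 = 1)}

/-- The pair formed by the stable class and the determinant of a form. -/
def SymmForm.toTarget {k : Type u} [Field k] {n : ℕ} (b : SymmForm k n) : Target k n :=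
  ⟨(Quotient.mk (stableSetoid k n) b, (b.det : UnitsModPow k (2 * n))), rfl, by
    rintro rfl
    have : b.det = 1 := by ext; simp [SymmForm.det]
    simp [this]⟩

end NaiveP1

end

noncomputable section

namespace NaiveP1

/-! The geometry reduces to pairs of polynomials. Since `k[X]` and `k[T][X]` are factorial, a
morphism from an affine chart to `ℙ¹` has global coprime homogeneous coordinates
(`P1.exists_point_eq`). Comparing the two charts bounds the degrees and excludes common zeros at
infinity as well (`Good`, `Cylinder.exists_good`). So an endomorphism is such a pair over `k` up to
a scalar, and a naive homotopy is such a pair over `k[T]`.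

The invariant is well defined for the following reason. The Bézout form of a pair over `k[T]` is
symmetric with unit determinant, and units of `k[T]` are constants. By reduction theory such a form
takes a constant value at some non-zero vector (`exists_natDegree_le`), so it splits off a constant
form of rank one or a metabolic plane. Metabolic planes over `k` are all stably `⟨1⟩ ⊕ ⟨-1⟩`; hence
all fibres are stably isomorphic to one diagonal form (`exists_forall_stabIso_diagForm`). A scalar
`u` multiplies the form by `u²` and its determinant by `u²ⁿ`, which is why the determinant survives
only modulo `2n`-th powers.

For injectivity, elementary matrices are joined to the identity by lines, so every class contains a
function fixing `∞`. The Euclidean algorithm and explicit homotopies turn it into a continued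
fraction `cf [u₁, …, uₙ]` (`Pointed.exists_cf`), whose Bézout form is `⟨u₁, …, uₙ⟩` with determinant
`u₁⋯uₙ`. Two consecutive steps belong to a family parametrized by binary forms of fixed determinant
(`pairStep`). Shearing the binary form is a homotopy, so the list can be moved to begin with any
non-zero value of its diagonal form, or with any unit if that form is isotropic
(`CfEq.exists_cons`). A dimension count shows that stably isomorphic forms have a common non-zero
value or are both isotropic (`exists_eq_of_formIso`). Splitting off a common first entry and
inducting shows that the stable class and the exact product determine the continued fraction up to
homotopy (`cfEq_of_stabIso`). Without base points, `A / B` and `A / (u² B)` are homotopic, which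
absorbs the `2n`-th powers.

Surjectivity is stable diagonalization, followed by a correction of one entry by a square. The
arguments hold in every characteristic. -/

/-! ### Morphisms into `Proj` and local computations on affine schemes -/

lemma comp_assoc₅ {C : Type*} [Category C] {X₁ X₂ X₃ X₄ X₅ X₆ : C} (a : X₁ ⟶ X₂) (b : X₂ ⟶ X₃)
    (c : X₃ ⟶ X₄) (d : X₄ ⟶ X₅) (e : X₅ ⟶ X₆) :
    a ≫ b ≫ c ≫ d ≫ e = (a ≫ b ≫ c ≫ d) ≫ e := by
  simp only [Category.assoc]

-- The bridge from glued morphisms to ring maps: once `t` becomes invertible along `g`, the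
-- composite stays in `D₊(t)` and can be read off from a homomorphism out of the degree-zero
-- localization.
open HomogeneousLocalization in
lemma comp_fromOfGlobalSections {σ A : Type u} [CommRing A] [SetLike σ A] [AddSubgroupClass σ A]
    (𝒜 : ℕ → σ) [GradedRing 𝒜] {X : Scheme.{u}} (f : A →+* Γ(X, ⊤))
    (hf : (HomogeneousIdeal.irrelevant 𝒜).toIdeal.map f = ⊤)
    {S : Type u} [CommRing S] (g : Spec (CommRingCat.of S) ⟶ X) (ψ : Γ(X, ⊤) →+* S)
    (hg : g ≫ X.toSpecΓ = Spec.map (CommRingCat.ofHom ψ))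
    {t : A} {d : ℕ} (hd : 0 < d) (ht : t ∈ 𝒜 d) (hu : IsUnit ((ψ.comp f) t)) :
    g ≫ Proj.fromOfGlobalSections 𝒜 f hf =
      Spec.map (CommRingCat.ofHom ((IsLocalization.Away.lift (S := Localization.Away t) t hu).comp
        (algebraMap (Away 𝒜 t) (Localization.Away t)))) ≫ Proj.awayι 𝒜 t ht hd := by
  have hr : Set.range g ⊆ Set.range (X.basicOpen (f t)).ι := by
    rintro _ ⟨w, rfl⟩
    rw [Scheme.Opens.range_ι, ← X.toSpecΓ_preimage_basicOpen]
    change (g ≫ X.toSpecΓ) w ∈ PrimeSpectrum.basicOpen (f t)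
    rw [hg]
    change ψ (f t) ∉ w.asIdeal
    intro hmem
    exact w.2.ne_top (Ideal.eq_top_of_isUnit_mem _ hmem hu)
  obtain ⟨g', hg'⟩ : ∃ g', g' ≫ (X.basicOpen (f t)).ι = g :=
    ⟨IsOpenImmersion.lift _ g hr, IsOpenImmersion.lift_fac _ _ _⟩
  have h1 : (X.basicOpen (f t)).ι ≫ Proj.fromOfGlobalSections 𝒜 f hf =
      Proj.toBasicOpenOfGlobalSections 𝒜 f rfl hd ht ≫ Scheme.Opens.ι _ :=
    (Proj.openCoverOfMapIrrelevantEqTop 𝒜 f hf).ι_glueMorphisms _ _ ⟨_, _, hd, ht⟩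
  rw [← hg', Category.assoc, h1]
  simp only [Proj.toBasicOpenOfGlobalSections, Category.assoc, Proj.basicOpenIsoSpec_inv_ι]
  have h2 : g' ≫ (X.isoOfEq (X.toSpecΓ_preimage_basicOpen (f t))).inv ≫
      X.toSpecΓ ∣_ (PrimeSpectrum.basicOpen (f t)) ≫ (basicOpenIsoSpecAway (f t)).hom =
      Spec.map (CommRingCat.ofHom
        (IsLocalization.Away.lift (S := Localization.Away (f t)) (f t) (g := ψ) hu)) := by
    rw [← cancel_mono (Spec.map (CommRingCat.ofHom
      (algebraMap Γ(X, ⊤) (Localization.Away (f t)))))]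
    rw [← Spec.map_comp, ← CommRingCat.ofHom_comp, IsLocalization.Away.lift_comp, ← hg, ← hg']
    simp only [Category.assoc, basicOpenIsoSpecAway, IsOpenImmersion.isoOfRangeEq_hom_fac]
    refine congrArg (g' ≫ ·) ?_
    refine (congrArg (_ ≫ ·) (morphismRestrict_ι X.toSpecΓ (PrimeSpectrum.basicOpen (f t)))).trans ?_
    exact (Category.assoc _ _ _).symm.trans
      (congrArg (· ≫ X.toSpecΓ) (Scheme.isoOfEq_inv_ι X _))
  refine (comp_assoc₅ _ _ _ _ _).trans ((congrArg (· ≫ _) h2).trans ?_)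
  rw [← Category.assoc, ← Spec.map_comp, ← CommRingCat.ofHom_comp, ← RingHom.comp_assoc]
  congr 5
  apply IsLocalization.ringHom_ext (M := .powers t)
  ext i
  simp

lemma Spec_hom_ext_of_span_eq_top {S : Type u} [CommRing S] {Z : Scheme.{u}}
    {f g : Spec (CommRingCat.of S) ⟶ Z} {ι : Type u} (s : ι → S)
    (hs : Ideal.span (Set.range s) = ⊤)
    (h : ∀ i, Spec.map (CommRingCat.ofHom (algebraMap S (Localization.Away (s i)))) ≫ f =
      Spec.map (CommRingCat.ofHom (algebraMap S (Localization.Away (s i)))) ≫ g) : f = g :=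
  (Scheme.affineOpenCoverOfSpanRangeEqTop (R := CommRingCat.of S) s hs).openCover.hom_ext _ _ h

lemma Spec_hom_ext_of_isCoprime {S : Type u} [CommRing S] {Z : Scheme.{u}}
    {f g : Spec (CommRingCat.of S) ⟶ Z} {a b : S} (hab : IsCoprime a b)
    (ha : Spec.map (CommRingCat.ofHom (algebraMap S (Localization.Away a))) ≫ f =
      Spec.map (CommRingCat.ofHom (algebraMap S (Localization.Away a))) ≫ g)
    (hb : Spec.map (CommRingCat.ofHom (algebraMap S (Localization.Away b))) ≫ f =
      Spec.map (CommRingCat.ofHom (algebraMap S (Localization.Away b))) ≫ g) : f = g := by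
  refine Spec_hom_ext_of_span_eq_top (fun i : ULift.{u} (Fin 2) => ![a, b] i.down) ?_ ?_
  · rw [Ideal.eq_top_iff_one]
    obtain ⟨x, y, hxy⟩ := hab
    rw [← hxy]
    exact Ideal.add_mem _ (Ideal.mul_mem_left _ _ (Ideal.subset_span ⟨⟨0⟩, rfl⟩))
      (Ideal.mul_mem_left _ _ (Ideal.subset_span ⟨⟨1⟩, rfl⟩))
  · rintro ⟨i⟩
    fin_cases i
    · exact ha
    · exact hb

lemma map_eq_pow_mul_of_isHomogeneous {k S σ : Type*} [CommSemiring k] [CommSemiring S]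
    {ρ ρ' : MvPolynomial σ k →+* S} {u : S} (hC : ∀ c, ρ' (MvPolynomial.C c) = ρ (MvPolynomial.C c))
    (hX : ∀ j, ρ' (MvPolynomial.X j) = u * ρ (MvPolynomial.X j))
    {n : ℕ} {p : MvPolynomial σ k} (hp : p.IsHomogeneous n) : ρ' p = u ^ n * ρ p := by
  rw [p.as_sum, map_sum, map_sum, Finset.mul_sum]
  refine Finset.sum_congr rfl fun d hd => ?_
  have hdeg := hp.degree_eq_sum_deg_support hd
  rw [MvPolynomial.monomial_eq, map_mul, map_mul, hC, Finsupp.prod, map_prod, map_prod,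
    hdeg, ← Finset.prod_pow_eq_pow_sum]
  simp only [map_pow, hX, mul_pow, Finset.prod_mul_distrib]
  ring

/-! ### Degree-zero localizations of `k[x₀, x₁]` -/

section Away

attribute [local instance] MvPolynomial.gradedAlgebra

open HomogeneousLocalization

variable {k : Type u} [Field k]

lemma X_mem_homogeneousSubmodule (i : Fin 2) :
    (MvPolynomial.X i : MvPolynomial (Fin 2) k) ∈ MvPolynomial.homogeneousSubmodule (Fin 2) k 1 :=
  (MvPolynomial.mem_homogeneousSubmodule 1 _).2 (MvPolynomial.isHomogeneous_X k i)

/-- The ring homomorphism from the degree zero part of `k[x₀, x₁]` localized at `xᵢ` induced by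
a homomorphism under which `xᵢ` becomes invertible. -/
def awayHom {S : Type u} [CommRing S] (ρ : MvPolynomial (Fin 2) k →+* S) (i : Fin 2)
    (hu : IsUnit (ρ (MvPolynomial.X i))) :
    Away (MvPolynomial.homogeneousSubmodule (Fin 2) k) (MvPolynomial.X i) →+* S :=
  (IsLocalization.Away.lift (S := Localization.Away (MvPolynomial.X i : MvPolynomial (Fin 2) k))
    (MvPolynomial.X i) hu).comp (algebraMap _ _)

lemma pow_mul_awayHom_mk {S : Type u} [CommRing S] (ρ : MvPolynomial (Fin 2) k →+* S) (i : Fin 2)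
    (hu : IsUnit (ρ (MvPolynomial.X i))) (n : ℕ) (p : MvPolynomial (Fin 2) k) (hp) :
    ρ (MvPolynomial.X i) ^ n * awayHom ρ i hu
      (Away.mk (MvPolynomial.homogeneousSubmodule (Fin 2) k) (X_mem_homogeneousSubmodule i)
        n p hp) = ρ p := by
  rw [awayHom, RingHom.comp_apply, HomogeneousLocalization.algebraMap_apply, Away.val_mk,
    Localization.mk_eq_mk', IsLocalization.Away.lift, ← map_pow]
  refine ((IsLocalization.lift_mk'_spec
    (M := Submonoid.powers (MvPolynomial.X i : MvPolynomial (Fin 2) k))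
    (S := Localization (Submonoid.powers (MvPolynomial.X i : MvPolynomial (Fin 2) k)))
    (g := ρ) _ p _ ⟨MvPolynomial.X i ^ n, n, rfl⟩).1 rfl).symm

/-- Proportional coordinates differ by one unit factor, which scales a form of degree `n` by its
`n`-th power and cancels in fractions of degree zero. -/
lemma awayHom_eq {S : Type u} [CommRing S] {ρ ρ' : MvPolynomial (Fin 2) k →+* S} {i : Fin 2}
    (hu : IsUnit (ρ (MvPolynomial.X i))) (hu' : IsUnit (ρ' (MvPolynomial.X i)))
    (hC : ∀ c, ρ' (MvPolynomial.C c) = ρ (MvPolynomial.C c))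
    (hX : ∀ j, ρ' (MvPolynomial.X j) * ρ (MvPolynomial.X i) =
      ρ (MvPolynomial.X j) * ρ' (MvPolynomial.X i)) :
    awayHom ρ i hu = awayHom ρ' i hu' := by
  ext x
  obtain ⟨n, p, hp, rfl⟩ := Away.mk_surjective _ (X_mem_homogeneousSubmodule i) x
  obtain ⟨v, hv⟩ := hu.exists_left_inv
  have hp' : p.IsHomogeneous n := by
    have := (MvPolynomial.mem_homogeneousSubmodule _ _).1 hp
    rwa [smul_eq_mul, mul_one] at this
  have h := map_eq_pow_mul_of_isHomogeneous (ρ := ρ) (ρ' := ρ')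
    (u := ρ' (MvPolynomial.X i) * v) hC (fun j => by
      linear_combination (-ρ' (MvPolynomial.X j)) * hv + v * hX j) hp'
  apply ((hu.pow n).mul (hu'.pow n)).mul_left_cancel
  have h1 := pow_mul_awayHom_mk ρ i hu n p hp
  have h2 := pow_mul_awayHom_mk ρ' i hu' n p hp
  rw [mul_right_comm, h1, mul_assoc, h2, h, mul_pow]
  have hv' : v ^ n * ρ (MvPolynomial.X i) ^ n = 1 := by rw [← mul_pow, hv, one_pow]
  linear_combination (-ρ p * ρ' (MvPolynomial.X i) ^ n) * hv'

end Away

/-! ### Points of the projective line and their homogeneous coordinates -/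

section Point

attribute [local instance] MvPolynomial.gradedAlgebra

open HomogeneousLocalization

variable {k : Type u} [Field k]

/-- The open immersion of the standard chart `D₊(xᵢ)` of the projective line. -/
def P1.awayι (k : Type u) [Field k] (i : Fin 2) :
    Spec (CommRingCat.of (Away (MvPolynomial.homogeneousSubmodule (Fin 2) k)
      (MvPolynomial.X i))) ⟶ P1 k :=
  Proj.awayι (MvPolynomial.homogeneousSubmodule (Fin 2) k) (MvPolynomial.X i)
    (X_mem_homogeneousSubmodule i) Nat.one_pos

instance (i : Fin 2) : IsOpenImmersion (P1.awayι k i) := by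
  exact inferInstanceAs (IsOpenImmersion (Proj.awayι
    (MvPolynomial.homogeneousSubmodule (Fin 2) k) (MvPolynomial.X i)
    (X_mem_homogeneousSubmodule i) Nat.one_pos))

/-- The standard open `D₊(xᵢ)` of the projective line. -/
def P1.basicOpen (k : Type u) [Field k] (i : Fin 2) : (P1 k).Opens :=
  Proj.basicOpen (MvPolynomial.homogeneousSubmodule (Fin 2) k) (MvPolynomial.X i)

lemma P1.opensRange_awayι (i : Fin 2) : (P1.awayι k i).opensRange = P1.basicOpen k i :=
  Proj.opensRange_awayι ..

lemma P1.exists_mem_basicOpen (x : P1 k) : ∃ i, x ∈ P1.basicOpen k i := by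
  have h := Proj.iSup_basicOpen_eq_top' (MvPolynomial.homogeneousSubmodule (Fin 2) k)
    (fun i : Fin 2 => MvPolynomial.X i) (fun i => ⟨1, X_mem_homogeneousSubmodule i⟩) (by
      rw [eq_top_iff]
      rintro p -
      induction p using MvPolynomial.induction_on with
      | C a => 
        exact Subalgebra.algebraMap_mem _ (⟨MvPolynomial.C a,
          (MvPolynomial.mem_homogeneousSubmodule _ _).2 (MvPolynomial.isHomogeneous_C _ a)⟩ :
          MvPolynomial.homogeneousSubmodule (Fin 2) k 0)
      | add p q hp hq => exact Subalgebra.add_mem _ hp hq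
      | mul_X p i hp =>
        exact Subalgebra.mul_mem _ hp (Algebra.subset_adjoin ⟨i, rfl⟩))
  have hx : x ∈ (⊤ : (P1 k).Opens) := trivial
  erw [← h] at hx
  exact TopologicalSpace.Opens.mem_iSup.1 hx

variable {S : Type u} [CommRing S] [Algebra k S]

lemma SpecMap_comp_point {S' : Type u} [CommRing S'] (ψ : S →+* S') (a b : S) (h : IsCoprime a b)
    (i : Fin 2)
    (hu : IsUnit ((ψ.comp (MvPolynomial.aeval (R := k) ![a, b]).toRingHom) (MvPolynomial.X i))) :
    Spec.map (CommRingCat.ofHom ψ) ≫ P1.point (k := k) a b h =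
      Spec.map (CommRingCat.ofHom
        (awayHom (ψ.comp (MvPolynomial.aeval (R := k) ![a, b]).toRingHom) i hu)) ≫
          P1.awayι k i := by
  have key : ((ψ.comp (Scheme.ΓSpecIso (CommRingCat.of S)).hom.hom).comp
      ((Scheme.ΓSpecIso (CommRingCat.of S)).inv.hom.comp
        (MvPolynomial.aeval (R := k) ![a, b]).toRingHom)) =
      ψ.comp (MvPolynomial.aeval (R := k) ![a, b]).toRingHom := by
    ext x <;> simp
  have := comp_fromOfGlobalSections (MvPolynomial.homogeneousSubmodule (Fin 2) k)
    ((Scheme.ΓSpecIso (CommRingCat.of S)).inv.hom.comp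
      (MvPolynomial.aeval (R := k) ![a, b]).toRingHom)
    (map_irrelevant_eq_top _ a b h) (Spec.map (CommRingCat.ofHom ψ))
    (ψ.comp (Scheme.ΓSpecIso (CommRingCat.of S)).hom.hom)
    (by rw [← SpecMap_ΓSpecIso_hom, ← Spec.map_comp]; rfl)
    Nat.one_pos (X_mem_homogeneousSubmodule i) (by rw [key]; exact hu)
  refine this.trans ?_
  unfold P1.awayι awayHom
  congr 5
  

lemma P1.point_preimage_basicOpen (a b : S) (h : IsCoprime a b) (i : Fin 2) :
    P1.point (k := k) a b h ⁻¹ᵁ P1.basicOpen k i = PrimeSpectrum.basicOpen (![a, b] i) := by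
  refine (Proj.fromOfGlobalSections_preimage_basicOpen _ _ _ Nat.one_pos
    (X_mem_homogeneousSubmodule i)).trans ?_
  refine (basicOpen_eq_of_affine' (R := CommRingCat.of S) _).trans ?_
  have h2 : ∀ x : S, (Scheme.ΓSpecIso (CommRingCat.of S)).hom.hom
      ((Scheme.ΓSpecIso (CommRingCat.of S)).inv.hom x) = x := fun x => by simp
  have h3 : (MvPolynomial.aeval (R := k) ![a, b]).toRingHom (MvPolynomial.X i) = ![a, b] i :=
    MvPolynomial.aeval_X _ _
  rw [RingHom.comp_apply, h3]
  exact congrArg PrimeSpectrum.basicOpen (h2 _)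

lemma P1.point_comp_str (a b : S) (h : IsCoprime a b) :
    P1.point (k := k) a b h ≫ P1.str k = Spec.map (CommRingCat.ofHom (algebraMap k S)) := by
  refine (Proj.fromOfGlobalSections_toSpecZero_assoc _ _ _ _).trans ?_
  rw [← SpecMap_ΓSpecIso_hom, ← Spec.map_comp, ← Spec.map_comp]
  congr 1
  ext x
  have h3 : (MvPolynomial.aeval (R := k) ![a, b]).toRingHom (MvPolynomial.C x) =
    algebraMap k S x := MvPolynomial.aeval_C _ _
  have h2 : ∀ x : S, (Scheme.ΓSpecIso (CommRingCat.of S)).hom.hom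
      ((Scheme.ΓSpecIso (CommRingCat.of S)).inv.hom x) = x := fun x => by simp
  exact (h2 _).trans h3

/-- The standard coordinate on `D₊(xᵢ)`, extended by `1` in the `i`-th place. -/
def chartVec (k : Type u) [Field k] (i : Fin 2) : Fin 2 → Polynomial k :=
  Function.update (fun _ => Polynomial.X) i 1

lemma isCoprime_chartVec (i : Fin 2) : IsCoprime (chartVec k i 0) (chartVec k i 1) := by
  fin_cases i
  · exact isCoprime_one_left
  · exact isCoprime_one_right

/-- The chart `𝔸¹ ⟶ ℙ¹` onto `D₊(xᵢ)`. -/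
def P1.stdChart (k : Type u) [Field k] (i : Fin 2) :
    Spec (CommRingCat.of (Polynomial k)) ⟶ P1 k :=
  P1.point (chartVec k i 0) (chartVec k i 1) (isCoprime_chartVec i)

lemma P1.stdChart_one : P1.stdChart k 1 = P1.chart k := rfl

lemma chartVec_eq (i : Fin 2) : ![chartVec k i 0, chartVec k i 1] = chartVec k i := by
  ext j; fin_cases j <;> rfl

lemma aeval_chartVec_self (i : Fin 2) :
    (MvPolynomial.aeval (R := k) (chartVec k i)).toRingHom (MvPolynomial.X i) = 1 := by
  refine (MvPolynomial.aeval_X _ _).trans ?_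
  simp [chartVec]

/-- The inverse `σ` sends the coordinate to the fraction of the other variable by `xᵢ`. This
identifies `D₊(xᵢ)` with the affine line. -/
lemma bijective_awayHom_chartVec (i : Fin 2) :
    Function.Bijective (awayHom (MvPolynomial.aeval (R := k) (chartVec k i)).toRingHom i
      (by rw [aeval_chartVec_self]; exact isUnit_one)) := by
  set ρ := (MvPolynomial.aeval (R := k) (chartVec k i)).toRingHom with hρ
  have hρX : ∀ j, ρ (MvPolynomial.X j) = chartVec k i j := fun j => MvPolynomial.aeval_X _ _
  have hρC : ∀ c, ρ (MvPolynomial.C c) = Polynomial.C c := fun c => MvPolynomial.aeval_C _ _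
  have hu : IsUnit (ρ (MvPolynomial.X i)) := by rw [aeval_chartVec_self]; exact isUnit_one
  let x : Away (MvPolynomial.homogeneousSubmodule (Fin 2) k) (MvPolynomial.X i) :=
    Away.mk _ (X_mem_homogeneousSubmodule i) 1 (MvPolynomial.X (1 - i))
      (X_mem_homogeneousSubmodule (1 - i))
  let σ : Polynomial k →+* Away (MvPolynomial.homogeneousSubmodule (Fin 2) k)
      (MvPolynomial.X i) := Polynomial.eval₂RingHom ((fromZeroRingHom
        (MvPolynomial.homogeneousSubmodule (Fin 2) k) (Submonoid.powers (MvPolynomial.X i))).comp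
        (algebraMap k (MvPolynomial.homogeneousSubmodule (Fin 2) k 0))) x
  have hmk := pow_mul_awayHom_mk ρ i hu
  have hone : ∀ n p hp, awayHom ρ i hu
      (Away.mk (MvPolynomial.homogeneousSubmodule (Fin 2) k) (X_mem_homogeneousSubmodule i)
        n p hp) = ρ p := fun n p hp => by
    rw [← hmk n p hp, aeval_chartVec_self, one_pow, one_mul]
  refine ⟨?_, ?_⟩
  · have hinv : ∀ y, σ (awayHom ρ i hu y) = y := by
      intro y
      obtain ⟨n, p, hp, rfl⟩ := Away.mk_surjective _ (X_mem_homogeneousSubmodule i) y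
      rw [hone]
      have hp' : p.IsHomogeneous n := by
        have := (MvPolynomial.mem_homogeneousSubmodule _ _).1 hp
        rwa [smul_eq_mul, mul_one] at this
      apply HomogeneousLocalization.val_injective
      let L := Localization.Away (MvPolynomial.X i : MvPolynomial (Fin 2) k)
      have h := map_eq_pow_mul_of_isHomogeneous
        (ρ := (algebraMap (Away (MvPolynomial.homogeneousSubmodule (Fin 2) k)
          (MvPolynomial.X i)) L).comp (σ.comp ρ))
        (ρ' := algebraMap (MvPolynomial (Fin 2) k) L)
        (u := algebraMap (MvPolynomial (Fin 2) k) L (MvPolynomial.X i)) ?_ ?_ hp'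
      · rw [Away.val_mk, Localization.mk_eq_mk', IsLocalization.eq_mk'_iff_mul_eq, mul_comm]
        rw [h, map_pow]
        rfl
      · intro c
        refine Eq.trans ?_ (congrArg (fun z => algebraMap _ L (σ z)) (hρC c)).symm
        simp only [σ, Polynomial.coe_eval₂RingHom, Polynomial.eval₂_C]
        rfl
      · intro j
        refine Eq.trans ?_ (congrArg (fun z => algebraMap (MvPolynomial (Fin 2) k) L
          (MvPolynomial.X i) * algebraMap _ L (σ z)) (hρX j)).symm
        by_cases hj : j = i
        · subst hj
          simp [chartVec]
        · have hj' : j = 1 - i := by omega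
          simp only [chartVec, Function.update_of_ne hj, σ, Polynomial.coe_eval₂RingHom,
            Polynomial.eval₂_X]
          rw [HomogeneousLocalization.algebraMap_apply, Away.val_mk, Localization.mk_eq_mk',
            mul_comm, eq_comm, ← hj']
          have := IsLocalization.mk'_spec L (MvPolynomial.X j : MvPolynomial (Fin 2) k)
            (⟨MvPolynomial.X i ^ 1, 1, rfl⟩ : Submonoid.powers (MvPolynomial.X i))
          simpa only [pow_one] using this
    exact Function.LeftInverse.injective hinv
  · have hinv : (awayHom ρ i hu).comp σ = RingHom.id _ := by
      ext c
      · have h0 := hone 0 (MvPolynomial.C c) ((MvPolynomial.mem_homogeneousSubmodule _ _).2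
          (by simpa using MvPolynomial.isHomogeneous_C (Fin 2) c))
        rw [hρC] at h0
        simp only [RingHom.comp_apply, RingHom.id_apply, σ, Polynomial.coe_eval₂RingHom,
          Polynomial.eval₂_C]
        rw [← h0]
        congr 2
      · have h1 := hone 1 (MvPolynomial.X (1 - i)) (X_mem_homogeneousSubmodule (1 - i))
        have hne : (1 - i : Fin 2) ≠ i := by omega
        rw [hρX, chartVec, Function.update_of_ne hne] at h1
        simp only [RingHom.comp_apply, RingHom.id_apply, σ, Polynomial.coe_eval₂RingHom,
          Polynomial.eval₂_X]
        exact congrArg (fun z : Polynomial k => z.coeff _) h1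
    exact fun f => ⟨σ f, congr($hinv f)⟩

lemma SpecMap_awayHom_chartVec (i : Fin 2) :
    P1.stdChart k i = Spec.map (CommRingCat.ofHom
      (awayHom (MvPolynomial.aeval (R := k) (chartVec k i)).toRingHom i
        (by rw [aeval_chartVec_self]; exact isUnit_one))) ≫ P1.awayι k i := by
  have hu : IsUnit (((RingHom.id (Polynomial k)).comp
      (MvPolynomial.aeval (R := k) ![chartVec k i 0, chartVec k i 1]).toRingHom)
        (MvPolynomial.X i)) := by
    rw [RingHom.id_comp, chartVec_eq, aeval_chartVec_self]; exact isUnit_one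
  have h := SpecMap_comp_point (RingHom.id (Polynomial k)) _ _ (isCoprime_chartVec i) i hu
  have hid : Spec.map (CommRingCat.ofHom (RingHom.id (Polynomial k))) = 𝟙 _ := Spec.map_id _
  rw [hid, Category.id_comp] at h
  refine h.trans ?_
  congr 4
  rw [RingHom.id_comp, chartVec_eq]

lemma isIso_SpecMap_of_bijective {R S : Type u} [CommRing R] [CommRing S] (f : R →+* S)
    (hf : Function.Bijective f) : IsIso (Spec.map (CommRingCat.ofHom f)) := by
  have : IsIso (CommRingCat.ofHom f) :=
    (RingEquiv.ofBijective f hf).toCommRingCatIso.isIso_hom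
  infer_instance

instance P1.isOpenImmersion_stdChart (i : Fin 2) : IsOpenImmersion (P1.stdChart k i) := by
  rw [SpecMap_awayHom_chartVec]
  have := isIso_SpecMap_of_bijective _ (bijective_awayHom_chartVec (k := k) i)
  infer_instance

lemma P1.opensRange_stdChart (i : Fin 2) : (P1.stdChart k i).opensRange = P1.basicOpen k i := by
  rw [← P1.opensRange_awayι]
  have := isIso_SpecMap_of_bijective _ (bijective_awayHom_chartVec (k := k) i)
  simp only [SpecMap_awayHom_chartVec]
  exact Scheme.Hom.opensRange_comp_of_isIso _ _

lemma P1.range_stdChart (i : Fin 2) : Set.range (P1.stdChart k i) = P1.basicOpen k i := by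
  rw [← P1.opensRange_stdChart]; rfl

/-- Functoriality of `P1.point`. -/
lemma P1.SpecMap_comp_point {S' : Type u} [CommRing S'] [Algebra k S'] (ψ : S →+* S')
    (hψ : ∀ c, ψ (algebraMap k S c) = algebraMap k S' c) (a b : S) (h : IsCoprime a b)
    (h' : IsCoprime (ψ a) (ψ b)) :
    Spec.map (CommRingCat.ofHom ψ) ≫ P1.point (k := k) a b h = P1.point (ψ a) (ψ b) h' := by
  have hρ : ψ.comp (MvPolynomial.aeval (R := k) ![a, b]).toRingHom =
      (MvPolynomial.aeval (R := k) ![ψ a, ψ b]).toRingHom := by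
    ext x
    · exact (congrArg ψ (MvPolynomial.aeval_C _ _)).trans
        ((hψ _).trans (MvPolynomial.aeval_C _ _).symm)
    · refine (congrArg ψ (MvPolynomial.aeval_X _ _)).trans
        (Eq.trans ?_ (MvPolynomial.aeval_X _ _).symm)
      fin_cases x <;> rfl
  have key : ∀ i, Spec.map (CommRingCat.ofHom
        (algebraMap S' (Localization.Away (![ψ a, ψ b] i)))) ≫
        Spec.map (CommRingCat.ofHom ψ) ≫ P1.point (k := k) a b h =
      Spec.map (CommRingCat.ofHom (algebraMap S' (Localization.Away (![ψ a, ψ b] i)))) ≫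
        P1.point (ψ a) (ψ b) h' := by
    intro i
    have hX : (MvPolynomial.aeval (R := k) ![ψ a, ψ b]).toRingHom (MvPolynomial.X i) =
      ![ψ a, ψ b] i := MvPolynomial.aeval_X _ _
    have hu : IsUnit (((algebraMap S' (Localization.Away (![ψ a, ψ b] i))).comp
        (MvPolynomial.aeval (R := k) ![ψ a, ψ b]).toRingHom) (MvPolynomial.X i)) := by
      rw [RingHom.comp_apply, hX]
      exact IsLocalization.Away.algebraMap_isUnit _
    rw [NaiveP1.SpecMap_comp_point _ _ _ h' i hu, ← Category.assoc, ← Spec.map_comp,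
      ← CommRingCat.ofHom_comp,
      NaiveP1.SpecMap_comp_point _ _ _ h i (by rwa [RingHom.comp_assoc, hρ])]
    congr 4
    rw [RingHom.comp_assoc, hρ]
  exact Spec_hom_ext_of_isCoprime h' (key 0) (key 1)

/-- Homogeneous coordinates are only defined up to scalars. -/
lemma P1.point_eq_of_mul_eq {a b c d : S} (h : IsCoprime a b) (h' : IsCoprime c d)
    (habcd : a * d = b * c) : P1.point (k := k) a b h = P1.point c d h' := by
  -- With `x c + y d = 1`, both quotients are `x a + y b`. Hence where a coordinate of the first
  -- point is invertible, so is that of the second, and both lie in the same chart.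
  have hdvd : ∀ {a b c d : S}, IsCoprime c d → a * d = b * c → c ∣ a ∧ d ∣ b := by
    rintro a b c d ⟨x, y, hxy⟩ he
    exact ⟨⟨x * a + y * b, by linear_combination -a * hxy + y * he⟩,
      ⟨x * a + y * b, by linear_combination -b * hxy - x * he⟩⟩
  obtain ⟨hca, hdb⟩ := hdvd h' habcd
  have key : ∀ i, Spec.map (CommRingCat.ofHom
        (algebraMap S (Localization.Away (![a, b] i)))) ≫ P1.point (k := k) a b h =
      Spec.map (CommRingCat.ofHom (algebraMap S (Localization.Away (![a, b] i)))) ≫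
        P1.point c d h' := by
    intro i
    have hX : ∀ (a b : S) j, (MvPolynomial.aeval (R := k) ![a, b]).toRingHom (MvPolynomial.X j) =
      ![a, b] j := fun a b j => MvPolynomial.aeval_X _ _
    have hu : IsUnit (((algebraMap S (Localization.Away (![a, b] i))).comp
        (MvPolynomial.aeval (R := k) ![a, b]).toRingHom) (MvPolynomial.X i)) := by
      rw [RingHom.comp_apply, hX]
      exact IsLocalization.Away.algebraMap_isUnit _
    have hu' : IsUnit (((algebraMap S (Localization.Away (![a, b] i))).comp
        (MvPolynomial.aeval (R := k) ![c, d]).toRingHom) (MvPolynomial.X i)) := by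
      rw [RingHom.comp_apply, hX] at hu ⊢
      refine isUnit_of_dvd_unit (map_dvd _ ?_) hu
      fin_cases i
      · exact hca
      · exact hdb
    rw [NaiveP1.SpecMap_comp_point _ _ _ h i hu, NaiveP1.SpecMap_comp_point _ _ _ h' i hu']
    congr 3
    refine awayHom_eq _ _ (fun x => ?_) (fun j => ?_)
    · have hC : ∀ a b : S, (MvPolynomial.aeval (R := k) ![a, b]).toRingHom (MvPolynomial.C x) =
        algebraMap k S x := fun a b => MvPolynomial.aeval_C _ _
      rw [RingHom.comp_apply, RingHom.comp_apply, hC, hC]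
    · simp only [RingHom.comp_apply, hX, ← map_mul]
      congr 1
      fin_cases i <;> fin_cases j <;> simp <;>
        first | ring1 | linear_combination habcd | linear_combination -habcd
  exact Spec_hom_ext_of_isCoprime h (key 0) (key 1)

lemma SpecMap_injective_of_comp_eq {R : Type u} [CommRing R] {S' : Type u} [CommRing S']
    {φ φ' : R →+* S'} (h : Spec.map (CommRingCat.ofHom φ) = Spec.map (CommRingCat.ofHom φ')) :
    φ = φ' :=
  congrArg CommRingCat.Hom.hom (Spec.map_injective h)

/-- Conversely, over a domain, homogeneous coordinates are unique up to scalars. -/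
lemma P1.mul_eq_of_point_eq [IsDomain S] {a b c d : S} (h : IsCoprime a b) (h' : IsCoprime c d)
    (he : P1.point (k := k) a b h = P1.point c d h') : a * d = b * c := by
  have hD : PrimeSpectrum.basicOpen b = PrimeSpectrum.basicOpen d := by
    have h1 := P1.point_preimage_basicOpen (k := k) a b h 1
    rw [he, P1.point_preimage_basicOpen] at h1
    exact h1.symm
  -- If `b` vanishes, equality of the preimages of `D₊(x₁)` forces `d` to vanish too. Otherwise the
  -- two points are compared through `a / b = c / d` after inverting `b`.
  by_cases hb : b = 0
  · have hd : d = 0 := by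
      rw [hb, PrimeSpectrum.basicOpen_zero] at hD
      exact (PrimeSpectrum.basicOpen_eq_bot_iff d).1 hD.symm |>.eq_zero
    rw [hb, hd, mul_zero, zero_mul]
  let L := Localization.Away b
  have hX : ∀ (a b : S) j, (MvPolynomial.aeval (R := k) ![a, b]).toRingHom (MvPolynomial.X j) =
    ![a, b] j := fun a b j => MvPolynomial.aeval_X _ _
  have hu : IsUnit (((algebraMap S L).comp
      (MvPolynomial.aeval (R := k) ![a, b]).toRingHom) (MvPolynomial.X 1)) := by
    rw [RingHom.comp_apply, hX]
    exact (IsLocalization.Away.algebraMap_isUnit b : IsUnit (algebraMap S L b))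
  have hu' : IsUnit (((algebraMap S L).comp
      (MvPolynomial.aeval (R := k) ![c, d]).toRingHom) (MvPolynomial.X 1)) := by
    rw [RingHom.comp_apply, hX] at hu ⊢
    obtain ⟨n, hn⟩ := (PrimeSpectrum.basicOpen_le_basicOpen_iff b d).1 hD.le
    refine isUnit_of_dvd_unit (map_dvd _ (Ideal.mem_span_singleton.1 hn)) ?_
    rw [map_pow]
    exact hu.pow n
  have h1 := NaiveP1.SpecMap_comp_point (algebraMap S L) _ _ h 1 hu
  rw [he, NaiveP1.SpecMap_comp_point _ _ _ h' 1 hu', cancel_mono] at h1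
  have h2 := SpecMap_injective_of_comp_eq h1
  have h3 := pow_mul_awayHom_mk _ 1 hu 1 (MvPolynomial.X 0) (X_mem_homogeneousSubmodule 0)
  have h4 := pow_mul_awayHom_mk _ 1 hu' 1 (MvPolynomial.X 0) (X_mem_homogeneousSubmodule 0)
  rw [h2] at h4
  simp only [RingHom.comp_apply, hX, Matrix.cons_val_zero, Matrix.cons_val_one, pow_one] at h3 h4
  have hinj : Function.Injective (algebraMap S L) :=
    IsLocalization.injective L (powers_le_nonZeroDivisors_of_noZeroDivisors hb)
  apply hinj
  rw [map_mul, map_mul, ← h3, ← h4]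
  ring

end Point

/-! ### Global coordinates over factorial rings -/

section Factorial

variable {k : Type u} [Field k] {S : Type u} [CommRing S] [Algebra k S]

lemma P1.exists_point_eq_of_range_subset (g : Spec (CommRingCat.of S) ⟶ P1 k)
    (hg : g ≫ P1.str k = Spec.map (CommRingCat.ofHom (algebraMap k S))) (i : Fin 2)
    (hr : Set.range g ⊆ P1.basicOpen k i) :
    ∃ (a b : S) (h : IsCoprime a b), ![a, b] i = 1 ∧ g = P1.point a b h := by
  rw [← P1.range_stdChart] at hr
  obtain ⟨φ, hφ⟩ : ∃ φ : Polynomial k →+* S,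
      Spec.map (CommRingCat.ofHom φ) ≫ P1.stdChart k i = g :=
    ⟨(Spec.preimage (IsOpenImmersion.lift _ g hr)).hom, by
      rw [CommRingCat.ofHom_hom, Spec.map_preimage, IsOpenImmersion.lift_fac]⟩
  have hC : ∀ c, φ (algebraMap k _ c) = algebraMap k S c := by
    rw [← hφ, Category.assoc, P1.stdChart, P1.point_comp_str, ← Spec.map_comp,
      ← CommRingCat.ofHom_comp] at hg
    exact fun c => congr($(SpecMap_injective_of_comp_eq hg) c)
  have hcop := (isCoprime_chartVec (k := k) i).map φ
  refine ⟨_, _, hcop, ?_, ?_⟩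
  · have h1 : chartVec k i i = 1 := by simp [chartVec]
    fin_cases i
    · exact (congrArg φ h1).trans (map_one φ)
    · exact (congrArg φ h1).trans (map_one φ)
  · rw [← hφ, P1.stdChart, P1.SpecMap_comp_point φ hC _ _ _ hcop]

/-- Near `x` the morphism lands in one chart, where one coordinate is `1`; clearing the denominator
of the other turns that `1` into a power of `h`. Keeping `p` and `q` in `S` itself lets different
neighbourhoods be compared. -/
lemma P1.exists_local_point (g : Spec (CommRingCat.of S) ⟶ P1 k)
    (hg : g ≫ P1.str k = Spec.map (CommRingCat.ofHom (algebraMap k S))) (x : PrimeSpectrum S) :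
    ∃ (h p q : S) (i : Fin 2) (n : ℕ), h ∉ x.asIdeal ∧ ![p, q] i = h ^ n ∧
      ∃ hpq : IsCoprime (algebraMap S (Localization.Away h) p) (algebraMap S _ q),
        Spec.map (CommRingCat.ofHom (algebraMap S (Localization.Away h))) ≫ g =
          P1.point _ _ hpq := by
  obtain ⟨i, hi⟩ := P1.exists_mem_basicOpen (g x)
  let U : Set (PrimeSpectrum S) := (g ⁻¹ᵁ P1.basicOpen k i).carrier
  have hU : IsOpen U := (g ⁻¹ᵁ P1.basicOpen k i).2
  obtain ⟨_, ⟨h, rfl⟩, hxh, hsub⟩ :=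
    PrimeSpectrum.isTopologicalBasis_basic_opens.exists_subset_of_mem_open
      (show x ∈ U from hi) hU
  set L := Localization.Away h with hL
  obtain ⟨a, b, hab, h1, hg1⟩ := P1.exists_point_eq_of_range_subset (S := L)
    (Spec.map (CommRingCat.ofHom (algebraMap S L)) ≫ g)
    (by rw [Category.assoc, hg, ← Spec.map_comp, ← CommRingCat.ofHom_comp,
      ← IsScalarTower.algebraMap_eq]) i (by
      rintro _ ⟨y, rfl⟩
      change Spec.map (CommRingCat.ofHom (algebraMap S L)) y ∈ U
      apply hsub
      change Spec.map (CommRingCat.ofHom (algebraMap S L)) y ∈ PrimeSpectrum.basicOpen h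
      intro hy
      exact y.2.ne_top (Ideal.eq_top_of_isUnit_mem _ hy
        (IsLocalization.Away.algebraMap_isUnit h)))
  have hsurj : ∀ z : L, ∃ (n : ℕ) (p : S), z * algebraMap S L (h ^ n) = algebraMap S L p := by
    intro z
    obtain ⟨n, p, hp⟩ := IsLocalization.Away.surj h z
    exact ⟨n, p, by rw [map_pow, hp]⟩
  have hunit : ∀ n, IsUnit (algebraMap S L (h ^ n)) := fun n => by
    rw [map_pow]; exact (IsLocalization.Away.algebraMap_isUnit h).pow n
  fin_cases i
  · obtain ⟨n, p, hp⟩ := hsurj b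
    have ha : a = 1 := h1
    refine ⟨h, h ^ n, p, 0, n, hxh, rfl, (isCoprime_one_left (x := algebraMap S L p)).of_isCoprime_of_dvd_left (hunit n).dvd, ?_⟩
    rw [hg1]
    exact P1.point_eq_of_mul_eq _ _ (by rw [ha, one_mul, hp])
  · obtain ⟨n, p, hp⟩ := hsurj a
    have hb : b = 1 := h1
    refine ⟨h, p, h ^ n, 1, n, hxh, rfl, (isCoprime_one_right (x := algebraMap S L p)).of_isCoprime_of_dvd_right (hunit n).dvd, ?_⟩
    rw [hg1]
    exact P1.point_eq_of_mul_eq _ _ (by rw [hb, one_mul, hp])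

variable [IsDomain S]

/-- Morphisms from a factorial affine scheme to the projective line have global homogeneous
coordinates. -/
lemma P1.exists_point_eq [UniqueFactorizationMonoid S] (g : Spec (CommRingCat.of S) ⟶ P1 k)
    (hg : g ≫ P1.str k = Spec.map (CommRingCat.ofHom (algebraMap k S))) :
    ∃ (a b : S) (h : IsCoprime a b), g = P1.point a b h := by
  classical
  choose h p q i n hx hi hpq hloc using P1.exists_local_point g hg
  let K := FractionRing S
  have hne : ∀ x, h x ≠ 0 := fun x h0 => hx x (h0 ▸ x.asIdeal.zero_mem)
  have hK : ∀ x, ∃ hpq' : IsCoprime (algebraMap S K (p x)) (algebraMap S K (q x)),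
      Spec.map (CommRingCat.ofHom (algebraMap S K)) ≫ g = P1.point _ _ hpq' := by
    intro x
    have hu : IsUnit (algebraMap S K (h x)) :=
      isUnit_iff_ne_zero.2 fun h0 => hne x ((FaithfulSMul.algebraMap_eq_zero_iff S K).1 h0)
    let ψ : Localization.Away (h x) →+* K := IsLocalization.Away.lift (h x) hu
    have hψ : ∀ s, ψ (algebraMap S _ s) = algebraMap S K s := IsLocalization.Away.lift_eq _ _
    have hcop := (hpq x).map ψ
    rw [hψ, hψ] at hcop
    refine ⟨hcop, ?_⟩
    have h1 : (algebraMap S K) = ψ.comp (algebraMap S (Localization.Away (h x))) := by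
      ext s; exact (hψ s).symm
    have h2 : Spec.map (CommRingCat.ofHom (algebraMap S K)) ≫ g =
        Spec.map (CommRingCat.ofHom ψ) ≫
          Spec.map (CommRingCat.ofHom (algebraMap S (Localization.Away (h x)))) ≫ g := by
      rw [h1, CommRingCat.ofHom_comp, Spec.map_comp, Category.assoc]
    rw [h2, hloc x, P1.SpecMap_comp_point ψ (fun c => ?_) _ _ _ ((hpq x).map ψ)]
    · simp only [hψ]
    · rw [IsScalarTower.algebraMap_apply k S (Localization.Away (h x)), hψ,
        ← IsScalarTower.algebraMap_apply]
  -- All local coordinates describe the same point over the fraction field.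
  have hcross : ∀ x y, p x * q y = q x * p y := by
    intro x y
    obtain ⟨h1, e1⟩ := hK x
    obtain ⟨h2, e2⟩ := hK y
    apply IsFractionRing.injective S K
    rw [map_mul, map_mul]
    exact P1.mul_eq_of_point_eq h1 h2 (e1.symm.trans e2)
  let x₀ : PrimeSpectrum S := ⟨⊥, Ideal.isPrime_bot⟩
  -- Factoriality enters here: one local pair is divided by its greatest common divisor, and the
  -- result serves globally.
  obtain ⟨a, b, c, hrel, hca, hcb⟩ : ∃ a b c, IsRelPrime a b ∧ c * a = p x₀ ∧ c * b = q x₀ := by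
    by_cases hp : p x₀ = 0
    · refine UniqueFactorizationMonoid.exists_reduced_factors' _ _ ?_
      have h1 := hi x₀
      have h2 : h x₀ ^ n x₀ ≠ 0 := pow_ne_zero _ (hne x₀)
      intro hq
      rw [← h1, hp, hq] at h2
      revert h2
      generalize i x₀ = j
      fin_cases j <;> simp
    · exact UniqueFactorizationMonoid.exists_reduced_factors _ hp _
  have hc0 : c ≠ 0 := by
    rintro rfl
    have h2 : h x₀ ^ n x₀ ≠ 0 := pow_ne_zero _ (hne x₀)
    rw [← hi x₀, ← hca, ← hcb] at h2
    revert h2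
    generalize i x₀ = j
    fin_cases j <;> simp
  have hab : ∀ x, p x * b = q x * a := by
    intro x
    apply mul_left_cancel₀ hc0
    have := hcross x x₀
    rw [← hca, ← hcb] at this
    linear_combination this
  -- Relative primality gives `a ∣ p x` and `b ∣ q x`. A maximal ideal containing `a` and `b` would
  -- therefore contain both local coordinates there, one of which is a power of `h x`.
  have hcop : IsCoprime a b := by
    by_contra hn
    have htop : Ideal.span {a, b} ≠ ⊤ := fun h1 =>
      hn (Ideal.mem_span_pair.1 (h1 ▸ Submodule.mem_top : (1 : S) ∈ _))
    obtain ⟨m, hm, hle⟩ := Ideal.exists_le_maximal _ htop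
    let x : PrimeSpectrum S := ⟨m, hm.isPrime⟩
    have ha : a ∈ m := hle (Ideal.subset_span (by simp))
    have hb : b ∈ m := hle (Ideal.subset_span (by simp))
    have hpx : p x ∈ m := Ideal.mem_of_dvd m
      (hrel.dvd_of_dvd_mul_right ((Dvd.intro_left _ rfl).trans (hab x).symm.dvd)) ha
    have hqx : q x ∈ m := Ideal.mem_of_dvd m
      (hrel.symm.dvd_of_dvd_mul_right ((Dvd.intro_left _ rfl).trans (hab x).dvd)) hb
    apply hx x
    apply hm.isPrime.mem_of_pow_mem (n x)
    rw [← hi x]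
    generalize i x = j
    fin_cases j
    · exact hpx
    · exact hqx
  refine ⟨a, b, hcop, Spec_hom_ext_of_span_eq_top h ?_ fun x => ?_⟩
  · by_contra htop
    obtain ⟨m, hm, hle⟩ := Ideal.exists_le_maximal _ htop
    exact hx ⟨m, hm.isPrime⟩ (hle (Ideal.subset_span ⟨_, rfl⟩))
  · rw [hloc x, P1.SpecMap_comp_point _ (fun c => (IsScalarTower.algebraMap_apply k S _ c).symm)
      _ _ _ (hcop.map _)]
    exact P1.point_eq_of_mul_eq _ _ (by rw [← map_mul, ← map_mul, hab])

end Factorial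

/-! ### The cylinder `ℙ¹ × 𝔸¹` and its two affine charts -/

section PolynomialPushout

attribute [local instance] Polynomial.algebra

lemma isPullback_SpecMap_mapRingHom (R S : Type u) [CommRing R] [CommRing S] [Algebra R S] :
    IsPullback (Spec.map (CommRingCat.ofHom (Polynomial.mapRingHom (algebraMap R S))))
      (Spec.map (CommRingCat.ofHom (Polynomial.C : S →+* Polynomial S)))
      (Spec.map (CommRingCat.ofHom (Polynomial.C : R →+* Polynomial R)))
      (Spec.map (CommRingCat.ofHom (algebraMap R S))) :=
  isPullback_SpecMap_of_isPushout _ _ _ _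
    (CommRingCat.isPushout_of_isPushout R (Polynomial R) S (Polynomial S))

end PolynomialPushout

section Cylinder

variable {k : Type u} [Field k]

lemma P1.stdChart_comp_str (i : Fin 2) : P1.stdChart k i ≫ P1.str k =
    Spec.map (CommRingCat.ofHom (Polynomial.C : k →+* Polynomial k)) :=
  P1.point_comp_str _ _ _

/-- The chart `𝔸¹ × 𝔸¹ ⟶ ℙ¹ × 𝔸¹` lying over the `i`-th chart of the projective line. -/
def Cylinder.chart (k : Type u) [Field k] (i : Fin 2) :
    Spec (CommRingCat.of (Polynomial (Polynomial k))) ⟶ Cylinder k :=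
  pullback.lift (Spec.map (CommRingCat.ofHom
      (Polynomial.mapRingHom (Polynomial.C : k →+* Polynomial k))) ≫ P1.stdChart k i)
    (Spec.map (CommRingCat.ofHom (Polynomial.C : Polynomial k →+* Polynomial (Polynomial k)))) (by
      rw [Category.assoc, P1.stdChart_comp_str, A1.str, ← Spec.map_comp, ← Spec.map_comp,
        ← CommRingCat.ofHom_comp, ← CommRingCat.ofHom_comp, Polynomial.mapRingHom_comp_C])

lemma Cylinder.chart_fst (i : Fin 2) : Cylinder.chart k i ≫ pullback.fst _ _ =
    Spec.map (CommRingCat.ofHom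
      (Polynomial.mapRingHom (Polynomial.C : k →+* Polynomial k))) ≫ P1.stdChart k i :=
  pullback.lift_fst _ _ _

lemma Cylinder.chart_snd (i : Fin 2) : Cylinder.chart k i ≫ pullback.snd _ _ =
    Spec.map (CommRingCat.ofHom (Polynomial.C : Polynomial k →+* Polynomial (Polynomial k))) :=
  pullback.lift_snd _ _ _

/-- By pasting with the square defining the cylinder, this follows from the fact that polynomial
rings commute with base change. It makes the chart an open immersion. -/
lemma Cylinder.isPullback_chart (i : Fin 2) :
    IsPullback (Cylinder.chart k i) (Spec.map (CommRingCat.ofHom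
      (Polynomial.mapRingHom (Polynomial.C : k →+* Polynomial k))))
      (pullback.fst (P1.str k) (A1.str k)) (P1.stdChart k i) := by
  refine IsPullback.of_right (t := (IsPullback.of_hasPullback (P1.str k) (A1.str k)).flip) ?_
    (Cylinder.chart_fst i) 
  rw [Cylinder.chart_snd, P1.stdChart_comp_str]
  exact (isPullback_SpecMap_mapRingHom k (Polynomial k)).flip

instance Cylinder.isOpenImmersion_chart (i : Fin 2) : IsOpenImmersion (Cylinder.chart k i) :=
  MorphismProperty.of_isPullback (P := @IsOpenImmersion) (Cylinder.isPullback_chart i).flip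
    (P1.isOpenImmersion_stdChart i)

lemma Cylinder.opensRange_chart (i : Fin 2) : (Cylinder.chart k i).opensRange =
    pullback.fst (P1.str k) (A1.str k) ⁻¹ᵁ P1.basicOpen k i := by
  rw [← P1.opensRange_stdChart]
  have h := Cylinder.isPullback_chart (k := k) i
  have e := Scheme.Hom.opensRange_comp_of_isIso h.isoPullback.hom
    (pullback.fst (pullback.fst (P1.str k) (A1.str k)) (P1.stdChart k i))
  simp only [h.isoPullback_hom_fst] at e
  rw [← Scheme.Hom.opensRange_pullbackFst, ← e]

lemma Cylinder.exists_mem_range_chart (x : Cylinder k) :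
    ∃ i, x ∈ Set.range (Cylinder.chart k i) := by
  obtain ⟨i, hi⟩ := P1.exists_mem_basicOpen (pullback.fst (P1.str k) (A1.str k) x)
  refine ⟨i, ?_⟩
  have : x ∈ (Cylinder.chart k i).opensRange := by
    rw [Cylinder.opensRange_chart]; exact hi
  exact this

lemma P1.exists_mem_range_stdChart (x : P1 k) : ∃ i, x ∈ Set.range (P1.stdChart k i) := by
  obtain ⟨i, hi⟩ := P1.exists_mem_basicOpen x
  exact ⟨i, by rw [P1.range_stdChart]; exact hi⟩

/-- A jointly surjective pair of open immersions, as an open cover. -/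
def coverOfPair {Z : Scheme.{u}} {U : Fin 2 → Scheme.{u}} (j : ∀ i, U i ⟶ Z)
    [∀ i, IsOpenImmersion (j i)] (h : ∀ x, ∃ i, x ∈ Set.range (j i)) : Z.OpenCover where
  I₀ := Fin 2
  X := U
  f := j
  mem₀ := by
    rw [Scheme.presieve₀_mem_precoverage_iff]
    exact ⟨h, inferInstance⟩

/-- Allowing any model `W` of the overlap means that compatibility need only be tested on `Spec` of
a Laurent polynomial ring. -/
lemma exists_glue_of_pair {Z Y W : Scheme.{u}} {U : Fin 2 → Scheme.{u}} (j : ∀ i, U i ⟶ Z)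
    [∀ i, IsOpenImmersion (j i)] (h : ∀ x, ∃ i, x ∈ Set.range (j i))
    {p : W ⟶ U 0} {q : W ⟶ U 1} (hW : IsPullback p q (j 0) (j 1))
    (f : ∀ i, U i ⟶ Y) (hf : p ≫ f 0 = q ≫ f 1) :
    ∃ F : Z ⟶ Y, ∀ i, j i ≫ F = f i := by
  have h01 : pullback.fst (j 0) (j 1) ≫ f 0 = pullback.snd (j 0) (j 1) ≫ f 1 := by
    rw [← cancel_epi hW.isoPullback.hom, hW.isoPullback_hom_fst_assoc,
      hW.isoPullback_hom_snd_assoc, hf]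
  have hsame : ∀ i, pullback.fst (j i) (j i) = pullback.snd (j i) (j i) := fun i => by
    rw [← cancel_mono (j i), pullback.condition]
  refine ⟨(coverOfPair j h).glueMorphisms f ?_, fun i =>
    (coverOfPair j h).ι_glueMorphisms f _ i⟩
  intro x y
  change Fin 2 at x y
  change pullback.fst (j x) (j y) ≫ f x = pullback.snd (j x) (j y) ≫ f y
  fin_cases x <;> fin_cases y
  · exact congrArg (· ≫ f 0) (hsame 0)
  · exact h01
  · change pullback.fst (j 1) (j 0) ≫ f 1 = pullback.snd (j 1) (j 0) ≫ f 0
    rw [← cancel_epi (pullbackSymmetry (j 0) (j 1)).hom, pullbackSymmetry_hom_comp_fst_assoc,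
      pullbackSymmetry_hom_comp_snd_assoc, h01]
  · exact congrArg (· ≫ f 1) (hsame 1)

/-- The slice `ℙ¹ × {t}` in the standard charts. -/
lemma Cylinder.stdChart_comp_slice (t : k) (i : Fin 2) :
    P1.stdChart k i ≫ Cylinder.slice t = Spec.map (CommRingCat.ofHom
      (Polynomial.mapRingHom (Polynomial.evalRingHom t))) ≫ Cylinder.chart k i := by
  apply pullback.hom_ext
  · rw [Category.assoc, Category.assoc, Cylinder.chart_fst, Cylinder.slice, pullback.lift_fst,
      Category.comp_id, ← Category.assoc, ← Spec.map_comp, ← CommRingCat.ofHom_comp]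
    have : (Polynomial.mapRingHom (Polynomial.evalRingHom t)).comp
        (Polynomial.mapRingHom (Polynomial.C : k →+* Polynomial k)) = RingHom.id _ := by
      ext <;> simp
    rw [this]
    exact (Category.id_comp _).symm.trans (congrArg (· ≫ _) (Spec.map_id _).symm)
  · rw [Category.assoc, Category.assoc, Cylinder.chart_snd, Cylinder.slice, pullback.lift_snd,
      ← Category.assoc, P1.stdChart_comp_str, A1.point, ← Spec.map_comp, ← Spec.map_comp,
      ← CommRingCat.ofHom_comp, ← CommRingCat.ofHom_comp]
    congr 2
    ext x <;> simp

lemma mapRingHom_C_algebraMap (c : k) :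
    Polynomial.mapRingHom (Polynomial.C : k →+* Polynomial k) (algebraMap k (Polynomial k) c) =
      algebraMap k (Polynomial (Polynomial k)) c := by
  rw [Polynomial.algebraMap_apply, Polynomial.coe_mapRingHom, Polynomial.map_C]
  rfl

/-- The standard coordinates of the charts of `ℙ¹ × 𝔸¹`. -/
def cylVec (k : Type u) [Field k] (i : Fin 2) : Fin 2 → Polynomial (Polynomial k) :=
  Function.update (fun _ => Polynomial.X) i 1

lemma mapRingHom_chartVec (i j : Fin 2) :
    Polynomial.mapRingHom (Polynomial.C : k →+* Polynomial k) (chartVec k i j) = cylVec k i j := by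
  by_cases h : j = i
  · subst h; simp [chartVec, cylVec]
  · simp [chartVec, cylVec, h]

lemma isCoprime_cylVec (i : Fin 2) : IsCoprime (cylVec k i 0) (cylVec k i 1) := by
  rw [← mapRingHom_chartVec, ← mapRingHom_chartVec]
  exact (isCoprime_chartVec i).map _

lemma Cylinder.chart_fst_eq (i : Fin 2) : Cylinder.chart k i ≫ pullback.fst _ _ =
    P1.point (k := k) (cylVec k i 0) (cylVec k i 1) (isCoprime_cylVec i) := by
  rw [Cylinder.chart_fst, P1.stdChart,
    P1.SpecMap_comp_point _ mapRingHom_C_algebraMap _ _ _ ((isCoprime_chartVec i).map _)]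
  simp only [mapRingHom_chartVec]

end Cylinder

/-! ### Pairs of polynomials without common zero, and reflection -/

section Good

open Polynomial

/-- A pair of polynomials of degree at most `n` over `R` without common zero, even at infinity. -/
structure Good {R : Type u} [CommRing R] (n : ℕ) (A B : R[X]) : Prop where
  natDegree_left : A.natDegree ≤ n
  natDegree_right : B.natDegree ≤ n
  isCoprime : IsCoprime A B
  isCoprime_reflect : IsCoprime (A.reflect n) (B.reflect n)

variable {R : Type u} [CommRing R]

/-- The localization `R[X, X⁻¹]`. -/
abbrev LaurentRing (R : Type u) [CommRing R] : Type u := Localization.Away (X : R[X])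

/-- The homomorphism `R[X] → R[X, X⁻¹]` sending `X` to `X⁻¹`. -/
def invHom (R : Type u) [CommRing R] : R[X] →+* LaurentRing R :=
  eval₂RingHom ((algebraMap R[X] (LaurentRing R)).comp C)
    (IsLocalization.Away.invSelf (X : R[X]))

lemma invHom_C (r : R) : invHom R (C r) = algebraMap R[X] _ (C r) := by simp [invHom]

lemma algebraMap_X_mul_invHom_X : algebraMap R[X] (LaurentRing R) X * invHom R X = 1 := by
  simp [invHom, IsLocalization.Away.mul_invSelf]

/-- Reflection is the change of chart `X ↦ X⁻¹` with the denominator `X ^ n` cleared. -/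
lemma pow_mul_invHom {f : R[X]} {n : ℕ} (hf : f.natDegree ≤ n) :
    algebraMap R[X] (LaurentRing R) X ^ n * invHom R f =
      algebraMap R[X] _ (f.reflect n) := by
  let u : (LaurentRing R)ˣ := ⟨invHom R X, algebraMap R[X] _ X,
    by rw [mul_comm, algebraMap_X_mul_invHom_X], algebraMap_X_mul_invHom_X⟩
  let : Invertible (invHom R X) := u.invertible
  have h := eval₂_reflect_mul_pow ((algebraMap R[X] (LaurentRing R)).comp C) (invHom R X) n f hf
  have h1 : ⅟(invHom R X) = algebraMap R[X] _ X := rfl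
  have h2 : ∀ g : R[X], eval₂ ((algebraMap R[X] (LaurentRing R)).comp C) (algebraMap R[X] _ X) g =
      algebraMap R[X] _ g := fun g => by
    rw [← hom_eval₂, eval₂_C_X]
  rw [h1, h2] at h
  have h3 : eval₂ ((algebraMap R[X] (LaurentRing R)).comp C) (invHom R X) f = invHom R f := by
    simp [invHom]
  rw [h3] at h
  rw [← h, mul_left_comm, ← mul_pow, algebraMap_X_mul_invHom_X, one_pow, mul_one]

lemma reflect_reflect (f : R[X]) (n : ℕ) : (f.reflect n).reflect n = f := by
  ext i
  rw [coeff_reflect, coeff_reflect, revAt_invol]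

lemma reflect_natDegree_le {f : R[X]} {n : ℕ} (hf : f.natDegree ≤ n) :
    (f.reflect n).natDegree ≤ n := by
  rw [natDegree_le_iff_coeff_eq_zero]
  intro m hm
  rw [coeff_reflect, revAt_eq_self_of_lt hm]
  exact coeff_eq_zero_of_natDegree_lt (hf.trans_lt hm)

/-- The hypothesis says that `(a, b)` and `(a', b')` agree on the overlap of the charts. The
reflected second pair is then `w (a, b)`, and it suffices that `w` is a unit. -/
lemma good_of_reflect_mul_eq [IsDomain R] {a b a' b' : R[X]} (h : IsCoprime a b)
    (h' : IsCoprime a' b')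
    (he : a'.reflect (max a'.natDegree b'.natDegree) * b =
      b'.reflect (max a'.natDegree b'.natDegree) * a) :
    Good (max a'.natDegree b'.natDegree) a b := by
  set N := max a'.natDegree b'.natDegree with hN
  have hNa : a'.natDegree ≤ N := le_max_left _ _
  have hNb : b'.natDegree ≤ N := le_max_right _ _
  obtain ⟨x, y, hxy⟩ := h
  obtain ⟨w, ha, hb⟩ : ∃ w, a'.reflect N = w * a ∧ b'.reflect N = w * b :=
    ⟨x * a'.reflect N + y * b'.reflect N, by linear_combination (-a'.reflect N) * hxy + y * he,
      by linear_combination (-b'.reflect N) * hxy - x * he⟩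
  obtain ⟨u, v, huv⟩ := id h'
  -- Reflecting a Bézout relation for `(a', b')` replaces `1` by a power of `X`.
  have hw : w ∣ X ^ (max u.natDegree v.natDegree + N) := by
    have h1 := congrArg (reflect (max u.natDegree v.natDegree + N)) huv
    rw [reflect_add, reflect_mul _ _ (le_max_left _ _) hNa, reflect_mul _ _ (le_max_right _ _) hNb,
      ha, hb, ← C_1, reflect_C, C_1, one_mul] at h1
    exact ⟨reflect (max u.natDegree v.natDegree) u * a + reflect (max u.natDegree v.natDegree) v * b,
      by rw [← h1]; ring⟩
  -- Otherwise `a'` and `b'` would both have zero coefficient in degree `N`, the larger of their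
  -- degrees.
  have hX : ¬ X ∣ w := by
    intro hXw
    have h1 : a'.coeff N = 0 := by
      have := X_dvd_iff.1 (hXw.trans (Dvd.intro _ ha.symm))
      rwa [coeff_reflect, revAt_le (Nat.zero_le _), Nat.sub_zero] at this
    have h2 : b'.coeff N = 0 := by
      have := X_dvd_iff.1 (hXw.trans (Dvd.intro _ hb.symm))
      rwa [coeff_reflect, revAt_le (Nat.zero_le _), Nat.sub_zero] at this
    rcases max_choice a'.natDegree b'.natDegree with h3 | h3
    · rw [hN, h3, coeff_natDegree, leadingCoeff_eq_zero] at h1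
      have hN0 : N = 0 := by rw [hN, h3, h1, natDegree_zero]
      have hb0 : b' = 0 := by
        rw [eq_C_of_natDegree_le_zero (hNb.trans hN0.le), ← hN0, h2, C_0]
      rw [h1, hb0] at h'
      exact not_isCoprime_zero_zero h'
    · rw [hN, h3, coeff_natDegree, leadingCoeff_eq_zero] at h2
      have hN0 : N = 0 := by rw [hN, h3, h2, natDegree_zero]
      have hb0 : a' = 0 := by
        rw [eq_C_of_natDegree_le_zero (hNa.trans hN0.le), ← hN0, h1, C_0]
      rw [h2, hb0] at h'
      exact not_isCoprime_zero_zero h'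
  have hwu : IsUnit w := by
    obtain ⟨i, -, hi⟩ := (dvd_prime_pow prime_X _).1 hw
    rcases Nat.eq_zero_or_pos i with h0 | h0
    · rw [h0, pow_zero] at hi
      exact associated_one_iff_isUnit.1 hi
    · exact absurd ((dvd_pow_self X h0.ne').trans hi.symm.dvd) hX
  obtain ⟨c, hc, rfl⟩ := Polynomial.isUnit_iff.1 hwu
  have hdeg : ∀ f : R[X], (C c * f).natDegree = f.natDegree := fun f =>
    natDegree_C_mul_of_isUnit hc f
  refine ⟨?_, ?_, ⟨x, y, hxy⟩, ?_⟩
  · rw [← hdeg, ← ha]; exact reflect_natDegree_le hNa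
  · rw [← hdeg, ← hb]; exact reflect_natDegree_le hNb
  · have ha2 := congrArg (reflect N) ha
    have hb2 := congrArg (reflect N) hb
    rw [reflect_reflect, reflect_C_mul] at ha2 hb2
    rw [ha2, hb2] at h'
    exact h'.of_mul_left_right.of_mul_right_right

end Good

/-! ### Morphisms `ℙ¹ × 𝔸¹ ⟶ ℙ¹` as pairs over `k[T]` -/

section Classification
open Polynomial 
variable {k : Type u} [Field k]

lemma hom_ext_of_pair {Z Y : Scheme.{u}} {U : Fin 2 → Scheme.{u}} (j : ∀ i, U i ⟶ Z)
    [∀ i, IsOpenImmersion (j i)] (h : ∀ x, ∃ i, x ∈ Set.range (j i)) {f g : Z ⟶ Y}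
    (hfg : ∀ i, j i ≫ f = j i ≫ g) : f = g :=
  (coverOfPair j h).hom_ext _ _ hfg

lemma Cylinder.chart_overlap :
    Spec.map (CommRingCat.ofHom (invHom k[X])) ≫ Cylinder.chart k 0 =
      Spec.map (CommRingCat.ofHom (algebraMap k[X][X] (LaurentRing k[X]))) ≫
        Cylinder.chart k 1 := by
  have hinv : ∀ c, invHom k[X] (algebraMap k k[X][X] c) = algebraMap k (LaurentRing k[X]) c := by
    intro c
    rw [IsScalarTower.algebraMap_apply k k[X] k[X][X], algebraMap_eq, invHom_C, ← algebraMap_eq,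
      ← IsScalarTower.algebraMap_apply, ← IsScalarTower.algebraMap_apply]
  apply pullback.hom_ext
  · rw [Category.assoc, Category.assoc, Cylinder.chart_fst_eq, Cylinder.chart_fst_eq,
      P1.SpecMap_comp_point _ hinv _ _ _ ((isCoprime_cylVec 0).map _),
      P1.SpecMap_comp_point _ (fun c => (IsScalarTower.algebraMap_apply k _ _ c).symm) _ _ _
        ((isCoprime_cylVec 1).map _)]
    apply P1.point_eq_of_mul_eq
    simp [cylVec]
    rw [mul_comm, algebraMap_X_mul_invHom_X]
  · rw [Category.assoc, Category.assoc, Cylinder.chart_snd, Cylinder.chart_snd, ← Spec.map_comp,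
      ← Spec.map_comp, ← CommRingCat.ofHom_comp, ← CommRingCat.ofHom_comp]
    congr 2
    ext x
    · simp [invHom_C]
    · simp [invHom_C]

/-- Inside the second chart, the preimage of the first is the locus where the coordinate `X` is
invertible. -/
lemma Cylinder.isPullback_overlap :
    IsPullback (Spec.map (CommRingCat.ofHom (invHom k[X])))
      (Spec.map (CommRingCat.ofHom (algebraMap k[X][X] (LaurentRing k[X]))))
      (Cylinder.chart k 0) (Cylinder.chart k 1) := by
  have : IsOpenImmersion (Spec.map (CommRingCat.ofHom
      (algebraMap k[X][X] (LaurentRing k[X])))) := IsOpenImmersion.of_isLocalization (X : k[X][X])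
  refine IsOpenImmersion.isPullback _ _ _ _ Cylinder.chart_overlap.symm ?_
  have h1 : Cylinder.chart k 1 ⁻¹ᵁ (Cylinder.chart k 0).opensRange =
      PrimeSpectrum.basicOpen (X : k[X][X]) := by
    rw [Cylinder.opensRange_chart, ← Scheme.Hom.comp_preimage, Cylinder.chart_fst_eq,
      P1.point_preimage_basicOpen]
    simp only [cylVec, Matrix.cons_val_zero]
    rfl
  rw [h1]
  apply TopologicalSpace.Opens.ext
  exact (PrimeSpectrum.localization_away_comap_range (LaurentRing k[X]) (X : k[X][X])).symm

lemma algebraMap_laurent_injective (R : Type u) [CommRing R] [IsDomain R] :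
    Function.Injective (algebraMap R[X] (LaurentRing R)) :=
  IsLocalization.injective _ (powers_le_nonZeroDivisors_of_noZeroDivisors X_ne_zero)

instance (R : Type u) [CommRing R] [IsDomain R] : IsDomain (LaurentRing R) :=
  IsLocalization.isDomain_localization (powers_le_nonZeroDivisors_of_noZeroDivisors X_ne_zero)

lemma invHom_algebraMap (R : Type u) [CommRing R] [Algebra k R] (c : k) :
    invHom R (algebraMap k R[X] c) = algebraMap k (LaurentRing R) c := by
  rw [IsScalarTower.algebraMap_apply k R R[X], algebraMap_eq, invHom_C, ← algebraMap_eq,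
    ← IsScalarTower.algebraMap_apply, ← IsScalarTower.algebraMap_apply]

/-- A morphism `ℙ¹ × 𝔸¹ ⟶ ℙ¹` is given by a pair of polynomials over `k[T]`. -/
lemma Cylinder.exists_good (F : Cylinder k ⟶ P1 k)
    (hF : F ≫ P1.str k = pullback.fst (P1.str k) (A1.str k) ≫ P1.str k) :
    ∃ (n : ℕ) (A B : k[X][X]) (h : Good n A B),
      Cylinder.chart k 1 ≫ F = P1.point (k := k) A B h.isCoprime := by
  have hstr : ∀ i, (Cylinder.chart k i ≫ F) ≫ P1.str k =
      Spec.map (CommRingCat.ofHom (algebraMap k k[X][X])) := fun i => by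
    rw [Category.assoc, hF, ← Category.assoc, Cylinder.chart_fst_eq, P1.point_comp_str]
  obtain ⟨a, b, h, e⟩ := P1.exists_point_eq _ (hstr 1)
  obtain ⟨a', b', h', e'⟩ := P1.exists_point_eq _ (hstr 0)
  have hL := congrArg (· ≫ F) (Cylinder.chart_overlap (k := k))
  simp only [Category.assoc, e, e'] at hL
  rw [P1.SpecMap_comp_point _ (invHom_algebraMap _) _ _ _ (h'.map _),
    P1.SpecMap_comp_point _ (fun c => (IsScalarTower.algebraMap_apply k _ _ c).symm) _ _ _
      (h.map _)] at hL
  have hL' := P1.mul_eq_of_point_eq _ _ hL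
  have hgood := good_of_reflect_mul_eq h h' (by
    apply algebraMap_laurent_injective
    rw [map_mul, map_mul, ← pow_mul_invHom (le_max_left _ _), ← pow_mul_invHom (le_max_right _ _)]
    linear_combination (algebraMap k[X][X] (LaurentRing k[X]) X ^
      max a'.natDegree b'.natDegree) * hL')
  exact ⟨_, a, b, hgood, e⟩

/-- Conversely, such a pair defines a morphism `ℙ¹ × 𝔸¹ ⟶ ℙ¹`. -/
lemma Cylinder.exists_hom_of_good {n : ℕ} {A B : k[X][X]} (h : Good n A B) :
    ∃ F : Cylinder k ⟶ P1 k,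
      F ≫ P1.str k = pullback.fst (P1.str k) (A1.str k) ≫ P1.str k ∧
      Cylinder.chart k 1 ≫ F = P1.point (k := k) A B h.isCoprime := by
  let f : ∀ _ : Fin 2, Spec (CommRingCat.of k[X][X]) ⟶ P1 k :=
    fun i => if i = 0 then P1.point _ _ h.isCoprime_reflect else P1.point A B h.isCoprime
  have hf0 : f 0 = P1.point _ _ h.isCoprime_reflect := rfl
  have hf1 : f 1 = P1.point _ _ h.isCoprime := rfl
  obtain ⟨F, hF⟩ := exists_glue_of_pair (Cylinder.chart k) Cylinder.exists_mem_range_chart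
    Cylinder.isPullback_overlap f (by
      rw [hf0, hf1, P1.SpecMap_comp_point _ (invHom_algebraMap _) _ _ _
        (h.isCoprime_reflect.map _),
        P1.SpecMap_comp_point _ (fun c => (IsScalarTower.algebraMap_apply k _ _ c).symm) _ _ _
        (h.isCoprime.map _)]
      apply P1.point_eq_of_mul_eq
      have hA := pow_mul_invHom (reflect_natDegree_le h.natDegree_left)
      have hB := pow_mul_invHom (reflect_natDegree_le h.natDegree_right)
      rw [reflect_reflect] at hA hB
      rw [← hA, ← hB]
      ring)
  refine ⟨F, ?_, (hF 1).trans hf1⟩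
  refine hom_ext_of_pair (Cylinder.chart k) Cylinder.exists_mem_range_chart fun i => ?_
  rw [← Category.assoc, hF, ← Category.assoc, Cylinder.chart_fst_eq, P1.point_comp_str]
  fin_cases i
  · exact P1.point_comp_str _ _ h.isCoprime_reflect
  · exact P1.point_comp_str _ _ h.isCoprime

/-- Endomorphisms of the projective line are determined by their restriction to the affine line. -/
lemma Endo.ext_chart {f g : Endo k} (h : P1.chart k ≫ f.1 = P1.chart k ≫ g.1) : f = g := by
  have hover : Spec.map (CommRingCat.ofHom (invHom k)) ≫ P1.stdChart k 1 =
      Spec.map (CommRingCat.ofHom (algebraMap k[X] (LaurentRing k))) ≫ P1.stdChart k 0 := by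
    rw [P1.stdChart, P1.stdChart, P1.SpecMap_comp_point _ (invHom_algebraMap _) _ _ _
      ((isCoprime_chartVec 1).map _),
      P1.SpecMap_comp_point _ (fun c => (IsScalarTower.algebraMap_apply k _ _ c).symm) _ _ _
        ((isCoprime_chartVec 0).map _)]
    apply P1.point_eq_of_mul_eq
    simp [chartVec]
    rw [mul_comm, algebraMap_X_mul_invHom_X]
  have hstr : ∀ f : Endo k, (P1.stdChart k 0 ≫ f.1) ≫ P1.str k =
      Spec.map (CommRingCat.ofHom (algebraMap k k[X])) := fun f => by
    rw [Category.assoc, f.2, P1.stdChart_comp_str, algebraMap_eq]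
  obtain ⟨a, b, hab, e⟩ := P1.exists_point_eq _ (hstr f)
  obtain ⟨c, d, hcd, e'⟩ := P1.exists_point_eq _ (hstr g)
  have hL : Spec.map (CommRingCat.ofHom (algebraMap k[X] (LaurentRing k))) ≫
      P1.stdChart k 0 ≫ f.1 = Spec.map (CommRingCat.ofHom (algebraMap k[X] (LaurentRing k))) ≫
      P1.stdChart k 0 ≫ g.1 := by
    rw [← Category.assoc, ← Category.assoc, ← hover, Category.assoc, Category.assoc,
      P1.stdChart_one, h]
  rw [e, e', P1.SpecMap_comp_point _ (fun c => (IsScalarTower.algebraMap_apply k _ _ c).symm) _ _ _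
      (hab.map _),
    P1.SpecMap_comp_point _ (fun c => (IsScalarTower.algebraMap_apply k _ _ c).symm) _ _ _
      (hcd.map _)] at hL
  have hL' := P1.mul_eq_of_point_eq _ _ hL
  rw [← map_mul, ← map_mul] at hL'
  -- The two morphisms agree on the overlap. As `k[X]` embeds in the Laurent polynomials, their
  -- coordinates are also proportional on the whole chart at infinity.
  have hadbc := algebraMap_laurent_injective k hL'
  apply Subtype.ext
  refine hom_ext_of_pair (P1.stdChart k) P1.exists_mem_range_stdChart fun i => ?_
  fin_cases i
  · change P1.stdChart k 0 ≫ _ = P1.stdChart k 0 ≫ _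
    rw [e, e']
    exact P1.point_eq_of_mul_eq _ _ hadbc
  · exact h

end Classification

/-! ### Good pairs over a field, resultants and scalars -/

section GoodField

open Polynomial

variable {R : Type u} [CommRing R]

/-- Reflecting a Bézout relation shows that the reflections generate a power of `X`. The constant
term of the reflected `A` is a unit, so `A.reflect n` is itself coprime to that power. -/
lemma isCoprime_reflect_of_isUnit_coeff {n : ℕ} {A B : R[X]} (hA : A.natDegree ≤ n)
    (hB : B.natDegree ≤ n) (h : IsCoprime A B) (hu : IsUnit (A.coeff n)) :
    IsCoprime (A.reflect n) (B.reflect n) := by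
  obtain ⟨u, v, huv⟩ := h
  have h1 := congrArg (reflect (max u.natDegree v.natDegree + n)) huv
  rw [reflect_add, reflect_mul _ _ (le_max_left _ _) hA, reflect_mul _ _ (le_max_right _ _) hB,
    ← C_1, reflect_C, C_1, one_mul] at h1
  have h2 : IsCoprime (A.reflect n) X := by
    obtain ⟨c, hc⟩ := hu.exists_left_inv
    refine ⟨C c, -(C c * (A.reflect n).divX), ?_⟩
    have h3 := (A.reflect n).divX_mul_X_add
    rw [coeff_reflect, revAt_le (Nat.zero_le _), Nat.sub_zero] at h3
    have h4 : C c * C (A.coeff n) = 1 := by rw [← C_mul, hc, C_1]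
    linear_combination (-C c) * h3 + h4
  obtain ⟨x, y, hxy⟩ := h2.pow_right (n := max u.natDegree v.natDegree + n)
  refine ⟨x + y * reflect (max u.natDegree v.natDegree) u,
    y * reflect (max u.natDegree v.natDegree) v, ?_⟩
  linear_combination hxy + y * h1

lemma Good.symm {n : ℕ} {A B : R[X]} (h : Good n A B) : Good n B A :=
  ⟨h.natDegree_right, h.natDegree_left, h.isCoprime.symm, h.isCoprime_reflect.symm⟩

lemma good_of_isUnit_coeff {n : ℕ} {A B : R[X]} (hA : A.natDegree ≤ n)
    (hB : B.natDegree ≤ n) (h : IsCoprime A B) (hu : IsUnit (A.coeff n)) : Good n A B :=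
  ⟨hA, hB, h, isCoprime_reflect_of_isUnit_coeff hA hB h hu⟩

lemma Good.map {R' : Type u} [CommRing R'] (φ : R →+* R') {n : ℕ} {A B : R[X]} (h : Good n A B) :
    Good n (A.map φ) (B.map φ) := by
  refine ⟨natDegree_map_le.trans h.natDegree_left, natDegree_map_le.trans h.natDegree_right,
    h.isCoprime.map (mapRingHom φ), ?_⟩
  rw [reflect_map, reflect_map]
  exact h.isCoprime_reflect.map (mapRingHom φ)

lemma Good.coeff_ne_zero [Nontrivial R] {n : ℕ} {A B : R[X]} (h : Good n A B) :
    A.coeff n ≠ 0 ∨ B.coeff n ≠ 0 := by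
  by_contra! hn
  obtain ⟨x, y, hxy⟩ := h.isCoprime_reflect
  have := congrArg (eval 0) hxy
  simp only [eval_add, eval_mul, ← coeff_zero_eq_eval_zero, coeff_reflect,
    revAt_le (Nat.zero_le _), Nat.sub_zero, hn, mul_zero, add_zero, coeff_one_zero] at this
  exact zero_ne_one this

variable {k : Type u} [Field k]

lemma good_of_coeff_ne_zero {n : ℕ} {A B : k[X]} (hA : A.natDegree ≤ n)
    (hB : B.natDegree ≤ n) (h : IsCoprime A B) (hu : A.coeff n ≠ 0 ∨ B.coeff n ≠ 0) :
    Good n A B := by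
  rcases hu with hu | hu
  · exact good_of_isUnit_coeff hA hB h hu.isUnit
  · exact (good_of_isUnit_coeff hB hA h.symm hu.isUnit).symm

lemma RatFun.good {n : ℕ} (r : RatFun k n) : Good n r.A r.B := by
  refine good_of_coeff_ne_zero r.natDegree_A r.natDegree_B r.isCoprime ?_
  by_contra! hn
  -- In degree zero the resultant is no condition, so the requirement that the pair be non-zero
  -- takes over.
  rcases Nat.eq_zero_or_pos n with h0 | h0
  · subst h0
    rcases r.ne_zero with h | h <;> apply h
    · rw [eq_C_of_natDegree_le_zero r.natDegree_A, hn.1, C_0]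
    · rw [eq_C_of_natDegree_le_zero r.natDegree_B, hn.2, C_0]
  · have hlt : ∀ f : k[X], f.natDegree ≤ n → f.coeff n = 0 → f.natDegree < n := by
      intro f hf h
      refine lt_of_le_of_ne hf fun he => ?_
      rw [← he, coeff_natDegree, leadingCoeff_eq_zero] at h
      rw [h, natDegree_zero] at he
      exact h0.ne he
    exact r.resultant_ne_zero (resultant_eq_zero_of_lt_lt _ _ _ _
      (hlt _ r.natDegree_A hn.1) (hlt _ r.natDegree_B hn.2))

/-- If `A` has full degree, lowering the formal degree of `B` to its true degree only costs a power
of the leading coefficient of `A`; the remaining resultant is non-zero by coprimality. -/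
lemma Good.resultant_ne_zero {n : ℕ} {A B : k[X]} (h : Good n A B) : resultant A B n n ≠ 0 := by
  have key : ∀ {A B : k[X]}, Good n A B → A.coeff n ≠ 0 → resultant A B n n ≠ 0 := by
    intro A B h hA
    have hd : A.natDegree = n := le_antisymm h.natDegree_left (le_natDegree_of_ne_zero hA)
    obtain ⟨j, hj⟩ := Nat.exists_eq_add_of_le h.natDegree_right
    have h1 := resultant_add_right_deg A B n B.natDegree j le_rfl
    rw [← hj] at h1
    rw [h1]
    refine mul_ne_zero (pow_ne_zero _ hA) ?_
    have := Polynomial.resultant_ne_zero A B h.isCoprime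
    rwa [hd] at this
  rcases h.coeff_ne_zero with hA | hB
  · exact key h hA
  · rw [resultant_comm]
    exact mul_ne_zero (pow_ne_zero _ (by simp)) (key h.symm hB)

/-- The rational function defined by a pair without common zero. -/
def Good.ratFun {n : ℕ} {A B : k[X]} (h : Good n A B) : RatFun k n where
  A := A
  B := B
  natDegree_A := h.natDegree_left
  natDegree_B := h.natDegree_right
  ne_zero := by
    by_contra! hn
    have := h.isCoprime
    rw [hn.1, hn.2] at this
    exact not_isCoprime_zero_zero this
  resultant_ne_zero := h.resultant_ne_zero

lemma Good.smul {n : ℕ} {A B : k[X]} (h : Good n A B) {u : k} (hu : u ≠ 0) :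
    Good n (C u * A) (C u * B) := by
  have hu' : IsUnit (C u : k[X]) := isUnit_C.2 hu.isUnit
  refine good_of_coeff_ne_zero ((natDegree_C_mul_le _ _).trans h.natDegree_left)
    ((natDegree_C_mul_le _ _).trans h.natDegree_right) ?_ ?_
  · exact (isCoprime_mul_unit_left hu' A B).2 h.isCoprime
  · simpa [hu] using h.coeff_ne_zero

lemma Good.degree_unique {n m : ℕ} {A B : k[X]} (h : Good n A B) (h' : Good m A B) : n = m := by
  have key : ∀ {n m : ℕ}, Good n A B → Good m A B → n ≤ m := by
    intro n m h h'
    rcases h.coeff_ne_zero with h1 | h1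
    · exact (le_natDegree_of_ne_zero h1).trans h'.natDegree_left
    · exact (le_natDegree_of_ne_zero h1).trans h'.natDegree_right
  exact le_antisymm (key h h') (key h' h)

/-- Two coprime pairs with equal cross products differ by a unit of `k[X]`, and such units are
constants. -/
lemma Good.exists_smul_of_point_eq {n m : ℕ} {A B A' B' : k[X]} (h : Good n A B)
    (h' : Good m A' B') (he : P1.point (k := k) A B h.isCoprime = P1.point A' B' h'.isCoprime) :
    n = m ∧ ∃ u : k, u ≠ 0 ∧ A' = C u * A ∧ B' = C u * B := by
  have hcross := P1.mul_eq_of_point_eq _ _ he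
  obtain ⟨x, y, hxy⟩ := h.isCoprime
  obtain ⟨x', y', hxy'⟩ := h'.isCoprime
  have h1 : A' = (x * A' + y * B') * A := by linear_combination (-A') * hxy - y * hcross
  have h2 : B' = (x * A' + y * B') * B := by linear_combination (-B') * hxy + x * hcross
  have hu : IsUnit (x * A' + y * B') :=
    IsUnit.of_mul_eq_one (x' * A + y' * B) (by
      linear_combination hxy' - x' * h1 - y' * h2)
  obtain ⟨u, hu0, hu⟩ := Polynomial.isUnit_iff.1 hu
  rw [← hu] at h1 h2
  refine ⟨?_, u, hu0.ne_zero, h1, h2⟩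
  have h3 := h.smul hu0.ne_zero
  rw [← h1, ← h2] at h3
  exact h3.degree_unique h'

end GoodField

/-! ### Endomorphisms and homotopies expressed by pairs -/

section Classes

open Polynomial

variable {k : Type u} [Field k]

lemma mapRingHom_evalRingHom_algebraMap (t c : k) :
    mapRingHom (evalRingHom t) (algebraMap k k[X][X] c) = algebraMap k k[X] c := by
  rw [IsScalarTower.algebraMap_apply k k[X] k[X][X], algebraMap_eq, algebraMap_eq,
    coe_mapRingHom, map_C, coe_evalRingHom, eval_C]

lemma Cylinder.chart_comp_slice_comp {F : Cylinder k ⟶ P1 k} {n : ℕ} {A B : k[X][X]}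
    (h : Good n A B) (hF : Cylinder.chart k 1 ≫ F = P1.point (k := k) A B h.isCoprime) (t : k) :
    P1.chart k ≫ Cylinder.slice t ≫ F =
      P1.point (k := k) _ _ (h.map (evalRingHom t)).isCoprime := by
  rw [← P1.stdChart_one, ← Category.assoc, Cylinder.stdChart_comp_slice, Category.assoc, hF,
    P1.SpecMap_comp_point _ (mapRingHom_evalRingHom_algebraMap t) _ _ _
      (h.map (evalRingHom t)).isCoprime]
  rfl

lemma Cylinder.slice_comp_str (t : k) {F : Cylinder k ⟶ P1 k}
    (hF : F ≫ P1.str k = pullback.fst (P1.str k) (A1.str k) ≫ P1.str k) :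
    (Cylinder.slice t ≫ F) ≫ P1.str k = P1.str k := by
  rw [Category.assoc, hF, Cylinder.slice, pullback.lift_fst_assoc, Category.id_comp]

lemma map_C_map_evalRingHom (A : k[X]) (t : k) :
    (A.map (C : k →+* k[X])).map (evalRingHom t) = A := by
  rw [Polynomial.map_map]
  have : (evalRingHom t).comp (C : k →+* k[X]) = RingHom.id k := by ext; simp
  rw [this, Polynomial.map_id]

lemma Good.exists_endo {n : ℕ} {A B : k[X]} (h : Good n A B) :
    ∃ f : Endo k, P1.chart k ≫ f.1 = P1.point A B h.isCoprime := by
  obtain ⟨F, hF, hF'⟩ := Cylinder.exists_hom_of_good (h.map (C : k →+* k[X]))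
  refine ⟨⟨Cylinder.slice 0 ≫ F, Cylinder.slice_comp_str 0 hF⟩, ?_⟩
  refine (Cylinder.chart_comp_slice_comp (h.map (C : k →+* k[X])) hF' 0).trans ?_
  simp only [map_C_map_evalRingHom]

lemma Endo.exists_good (f : Endo k) :
    ∃ (n : ℕ) (A B : k[X]) (h : Good n A B), P1.chart k ≫ f.1 = P1.point A B h.isCoprime := by
  -- An endomorphism is treated as a constant homotopy and then restricted to a slice, so no
  -- separate classification is needed.
  obtain ⟨n, A, B, h, e⟩ := Cylinder.exists_good (pullback.fst (P1.str k) (A1.str k) ≫ f.1)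
    (by rw [Category.assoc, f.2])
  refine ⟨n, _, _, h.map (evalRingHom 0), ?_⟩
  rw [← Cylinder.chart_comp_slice_comp h e 0, Cylinder.slice, pullback.lift_fst_assoc,
    Category.id_comp]

/-- The endomorphism `A / B` of the projective line. -/
def Good.endo {n : ℕ} {A B : k[X]} (h : Good n A B) : Endo k := h.exists_endo.choose

lemma Good.chart_comp_endo {n : ℕ} {A B : k[X]} (h : Good n A B) :
    P1.chart k ≫ h.endo.1 = P1.point A B h.isCoprime := h.exists_endo.choose_spec

lemma Good.eq_endo {n : ℕ} {A B : k[X]} (h : Good n A B) {f : Endo k}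
    (hf : P1.chart k ≫ f.1 = P1.point A B h.isCoprime) : f = h.endo :=
  Endo.ext_chart (hf.trans h.chart_comp_endo.symm)

/-- The naive homotopy class of `A / B`. -/
def Good.cls {n : ℕ} {A B : k[X]} (h : Good n A B) : NaiveClasses k := h.endo.toClass

lemma Good.cls_congr {n m : ℕ} {A B A' B' : k[X]} (h : Good n A B) (h' : Good m A' B')
    (he : A * B' = B * A') : h.cls = h'.cls := by
  have e : h.endo = h'.endo :=
    h'.eq_endo (h.chart_comp_endo.trans (P1.point_eq_of_mul_eq h.isCoprime h'.isCoprime he))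
  exact congrArg Endo.toClass e

/-- A pair over `k[T]` gives a naive homotopy between its values at `0` and `1`. -/
lemma Good.cls_map_eq {n : ℕ} {A B : k[X][X]} (h : Good n A B) :
    (h.map (evalRingHom 0)).cls = (h.map (evalRingHom 1)).cls := by
  obtain ⟨F, hF, hF'⟩ := Cylinder.exists_hom_of_good h
  have key : ∀ t : k, Cylinder.slice t ≫ F = (h.map (evalRingHom t)).endo.1 := by
    intro t
    let f : Endo k := ⟨Cylinder.slice t ≫ F, Cylinder.slice_comp_str t hF⟩
    have hf : P1.chart k ≫ f.1 = P1.point _ _ (h.map (evalRingHom t)).isCoprime :=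
      Cylinder.chart_comp_slice_comp h hF' t
    exact congrArg Subtype.val ((h.map (evalRingHom t)).eq_endo hf)
  have hh : NaivelyHomotopic (h.map (evalRingHom 0)).endo (h.map (evalRingHom 1)).endo :=
    ⟨F, hF, key 0, key 1⟩
  exact Quotient.sound (s := naiveSetoid k) (Relation.EqvGen.rel _ _ hh)

lemma NaiveClasses.exists_cls (c : NaiveClasses k) :
    ∃ (n : ℕ) (A B : k[X]) (h : Good n A B), c = h.cls := by
  obtain ⟨f, rfl⟩ := Quotient.exists_rep c
  obtain ⟨n, A, B, h, e⟩ := f.exists_good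
  exact ⟨n, A, B, h, congrArg Endo.toClass (h.eq_endo e)⟩

/-- Invariants of pairs of polynomials that are constant along paths and insensitive to scalars
descend to naive homotopy classes. -/
lemma NaiveClasses.exists_lift {T : Type*} (Ψ : ∀ (n : ℕ) (A B : k[X]), Good n A B → T)
    (hsmul : ∀ (n : ℕ) (A B : k[X]) (h : Good n A B) (u : k) (hu : u ≠ 0),
      Ψ n _ _ (h.smul hu) = Ψ n A B h)
    (hpath : ∀ (n : ℕ) (A B : k[X][X]) (h : Good n A B),
      Ψ n _ _ (h.map (evalRingHom 0)) = Ψ n _ _ (h.map (evalRingHom 1))) :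
    ∃ Φ : NaiveClasses k → T, ∀ (n : ℕ) (A B : k[X]) (h : Good n A B), Φ h.cls = Ψ n A B h := by
  choose n A B h e using Endo.exists_good (k := k)
  have huniq : ∀ (f : Endo k) (m : ℕ) (A' B' : k[X]) (h' : Good m A' B'),
      P1.chart k ≫ f.1 = P1.point A' B' h'.isCoprime → Ψ _ _ _ (h f) = Ψ _ _ _ h' := by
    intro f m A' B' h' he
    obtain ⟨hn, u, hu, hA, hB⟩ := (h f).exists_smul_of_point_eq h' ((e f).symm.trans he)
    subst hn hA hB
    rw [← hsmul _ _ _ (h f) u hu]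
  have hwd : ∀ f g : Endo k, NaivelyHomotopic f g → Ψ _ _ _ (h f) = Ψ _ _ _ (h g) := by
    rintro f g ⟨F, hF, h0, h1⟩
    obtain ⟨m, A', B', h', he⟩ := Cylinder.exists_good F hF
    have e0 := Cylinder.chart_comp_slice_comp h' he 0
    have e1 := Cylinder.chart_comp_slice_comp h' he 1
    rw [h0] at e0
    rw [h1] at e1
    have a0 := huniq f m (A'.map (evalRingHom (0 : k))) (B'.map (evalRingHom (0 : k)))
      (h'.map (evalRingHom (0 : k))) e0
    have a1 := huniq g m (A'.map (evalRingHom (1 : k))) (B'.map (evalRingHom (1 : k)))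
      (h'.map (evalRingHom (1 : k))) e1
    rw [a0, a1]
    exact hpath m A' B' h'
  refine ⟨Quotient.lift (s := naiveSetoid k) (fun f => Ψ _ _ _ (h f)) ?_, ?_⟩
  · intro f g hfg
    induction hfg with
    | rel f g hfg => exact hwd f g hfg
    | refl => rfl
    | symm _ _ _ ih => exact ih.symm
    | trans _ _ _ _ _ ih1 ih2 => exact ih1.trans ih2
  · intro m A' B' h'
    exact huniq _ _ _ _ h' h'.chart_comp_endo

end Classes

/-! ### Isometries of Gram matrices, metabolic planes, diagonal forms -/

section FormIso

open Matrix

variable {R : Type u} [CommRing R]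

/-- The orthogonal sum of two Gram matrices. -/
abbrev dsum {ι κ : Type} (M : Matrix ι ι R) (N : Matrix κ κ R) : Matrix (ι ⊕ κ) (ι ⊕ κ) R :=
  fromBlocks M 0 0 N

variable {ι κ τ μ : Type} [Fintype ι] [DecidableEq ι] [Fintype κ]
  [DecidableEq κ] [Fintype τ] [DecidableEq τ] [Fintype μ] [DecidableEq μ]

/-- Isomorphism of the bilinear forms with Gram matrices `M` and `N`, for arbitrary index types. -/
def FormIso (M : Matrix ι ι R) (N : Matrix κ κ R) : Prop :=
  ∃ (P : Matrix ι κ R) (Q : Matrix κ ι R), P * Q = 1 ∧ Q * P = 1 ∧ Pᵀ * M * P = N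

variable {M : Matrix ι ι R} {N : Matrix κ κ R} {L : Matrix τ τ R} {K : Matrix μ μ R}

lemma FormIso.refl (M : Matrix ι ι R) : FormIso M M := ⟨1, 1, by simp, by simp, by simp⟩

lemma FormIso.symm (h : FormIso M N) : FormIso N M := by
  obtain ⟨P, Q, h1, h2, rfl⟩ := h
  refine ⟨Q, P, h2, h1, ?_⟩
  have h3 : Qᵀ * Pᵀ = 1 := by rw [← transpose_mul, h1, transpose_one]
  calc Qᵀ * (Pᵀ * M * P) * Q = (Qᵀ * Pᵀ) * M * (P * Q) := by simp only [Matrix.mul_assoc]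
    _ = M := by rw [h1, h3, Matrix.one_mul, Matrix.mul_one]

lemma FormIso.trans (h : FormIso M N) (h' : FormIso N L) : FormIso M L := by
  obtain ⟨P, Q, h1, h2, rfl⟩ := h
  obtain ⟨P', Q', h1', h2', rfl⟩ := h'
  refine ⟨P * P', Q' * Q, ?_, ?_, ?_⟩
  · calc P * P' * (Q' * Q) = P * (P' * Q') * Q := by simp only [Matrix.mul_assoc]
      _ = 1 := by rw [h1', Matrix.mul_one, h1]
  · calc Q' * Q * (P * P') = Q' * (Q * P) * P' := by simp only [Matrix.mul_assoc]
      _ = 1 := by rw [h2, Matrix.mul_one, h2']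
  · simp only [transpose_mul, Matrix.mul_assoc]

lemma FormIso.submatrix (M : Matrix ι ι R) (e : κ ≃ ι) : FormIso M (M.submatrix e e) := by
  refine ⟨(1 : Matrix ι ι R).submatrix id e, (1 : Matrix ι ι R).submatrix e id, ?_, ?_, ?_⟩
  · rw [submatrix_mul_equiv, Matrix.one_mul, submatrix_id_id]
  · rw [← submatrix_mul _ _ _ _ _ Function.bijective_id, Matrix.one_mul, submatrix_one_equiv]
  · rw [transpose_submatrix, transpose_one]
    have h1 : M = M.submatrix id id := (submatrix_id_id M).symm
    conv_lhs => rw [h1]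
    rw [← submatrix_mul _ _ _ _ _ Function.bijective_id, Matrix.one_mul,
      ← submatrix_mul _ _ _ _ _ Function.bijective_id, Matrix.mul_one]

lemma FormIso.of_submatrix_eq (e : κ ≃ ι) (h : M.submatrix e e = N) : FormIso M N :=
  h ▸ FormIso.submatrix M e

lemma FormIso.dsum (h : FormIso M N) (h' : FormIso L K) : FormIso (dsum M L) (dsum N K) := by
  obtain ⟨P, Q, h1, h2, rfl⟩ := h
  obtain ⟨P', Q', h1', h2', rfl⟩ := h'
  refine ⟨fromBlocks P 0 0 P', fromBlocks Q 0 0 Q', ?_, ?_, ?_⟩ <;>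
    simp [fromBlocks_transpose, fromBlocks_multiply, *]

lemma FormIso.dsum_comm (M : Matrix ι ι R) (N : Matrix κ κ R) :
    FormIso (NaiveP1.dsum M N) (NaiveP1.dsum N M) :=
  .of_submatrix_eq (Equiv.sumComm _ _) (by ext (i | i) (j | j) <;> simp)

lemma FormIso.dsum_assoc (M : Matrix ι ι R) (N : Matrix κ κ R) (L : Matrix τ τ R) :
    FormIso (NaiveP1.dsum (NaiveP1.dsum M N) L) (NaiveP1.dsum M (NaiveP1.dsum N L)) :=
  .of_submatrix_eq (Equiv.sumAssoc _ _ _).symm (by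
    ext (i | i | i) (j | j | j) <;> simp)

lemma FormIso.dsum_right_comm (M : Matrix ι ι R) (N : Matrix κ κ R) (L : Matrix τ τ R) :
    FormIso (NaiveP1.dsum (NaiveP1.dsum M N) L) (NaiveP1.dsum (NaiveP1.dsum M L) N) :=
  (FormIso.dsum_assoc _ _ _).trans
    (((FormIso.refl _).dsum (FormIso.dsum_comm _ _)).trans (FormIso.dsum_assoc _ _ _).symm)

lemma FormIso.map {R' : Type u} [CommRing R'] (φ : R →+* R') (h : FormIso M N) :
    FormIso (M.map φ) (N.map φ) := by
  obtain ⟨P, Q, h1, h2, rfl⟩ := h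
  refine ⟨P.map φ, Q.map φ, ?_, ?_, ?_⟩
  · rw [← Matrix.map_mul, h1, Matrix.map_one _ φ.map_zero φ.map_one]
  · rw [← Matrix.map_mul, h2, Matrix.map_one _ φ.map_zero φ.map_one]
  · rw [Matrix.map_mul, Matrix.map_mul, transpose_map]

lemma FormIso.isSymm (h : FormIso M N) (hM : M.IsSymm) : N.IsSymm := by
  obtain ⟨P, Q, h1, h2, rfl⟩ := h
  rw [IsSymm, transpose_mul, transpose_mul, transpose_transpose, hM.eq, Matrix.mul_assoc]

lemma card_eq_of_mul_eq_one [Nontrivial R] {P : Matrix ι κ R} {Q : Matrix κ ι R} (h1 : P * Q = 1)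
    (h2 : Q * P = 1) : Fintype.card ι = Fintype.card κ :=
  Fintype.card_congr (indexEquivOfInv h1 h2)

lemma FormIso.card_eq [Nontrivial R] (h : FormIso M N) : Fintype.card ι = Fintype.card κ := by
  obtain ⟨P, Q, h1, h2, -⟩ := h
  exact card_eq_of_mul_eq_one h1 h2

lemma FormIso.exists_det [Nontrivial R] (h : FormIso M N) :
    ∃ s : Rˣ, N.det = M.det * (s : R) ^ 2 := by
  obtain ⟨P, Q, h1, h2, rfl⟩ := h
  -- Mutually inverse rectangular matrices over a non-trivial commutative ring have equally many
  -- rows and columns; reindexing gives `P` a determinant.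
  let e : κ ≃ ι := (indexEquivOfInv h1 h2).symm
  have h3 : P.submatrix e id * Q.submatrix id e = 1 := by
    rw [← submatrix_mul _ _ _ _ _ Function.bijective_id, h1, submatrix_one_equiv]
  have h4 : (P.submatrix e id).det * (Q.submatrix id e).det = 1 := by
    rw [← det_mul, h3, det_one]
  have h5 : Pᵀ * M * P = (P.submatrix e id)ᵀ * M.submatrix e e * P.submatrix e id := by
    rw [transpose_submatrix, submatrix_mul_equiv, submatrix_mul_equiv, submatrix_id_id]
  refine ⟨Units.mkOfMulEqOne _ _ h4, ?_⟩
  rw [h5, det_mul, det_mul, det_transpose, det_submatrix_equiv_self, Units.val_mkOfMulEqOne]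
  ring

/-- The form of rank one with value `u`. -/
def single {R : Type u} (u : R) : Matrix Unit Unit R := of fun _ _ => u

/-- The metabolic plane with an isotropic vector and a vector of value `c`. -/
def plane (c : R) : Matrix (Unit ⊕ Unit) (Unit ⊕ Unit) R := fromBlocks 0 1 1 (single c)

omit [CommRing R] in
lemma single_apply (u : R) (i j : Unit) : single u i j = u := rfl

omit [CommRing R] in
lemma isSymm_single (u : R) : (single u).IsSymm := by ext; rfl

lemma det_single (u : R) : (single u).det = u := by simp [single]

lemma single_map {R' : Type u} [CommRing R'] (φ : R →+* R') (u : R) :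
    (single u).map φ = single (φ u) := by ext; rfl

lemma plane_map {R' : Type u} [CommRing R'] (φ : R →+* R') (c : R) :
    (plane c).map φ = plane (φ c) := by
  simp [plane, fromBlocks_map, single_map, Matrix.map_one, Matrix.map_zero]

omit [Fintype ι] [DecidableEq ι] [Fintype κ] [DecidableEq κ] in
lemma dsum_map {R' : Type u} [CommRing R'] (φ : R →+* R') (M : Matrix ι ι R) (N : Matrix κ κ R) :
    (dsum M N).map φ = dsum (M.map φ) (N.map φ) := by
  simp [dsum, fromBlocks_map, Matrix.map_zero]

/-- If `x, y` is the basis of the plane and `f` spans the line, the new basis is `x, y + f, f - e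
x`. In characteristic two the planes themselves need not be isometric, and this is what makes them
stably so. -/
lemma FormIso.plane_dsum_single (c e : R) :
    FormIso (NaiveP1.dsum (plane c) (single e)) (NaiveP1.dsum (plane (c + e)) (single e)) := by
  refine ⟨fromBlocks 1 (of fun i _ => Sum.elim (fun _ => -e) (fun _ => 0) i)
    (of fun _ i => Sum.elim (fun _ => 0) (fun _ => 1) i) 1,
    fromBlocks (fromBlocks 1 (single (-e)) 0 1)
      (of fun i _ => Sum.elim (fun _ => e) (fun _ => 0) i)
      (of fun _ i => Sum.elim (fun _ => 0) (fun _ => -1) i) 1, ?_, ?_, ?_⟩ <;>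
  · ext ((i | i) | i) ((j | j) | j) <;>
      simp [Matrix.mul_apply, plane, single_apply, Fintype.sum_sum_type]

lemma FormIso.plane_one : FormIso (plane (1 : R)) (NaiveP1.dsum (single 1) (single (-1))) := by
  refine ⟨fromBlocks 0 (single 1) (single 1) (single (-1)),
    fromBlocks (single 1) (single 1) (single 1) 0, ?_, ?_, ?_⟩ <;>
  · ext (i | i) (j | j) <;>
      simp [Matrix.mul_apply, plane, single_apply, Fintype.sum_sum_type]

/-- The diagonal form with entries the elements of a list. -/
def diagForm (l : List Rˣ) : Matrix (Fin l.length) (Fin l.length) R :=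
  diagonal fun i => (l.get i : R)

lemma FormIso.diagForm_cons (u : Rˣ) (l : List Rˣ) :
    FormIso (diagForm (u :: l)) (NaiveP1.dsum (single (u : R)) (diagForm l)) := by
  refine .of_submatrix_eq ((Equiv.sumComm _ _).trans
    ((Equiv.optionEquivSumPUnit _).symm.trans (finSuccEquiv l.length).symm)) ?_
  ext (i | i) (j | j)
  · simp [diagForm, single_apply]
  · simp [diagForm, (Fin.succ_ne_zero j).symm]
  · simp [diagForm]
  · simp [diagForm, diagonal_apply, Fin.ext_iff]

end FormIso

/-! ### Stable isomorphism -/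

section StabIso

open Matrix

variable {k : Type u} [Field k] {ι κ τ μ : Type} [Fintype ι] [DecidableEq ι] [Fintype κ]
  [DecidableEq κ] [Fintype τ] [DecidableEq τ] [Fintype μ] [DecidableEq μ]

/-- Stable isomorphism of forms, for arbitrary index types. -/
def StabIso (M : Matrix ι ι k) (N : Matrix κ κ k) : Prop :=
  ∃ (n : ℕ) (C : Matrix (Fin n) (Fin n) k), C.IsSymm ∧ IsUnit C.det ∧
    FormIso (dsum M C) (dsum N C)

variable {M : Matrix ι ι k} {N : Matrix κ κ k} {L : Matrix τ τ k} {K : Matrix μ μ k}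

lemma StabIso.of_formIso (C : Matrix τ τ k) (hC : C.IsSymm) (hd : IsUnit C.det)
    (h : FormIso (dsum M C) (dsum N C)) : StabIso M N := by
  let e := (Fintype.equivFin τ).symm
  refine ⟨_, C.submatrix e e, hC.submatrix _, by rwa [det_submatrix_equiv_self], ?_⟩
  have h1 := FormIso.submatrix C e
  exact ((FormIso.refl M).dsum h1.symm).trans (h.trans ((FormIso.refl N).dsum h1))

lemma FormIso.stabIso (h : FormIso M N) : StabIso M N :=
  StabIso.of_formIso (single (1 : k)) (isSymm_single _) (by rw [det_single]; exact isUnit_one)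
    (h.dsum (FormIso.refl _))

lemma StabIso.symm (h : StabIso M N) : StabIso N M := by
  obtain ⟨n, C, hC, hd, h⟩ := h
  exact ⟨n, C, hC, hd, h.symm⟩

lemma StabIso.trans (h : StabIso M N) (h' : StabIso N L) : StabIso M L := by
  obtain ⟨n, C, hC, hd, h⟩ := h
  obtain ⟨n', C', hC', hd', h'⟩ := h'
  refine StabIso.of_formIso (NaiveP1.dsum C C') (Matrix.IsSymm.fromBlocks hC (by simp) hC')
    (by rw [det_fromBlocks_zero₂₁]; exact hd.mul hd') ?_
  refine (FormIso.dsum_assoc _ _ _).symm.trans ((h.dsum (FormIso.refl C')).trans ?_)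
  refine (FormIso.dsum_right_comm _ _ _).trans ((h'.dsum (FormIso.refl C)).trans ?_)
  exact (FormIso.dsum_right_comm _ _ _).trans (FormIso.dsum_assoc _ _ _)

lemma StabIso.dsum_left (h : StabIso M N) (L : Matrix τ τ k) :
    StabIso (dsum M L) (dsum N L) := by
  obtain ⟨n, C, hC, hd, h⟩ := h
  exact ⟨n, C, hC, hd, (FormIso.dsum_right_comm _ _ _).trans
    ((h.dsum (FormIso.refl L)).trans (FormIso.dsum_right_comm _ _ _))⟩

lemma StabIso.dsum (h : StabIso M N) (h' : StabIso L K) :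
    StabIso (dsum M L) (NaiveP1.dsum N K) :=
  (h.dsum_left L).trans ((FormIso.dsum_comm _ _).stabIso.trans
    ((h'.dsum_left N).trans (FormIso.dsum_comm _ _).stabIso))

lemma StabIso.plane (c : k) : StabIso (plane c) (NaiveP1.dsum (single 1) (single (-1 : k))) := by
  refine StabIso.trans (N := NaiveP1.plane (1 : k)) ?_ FormIso.plane_one.stabIso
  rcases eq_or_ne c 1 with rfl | h
  · exact (FormIso.refl _).stabIso
  · have h1 := FormIso.plane_dsum_single c (1 - c)
    rw [add_sub_cancel] at h1
    exact StabIso.of_formIso _ (isSymm_single _)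
      (by rw [det_single]; exact (sub_ne_zero.2 h.symm).isUnit) h1

/-- Stable cancellation. -/
lemma StabIso.cancel {u : kˣ} (h : StabIso (NaiveP1.dsum (single (u : k)) M)
    (NaiveP1.dsum (single (u : k)) N)) : StabIso M N := by
  obtain ⟨n, C, hC, hd, h⟩ := h
  refine StabIso.of_formIso (NaiveP1.dsum (single (u : k)) C)
    (Matrix.IsSymm.fromBlocks (isSymm_single _) (by simp) hC)
    (by rw [det_fromBlocks_zero₂₁, det_single]; exact u.isUnit.mul hd) ?_
  have key : ∀ {ι : Type} [Fintype ι] [DecidableEq ι] (M : Matrix ι ι k),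
      FormIso (NaiveP1.dsum M (NaiveP1.dsum (single (u : k)) C))
        (NaiveP1.dsum (NaiveP1.dsum (single (u : k)) M) C) := fun M =>
    (FormIso.dsum_assoc _ _ _).symm.trans ((FormIso.dsum_comm _ _).dsum (FormIso.refl C))
  exact (key M).trans (h.trans (key N).symm)

lemma StabIso.stablyIso {n : ℕ} {b b' : SymmForm k n} (h : StabIso b.gram b'.gram) :
    b.StablyIso b' := by
  obtain ⟨m, C, hC, hd, P, Q, h1, h2, h⟩ := h
  exact ⟨m, ⟨C, hC, hd⟩, P, (Matrix.isUnit_iff_isUnit_det P).1 (IsUnit.of_mul_eq_one Q h1), h⟩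

lemma SymmForm.StablyIso.stabIso {n : ℕ} {b b' : SymmForm k n} (h : b.StablyIso b') :
    StabIso b.gram b'.gram := by
  obtain ⟨m, c, P, hP, h⟩ := h
  exact ⟨m, c.gram, c.isSymm, c.isUnit_det, P, P⁻¹, Matrix.mul_nonsing_inv P hP,
    Matrix.nonsing_inv_mul P hP, h⟩

end StabIso

/-! ### Splitting off subforms over a principal ideal domain -/

section Split

open Matrix

variable {R : Type u} [CommRing R] [IsDomain R] [IsPrincipalIdealRing R]
variable {ι κ : Type} [Fintype ι] [DecidableEq ι] [Fintype κ] [DecidableEq κ]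

/-- Over a principal ideal domain, a split injection of free modules has a free complement. -/
lemma exists_complement {W : Matrix ι κ R} {Φ : Matrix κ ι R} (h : Φ * W = 1) :
    ∃ (m : ℕ) (Z : Matrix ι (Fin m) R) (Y : Matrix (Fin m) ι R),
      fromCols W Z * fromRows Φ Y = 1 ∧ fromRows Φ Y * fromCols W Z = 1 := by
  obtain ⟨m, b⟩ := Submodule.basisOfPid (Pi.basisFun R ι) (LinearMap.ker Φ.mulVecLin)
  let Z : Matrix ι (Fin m) R := of fun i j => (b j : ι → R) i
  have hZ : Φ * Z = 0 := by
    ext i j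
    have := congrFun (LinearMap.mem_ker.1 (b j).2) i
    rw [Matrix.mul_apply]
    exact this
  -- The complement is the kernel of `Φ`, free over a principal ideal domain, and `1 - W * Φ` is the
  -- projection onto it.
  have hker : ∀ i, ((1 - W * Φ).col i) ∈ LinearMap.ker Φ.mulVecLin := by
    intro i
    rw [LinearMap.mem_ker, mulVecLin_apply]
    have h1 : Φ * (1 - W * Φ) = 0 := by
      rw [Matrix.mul_sub, ← Matrix.mul_assoc, h, Matrix.mul_one, Matrix.one_mul, sub_self]
    ext j
    exact congrFun (congrFun h1 j) i
  let Y : Matrix (Fin m) ι R := of fun j i => b.repr ⟨_, hker i⟩ j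
  have hZY : Z * Y = 1 - W * Φ := by
    ext i j
    have := congrFun (congrArg Subtype.val (b.sum_repr ⟨_, hker j⟩)) i
    simp only [Submodule.coe_sum, Finset.sum_apply, Submodule.coe_smul, Pi.smul_apply,
      smul_eq_mul] at this
    rw [Matrix.mul_apply]
    refine Eq.trans (Finset.sum_congr rfl fun l _ => ?_) this
    rw [mul_comm]
    rfl
  have hinj : ∀ {τ : Type} (N : Matrix (Fin m) τ R), Z * N = 0 → N = 0 := by
    intro τ N hN
    ext i j
    refine Fintype.linearIndependent_iff.1 b.linearIndependent (fun i => N i j) ?_ i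
    ext l
    have := congrFun (congrFun hN l) j
    rw [Matrix.mul_apply] at this
    simp only [Submodule.coe_sum, Finset.sum_apply, Submodule.coe_smul, Pi.smul_apply,
      smul_eq_mul]
    refine Eq.trans (Finset.sum_congr rfl fun l _ => ?_) this
    rw [mul_comm]
    rfl
  have hYW : Y * W = 0 := hinj _ (by
    rw [← Matrix.mul_assoc, hZY, Matrix.sub_mul, Matrix.mul_assoc, h, Matrix.mul_one,
      Matrix.one_mul, sub_self])
  have hYZ : Y * Z = 1 := sub_eq_zero.1 (hinj _ (by
    rw [Matrix.mul_sub, ← Matrix.mul_assoc, hZY, Matrix.sub_mul, Matrix.mul_assoc, hZ,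
      Matrix.mul_zero, Matrix.one_mul, Matrix.mul_one, sub_zero, sub_self]))
  refine ⟨m, Z, Y, ?_, ?_⟩
  · rw [fromCols_mul_fromRows, hZY, add_sub_cancel]
  · rw [fromRows_mul_fromCols, h, hZ, hYW, hYZ, fromBlocks_one]

/-- A non-degenerate subform is an orthogonal summand. -/
lemma FormIso.exists_dsum {S : Matrix ι ι R} (hS : S.IsSymm) {W : Matrix ι κ R}
    (hW : IsUnit (Wᵀ * S * W).det) :
    ∃ (m : ℕ) (S' : Matrix (Fin m) (Fin m) R), FormIso S (NaiveP1.dsum (Wᵀ * S * W) S') := by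
  set G := Wᵀ * S * W with hG
  -- This retraction has as kernel the orthogonal complement of the columns of `W`, so the
  -- complement it yields is orthogonal.
  have h1 : (G⁻¹ * (Wᵀ * S)) * W = 1 := by
    rw [Matrix.mul_assoc, ← hG, Matrix.nonsing_inv_mul G hW]
  obtain ⟨m, Z, Y, h2, h3⟩ := exists_complement h1
  have h4 : Wᵀ * S * Z = 0 := by
    rw [fromRows_mul_fromCols, ← fromBlocks_one, fromBlocks_inj] at h3
    have h5 := congrArg (G * ·) h3.2.1
    simp only [← Matrix.mul_assoc, Matrix.mul_nonsing_inv G hW, Matrix.one_mul,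
      Matrix.mul_zero] at h5
    exact h5
  have h6 : Zᵀ * S * W = 0 := by
    have := congrArg transpose h4
    rwa [transpose_mul, transpose_mul, transpose_transpose, hS.eq, transpose_zero,
      ← Matrix.mul_assoc] at this
  refine ⟨m, Zᵀ * S * Z, fromCols W Z, _, h2, h3, ?_⟩
  rw [transpose_fromCols, Matrix.mul_assoc, mul_fromCols, fromRows_mul_fromCols,
    ← Matrix.mul_assoc, ← Matrix.mul_assoc, ← Matrix.mul_assoc, ← Matrix.mul_assoc, h4, h6]

end Split

/-! ### Reduction theory of symmetric forms over `k[X]` -/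

section Hermite

open Matrix Polynomial

variable {k : Type u} [Field k]

/-- Here `g` generates the ideal of the entries of `v`; writing `g` as a combination of them and
dividing by `g` gives `φ`. -/
lemma exists_primitive {ι : Type} [Fintype ι] [DecidableEq ι] {v : ι → k[X]} (hv : v ≠ 0) :
    ∃ (g : k[X]) (w φ : ι → k[X]), g ≠ 0 ∧ v = g • w ∧ φ ⬝ᵥ w = 1 := by
  obtain ⟨g, hg⟩ := (IsPrincipalIdealRing.principal (Ideal.span (Set.range v))).principal
  have hdvd : ∀ i, ∃ c, v i = g * c := fun i => by
    have : v i ∈ Ideal.span (Set.range v) := Ideal.subset_span ⟨i, rfl⟩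
    rw [hg] at this
    exact Ideal.mem_span_singleton.1 this
  choose w hw using hdvd
  have hg0 : g ≠ 0 := by
    rintro rfl
    exact hv (funext fun i => by rw [hw, zero_mul, Pi.zero_apply])
  have hmem : g ∈ Ideal.span (Set.range v) := by
    rw [hg]; exact Ideal.mem_span_singleton_self g
  obtain ⟨φ, hφ⟩ := (Ideal.mem_span_range_iff_exists_fun).1 hmem
  refine ⟨g, w, φ, hg0, funext hw, ?_⟩
  apply mul_left_cancel₀ hg0
  rw [mul_one]
  conv_rhs => rw [← hφ]
  rw [dotProduct, Finset.mul_sum]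
  exact Finset.sum_congr rfl fun i _ => by rw [hw]; ring

lemma natDegree_mul_sq_le {g q : k[X]} (hg : g ≠ 0) : q.natDegree ≤ (g * g * q).natDegree := by
  rcases eq_or_ne q 0 with rfl | hq
  · simp
  · rw [natDegree_mul (mul_ne_zero hg hg) hq]
    exact Nat.le_add_left _ _

/-- Reduction theory: a non-degenerate symmetric form over `k[X]` takes a value of small degree. -/
lemma exists_natDegree_le (m : ℕ) : ∀ {ι : Type} [Fintype ι] [DecidableEq ι]
    (S : Matrix ι ι k[X]), Fintype.card ι = m + 1 → S.IsSymm → S.det ≠ 0 →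
    ∃ v : ι → k[X], v ≠ 0 ∧ (m + 1) * (v ⬝ᵥ S *ᵥ v).natDegree ≤ S.det.natDegree := by
  induction m with
  | zero =>
    intro ι _ _ S hc hS hd
    obtain ⟨i, hi⟩ := Fintype.card_eq_one_iff.1 hc
    have : Unique ι := ⟨⟨i⟩, hi⟩
    refine ⟨fun _ => 1, fun h => one_ne_zero (congrFun h i), ?_⟩
    simp [Matrix.det_unique, dotProduct, mulVec]
  | succ m ih =>
    intro ι _ _ S hc hS hd
    have hne : ({v : ι → k[X] | v ≠ 0}).Nonempty := by
      have : Nonempty ι := Fintype.card_pos_iff.1 (by omega)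
      exact ⟨fun _ => 1, fun h => one_ne_zero (congrFun h (Classical.arbitrary ι))⟩
    -- A non-zero vector whose value has least degree. An isotropic vector counts as degree zero, so
    -- no anisotropy is assumed.
    obtain ⟨v, hv, hmin⟩ := WellFounded.has_min
      (measure fun v : ι → k[X] => (v ⬝ᵥ S *ᵥ v).natDegree).wf _ hne
    obtain ⟨g, w, φ, hg, rfl, hφ⟩ := exists_primitive hv
    have hw : w ≠ 0 := by
      rintro rfl
      simp at hφ
    set a := w ⬝ᵥ S *ᵥ w with ha
    have hmin' : ∀ u : ι → k[X], u ≠ 0 → a.natDegree ≤ (u ⬝ᵥ S *ᵥ u).natDegree := by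
      intro u hu
      refine le_trans ?_ (not_lt.1 (hmin u hu))
      have : (g • w) ⬝ᵥ S *ᵥ (g • w) = g * g * a := by
        rw [mulVec_smul, smul_dotProduct, dotProduct_smul, smul_eq_mul, smul_eq_mul, mul_assoc]
      change _ ≤ ((g • w) ⬝ᵥ S *ᵥ (g • w)).natDegree
      rw [this]
      exact natDegree_mul_sq_le hg
    rcases Nat.eq_zero_or_pos a.natDegree with hda | hda
    · exact ⟨w, hw, by rw [← ha, hda, mul_zero]; exact Nat.zero_le _⟩
    have ha0 : a ≠ 0 := by
      rintro h
      rw [h, natDegree_zero] at hda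
      exact hda.ne rfl
    let W : Matrix ι Unit k[X] := replicateCol Unit w
    have hΦ : replicateRow Unit φ * W = 1 := by
      ext i j
      simpa [W, Matrix.mul_apply, dotProduct] using congrArg (Polynomial.coeff · _) hφ
    obtain ⟨m', Z, Y, h1, h2⟩ := exists_complement hΦ
    obtain rfl : m' = m + 1 := by
      have := Fintype.card_congr (indexEquivOfInv h1 h2)
      rw [Fintype.card_sum, Fintype.card_fin, Fintype.card_unit, hc] at this
      omega
    have hiso : FormIso S ((fromCols W Z)ᵀ * S * fromCols W Z) := ⟨_, _, h1, h2, rfl⟩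
    set b := Wᵀ * S * Z with hb
    set D := Zᵀ * S * Z with hD
    have hD' : Dᵀ = D := by
      rw [hD, transpose_mul, transpose_mul, transpose_transpose, hS.eq, Matrix.mul_assoc]
    have hbT : Zᵀ * S * W = bᵀ := by
      rw [hb, transpose_mul, transpose_mul, transpose_transpose, hS.eq, Matrix.mul_assoc]
    have hT : (fromCols W Z)ᵀ * S * fromCols W Z = fromBlocks (single a) b bᵀ D := by
      rw [transpose_fromCols, Matrix.mul_assoc, mul_fromCols, fromRows_mul_fromCols,
        ← Matrix.mul_assoc, ← Matrix.mul_assoc, ← Matrix.mul_assoc, ← Matrix.mul_assoc, hbT]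
      congr 1
      rw [Matrix.mul_assoc]
      refine Matrix.ext fun i j => ?_
      simp [W, Matrix.mul_apply, ha, single, dotProduct, mulVec]
    rw [hT] at hiso
    clear_value b D
    -- `a` times the form induced on the orthogonal complement of `w`, after clearing denominators.
    -- In rank `m + 2` its determinant is, up to a unit square, `a ^ m` times that of `S`.
    set S' := a • D - bᵀ * b with hS'
    have hS'symm : S'.IsSymm := by
      rw [IsSymm, hS', transpose_sub, transpose_smul, transpose_mul, transpose_transpose, hD']
    have hdet : (fromBlocks (single a) b bᵀ D).det * a ^ (m + 1) = a * S'.det := by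
      have hU : (fromBlocks 1 (-b) 0 (a • 1) : Matrix (Unit ⊕ Fin (m + 1)) _ k[X])ᵀ *
          fromBlocks (single a) b bᵀ D * fromBlocks 1 (-b) 0 (a • 1) =
          fromBlocks (single a) 0 0 (a • S') := by
        have hs : ∀ N : Matrix Unit (Fin (m + 1)) k[X], single a * N = a • N := by
          intro N; ext i j; simp [Matrix.mul_apply, single]
        have hs' : ∀ N : Matrix (Fin (m + 1)) Unit k[X], N * single a = a • N := by
          intro N; ext i j; simp [Matrix.mul_apply, single, mul_comm]
        simp only [fromBlocks_transpose, fromBlocks_multiply, transpose_one, transpose_zero,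
          Matrix.one_mul, Matrix.zero_mul, Matrix.mul_zero, add_zero, transpose_neg,
          transpose_smul, Matrix.mul_one, Matrix.smul_mul, Matrix.mul_smul, Matrix.neg_mul,
          Matrix.mul_neg, hs, hs', Matrix.add_mul, hS', smul_sub]
        congr 1 <;> module
      have h3 := congrArg det hU
      rw [det_mul, det_mul, det_transpose, det_fromBlocks_zero₂₁, det_fromBlocks_zero₂₁,
        det_single, det_one, det_smul, det_smul, det_one, Fintype.card_fin] at h3
      apply mul_left_cancel₀ (pow_ne_zero (m + 1) ha0)
      linear_combination h3
    obtain ⟨s, hs⟩ := hiso.exists_det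
    have hsd : (s : k[X]).natDegree = 0 := natDegree_coe_units s
    rw [hs] at hdet
    have hS'0 : S'.det ≠ 0 := by
      intro h
      rw [h, mul_zero] at hdet
      exact mul_ne_zero (mul_ne_zero hd (pow_ne_zero _ s.ne_zero)) (pow_ne_zero _ ha0) hdet
    have hdeg := congrArg natDegree hdet
    rw [natDegree_mul (mul_ne_zero hd (pow_ne_zero _ s.ne_zero)) (pow_ne_zero _ ha0),
      natDegree_mul hd (pow_ne_zero _ s.ne_zero), natDegree_mul ha0 hS'0, natDegree_pow,
      natDegree_pow, hsd, mul_zero, add_zero] at hdeg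
    obtain ⟨x, hx, hxd⟩ := ih S' (by rw [Fintype.card_fin]) hS'symm hS'0
    set β := (b *ᵥ x) () with hβ
    -- Euclidean division of `β` by `a` chooses the first coordinate. Completing the square, `a`
    -- times the value at `z` becomes the squared remainder plus the value of `S'` at `x`.
    let z : Unit ⊕ Fin (m + 1) → k[X] := Sum.elim (fun _ => -(β / a)) x
    have hz : fromCols W Z *ᵥ z ≠ 0 := by
      intro h
      have : z = 0 := by
        have h3 := congrArg (fromRows (replicateRow Unit φ) Y *ᵥ ·) h
        simpa only [mulVec_mulVec, h2, one_mulVec, mulVec_zero] using h3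
      exact hx (funext fun i => congrFun this (Sum.inr i))
    have hval : a * ((fromCols W Z *ᵥ z) ⬝ᵥ S *ᵥ (fromCols W Z *ᵥ z)) =
        (β % a) * (β % a) + x ⬝ᵥ S' *ᵥ x := by
      have h3 : (fromCols W Z *ᵥ z) ⬝ᵥ S *ᵥ (fromCols W Z *ᵥ z) =
          z ⬝ᵥ fromBlocks (single a) b bᵀ D *ᵥ z := by
        rw [← hT, ← mulVec_mulVec, ← mulVec_mulVec, dotProduct_mulVec z, vecMul_transpose]
      have h4 : z ⬝ᵥ fromBlocks (single a) b bᵀ D *ᵥ z =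
          a * (β / a) * (β / a) - 2 * (β / a) * β + x ⬝ᵥ D *ᵥ x := by
        have h5 : x ⬝ᵥ bᵀ *ᵥ (fun _ => -(β / a)) = -(β / a) * β := by
          rw [dotProduct_mulVec, vecMul_transpose]
          simp [dotProduct, hβ, mul_comm]
        have h6 : (fun _ : Unit => -(β / a)) ⬝ᵥ (b *ᵥ x) = -(β / a) * β := by
          simp [dotProduct, hβ]
        have h7 : (fun _ : Unit => -(β / a)) ⬝ᵥ (single a *ᵥ fun _ => -(β / a)) =
            a * (β / a) * (β / a) := by
          simp [dotProduct, mulVec, single]; ring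
        simp only [z, fromBlocks_mulVec, Sum.elim_comp_inl, Sum.elim_comp_inr,
          sumElim_dotProduct_sumElim, dotProduct_add, h5, h6, h7]
        ring
      have h8 : x ⬝ᵥ S' *ᵥ x = a * (x ⬝ᵥ D *ᵥ x) - β * β := by
        rw [hS', sub_mulVec, dotProduct_sub, smul_mulVec, dotProduct_smul, smul_eq_mul,
          ← mulVec_mulVec, dotProduct_mulVec x bᵀ, vecMul_transpose]
        simp [dotProduct, hβ]
      rw [h3, h4, h8, EuclideanDomain.mod_eq_sub_mul_div]
      ring
    have hy := hmin' _ hz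
    have hy0 : (fromCols W Z *ᵥ z) ⬝ᵥ S *ᵥ (fromCols W Z *ᵥ z) ≠ 0 := by
      intro h
      rw [h, natDegree_zero] at hy
      omega
    have hr : (β % a).natDegree < a.natDegree := natDegree_mod_lt _ hda.ne'
    -- By minimality the value at `z` has degree at least that of `a`, while the squared remainder
    -- has degree less than `2 * a.natDegree`. So `S'` must account for the degree, and the
    -- inductive bound on `S'` finishes.
    have hlow : 2 * a.natDegree ≤ (x ⬝ᵥ S' *ᵥ x).natDegree := by
      have h3 := congrArg natDegree hval
      rw [natDegree_mul ha0 hy0] at h3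
      have h4 := natDegree_add_le ((β % a) * (β % a)) (x ⬝ᵥ S' *ᵥ x)
      have h5 : ((β % a) * (β % a)).natDegree ≤ _ := natDegree_mul_le
      rcases le_max_iff.1 (h3.le.trans h4) with h | h <;> omega
    refine ⟨w, hw, ?_⟩
    rw [← ha]
    have h9 := (Nat.mul_le_mul_left (m + 1) hlow).trans hxd
    nlinarith

lemma isUnit_det_plane {R : Type u} [CommRing R] (c : R) : IsUnit (plane c).det := by
  have h : plane c * fromBlocks (single (-c)) 1 1 0 = 1 := by
    refine Matrix.ext fun i j => ?_
    rcases i with i | i <;> rcases j with j | j <;>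
      simp [Matrix.mul_apply, plane, single_apply]
  exact IsUnit.of_mul_eq_one _ (by rw [← det_mul, h, det_one])

lemma FormIso.isUnit_det_right {R : Type u} [CommRing R] [Nontrivial R] {ι κ τ : Type} [Fintype ι]
    [DecidableEq ι] [Fintype κ] [DecidableEq κ] [Fintype τ] [DecidableEq τ] {S : Matrix ι ι R}
    {G : Matrix κ κ R} {S' : Matrix τ τ R} (h : FormIso S (NaiveP1.dsum G S'))
    (hS : IsUnit S.det) : IsUnit S'.det := by
  obtain ⟨s, hs⟩ := h.exists_det
  rw [det_fromBlocks_zero₂₁] at hs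
  have : IsUnit (G.det * S'.det) := by rw [hs]; exact hS.mul (s.isUnit.pow 2)
  exact isUnit_of_mul_isUnit_right this

lemma FormIso.isSymm_right {R : Type u} [CommRing R] {ι κ τ : Type} [Fintype ι]
    [DecidableEq ι] [Fintype κ] [DecidableEq κ] [Fintype τ] [DecidableEq τ] {S : Matrix ι ι R}
    {G : Matrix κ κ R} {S' : Matrix τ τ R} (h : FormIso S (NaiveP1.dsum G S'))
    (hS : S.IsSymm) : S'.IsSymm :=
  (isSymm_fromBlocks_iff.1 (h.isSymm hS)).2.2.2

/-- A non-degenerate symmetric form over `k[T]` is, at every `t`, stably isomorphic to one and the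
same diagonal form. -/
theorem exists_forall_stabIso_diagForm (n : ℕ) : ∀ {ι : Type} [Fintype ι] [DecidableEq ι]
    (S : Matrix ι ι k[X]), Fintype.card ι = n → S.IsSymm → IsUnit S.det →
    ∃ l : List kˣ, l.length = n ∧ ∀ t : k, StabIso (S.map (evalRingHom t)) (diagForm l) := by
  induction n using Nat.strong_induction_on with
  | _ n ih =>
  intro ι _ _ S hc hS hd
  rcases n with _ | m
  · have : IsEmpty ι := Fintype.card_eq_zero_iff.1 hc
    refine ⟨[], rfl, fun t => FormIso.stabIso ?_⟩
    exact .of_submatrix_eq (Equiv.equivOfIsEmpty (Fin 0) ι)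
      (Matrix.ext fun i => i.elim0)
  obtain ⟨v, hv, hvd⟩ := exists_natDegree_le m S hc hS hd.ne_zero
  rw [natDegree_eq_zero_of_isUnit hd] at hvd
  have hv0 : (v ⬝ᵥ S *ᵥ v).natDegree = 0 :=
    (Nat.mul_eq_zero.1 (Nat.le_zero.1 hvd)).resolve_left (Nat.succ_ne_zero m)
  obtain ⟨c, hcv⟩ := natDegree_eq_zero.1 hv0
  have hval : ∀ x y : ι → k[X], (replicateCol Unit x)ᵀ * S * replicateCol Unit y =
      single (x ⬝ᵥ S *ᵥ y) := by
    intro x y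
    rw [Matrix.mul_assoc]
    refine Matrix.ext fun i j => ?_
    simp [Matrix.mul_apply, single, dotProduct, mulVec]
  -- The bound makes the value a constant `c`. A non-zero constant splits off as a line; a zero
  -- value gives a primitive isotropic vector and hence a metabolic plane.
  rcases eq_or_ne c 0 with rfl | hc0
  · obtain ⟨g, w, φ, hg, rfl, hφ⟩ := exists_primitive hv
    have hw : w ⬝ᵥ S *ᵥ w = 0 := by
      rw [mulVec_smul, smul_dotProduct, dotProduct_smul, smul_eq_mul, smul_eq_mul, C_0] at hcv
      simpa [hg] using hcv.symm
    -- As the form is unimodular, the functional `φ` is represented by a vector `y`, which therefore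
    -- pairs to `1` with `w`.
    let y := S⁻¹ *ᵥ φ
    have hy : w ⬝ᵥ S *ᵥ y = 1 := by
      rw [mulVec_mulVec, Matrix.mul_nonsing_inv S hd, one_mulVec, dotProduct_comm, hφ]
    have hy' : y ⬝ᵥ S *ᵥ w = 1 := by
      rw [dotProduct_mulVec, ← mulVec_transpose, hS.eq, dotProduct_comm, hy]
    let W : Matrix ι (Unit ⊕ Unit) k[X] := fromCols (replicateCol Unit w) (replicateCol Unit y)
    have hW : Wᵀ * S * W = plane (y ⬝ᵥ S *ᵥ y) := by
      rw [transpose_fromCols, Matrix.mul_assoc, mul_fromCols, fromRows_mul_fromCols,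
        ← Matrix.mul_assoc, ← Matrix.mul_assoc, ← Matrix.mul_assoc, ← Matrix.mul_assoc,
        hval, hval, hval, hval, hw, hy, hy']
      rfl
    obtain ⟨m', S', hiso⟩ := FormIso.exists_dsum hS (W := W) (by
      rw [hW]; exact isUnit_det_plane _)
    rw [hW] at hiso
    have hm' := hiso.card_eq
    simp only [Fintype.card_sum, Fintype.card_unit, Fintype.card_fin, hc] at hm'
    obtain ⟨l, hl, hst⟩ := ih m' (by omega) S' (Fintype.card_fin _) (hiso.isSymm_right hS)
      (hiso.isUnit_det_right hd)
    refine ⟨1 :: -1 :: l, by simp only [List.length_cons, hl]; omega, fun t => ?_⟩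
    have h1 := hiso.map (evalRingHom t)
    rw [dsum_map, plane_map] at h1
    refine h1.stabIso.trans (((StabIso.plane _).dsum (hst t)).trans ?_)
    refine (FormIso.dsum_assoc _ _ _).stabIso.trans (FormIso.stabIso (FormIso.symm ?_))
    refine (FormIso.diagForm_cons _ _).trans ?_
    simpa using (FormIso.refl _).dsum (FormIso.diagForm_cons (-1) l)
  · obtain ⟨m', S', hiso⟩ := FormIso.exists_dsum hS (W := replicateCol Unit v) (by
      rw [hval, ← hcv, det_single]; exact isUnit_C.2 hc0.isUnit)
    rw [hval, ← hcv] at hiso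
    have hm' := hiso.card_eq
    simp only [Fintype.card_sum, Fintype.card_unit, Fintype.card_fin, hc] at hm'
    obtain ⟨l, hl, hst⟩ := ih m' (by omega) S' (Fintype.card_fin _) (hiso.isSymm_right hS)
      (hiso.isUnit_det_right hd)
    refine ⟨Units.mk0 c hc0 :: l, by simp only [List.length_cons, hl]; omega, fun t => ?_⟩
    have h1 := hiso.map (evalRingHom t)
    rw [dsum_map, single_map, coe_evalRingHom, eval_C] at h1
    refine h1.stabIso.trans (((FormIso.refl _).stabIso.dsum (hst t)).trans ?_)
    exact (FormIso.diagForm_cons (Units.mk0 c hc0) l).symm.stabIso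

/-- Every non-degenerate symmetric form over a field is stably diagonalizable. -/
lemma exists_stabIso_diagForm {ι : Type} [Fintype ι] [DecidableEq ι] (S : Matrix ι ι k)
    (hS : S.IsSymm) (hd : IsUnit S.det) :
    ∃ l : List kˣ, l.length = Fintype.card ι ∧ StabIso S (diagForm l) := by
  obtain ⟨l, hl, h⟩ := exists_forall_stabIso_diagForm _ (S.map (C : k →+* k[X])) rfl
    (by rw [IsSymm, ← transpose_map, hS.eq])
    (by rw [← RingHom.mapMatrix_apply, ← RingHom.map_det]; exact isUnit_C.2 hd)
  refine ⟨l, hl, ?_⟩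
  have h1 := h 0
  have h2 : (S.map (C : k →+* k[X])).map (evalRingHom 0) = S := by
    refine Matrix.ext fun i j => ?_
    simp
  rwa [h2] at h1

end Hermite

/-! ### The Bézout form: symmetry, recursion, non-degeneracy -/

section Bezout

open Matrix Polynomial

variable {R : Type u} [CommRing R]

lemma bezoutian_eq {A B : R[X]} {δ : R[X][X]}
    (h : δ * (C X - X) = C A * B.map C - A.map C * C B) : bezoutian A B = δ := by
  have h1 := (bezoutian_mul A B).trans h.symm
  have h2 : bezoutian A B * (X - C X) = δ * (X - C X) := by linear_combination -h1
  exact (monic_X_sub_C (X : R[X])).isRegular.right h2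

lemma bezoutian_map {R' : Type u} [CommRing R'] (φ : R →+* R') (A B : R[X]) :
    bezoutian (A.map φ) (B.map φ) = (bezoutian A B).map (mapRingHom φ) := by
  apply bezoutian_eq
  have h := congrArg (Polynomial.map (mapRingHom φ)) (bezoutian_mul A B)
  have h1 : ∀ f : R[X], (f.map C).map (mapRingHom φ) = (f.map φ).map C := by
    intro f
    rw [Polynomial.map_map, Polynomial.map_map]
    congr 1
    ext
    simp
  simpa [h1] using h

lemma bezoutMatrix_map {R' : Type u} [CommRing R'] (φ : R →+* R') (n : ℕ) (A B : R[X]) :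
    bezoutMatrix n (A.map φ) (B.map φ) = (bezoutMatrix n A B).map φ := by
  ext i j
  simp [bezoutMatrix, bezoutian_map]

lemma bezoutian_linear (A B : R[X]) (a b c d : R) :
    bezoutian (C a * A + C b * B) (C c * A + C d * B) = C (C (a * d - b * c)) * bezoutian A B := by
  apply bezoutian_eq
  rw [mul_assoc, bezoutian_mul]
  simp only [Polynomial.map_add, Polynomial.map_mul, Polynomial.map_C, map_add, map_mul, map_sub]
  ring

/-- Bézout forms and linear substitutions. -/
lemma bezoutMatrix_linear (n : ℕ) (A B : R[X]) (a b c d : R) :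
    bezoutMatrix n (C a * A + C b * B) (C c * A + C d * B) =
      (a * d - b * c) • bezoutMatrix n A B := by
  ext i j
  simp only [bezoutMatrix, of_apply, Matrix.smul_apply, bezoutian_linear, coeff_C_mul, smul_eq_mul]

lemma coeff_coeff_swap (p : R[X][X]) (i j : ℕ) :
    ((Bivariate.swap p).coeff i).coeff j = (p.coeff j).coeff i := by
  induction p using Polynomial.induction_on' with
  | add p q hp hq => simp [hp, hq]
  | monomial n f =>
    induction f using Polynomial.induction_on' with
    | add f g hf hg => simp [hf, hg]
    | monomial m r =>
      rw [Bivariate.swap_monomial_monomial]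
      simp only [coeff_monomial]
      split_ifs <;> simp_all [coeff_monomial]

lemma swap_bezoutian (A B : R[X]) : Bivariate.swap (bezoutian A B) = bezoutian A B := by
  refine (bezoutian_eq ?_).symm
  have h := congrArg Bivariate.swap (bezoutian_mul A B)
  simp only [map_mul, map_sub, Bivariate.swap_Y, Bivariate.swap_C,
    Bivariate.swap_map_C, Polynomial.map_X] at h
  linear_combination -h

lemma isSymm_bezoutMatrix (n : ℕ) (A B : R[X]) : (bezoutMatrix n A B).IsSymm := by
  ext i j
  simp only [bezoutMatrix, transpose_apply, of_apply]
  rw [← coeff_coeff_swap, swap_bezoutian]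

lemma coeff_bezoutian_eq_zero {n : ℕ} {A B : R[X]} (hA : A.natDegree ≤ n) (hB : B.natDegree ≤ n)
    {q : ℕ} (hq : n ≤ q) : (bezoutian A B).coeff q = 0 := by
  nontriviality R
  have hN : (A.map C * C B - C A * B.map C : R[X][X]).natDegree ≤ n := by
    refine (natDegree_sub_le _ _).trans (max_le ?_ ?_)
    · exact (natDegree_mul_C_le _ _).trans (natDegree_map_le.trans hA)
    · exact (natDegree_C_mul_le _ _).trans (natDegree_map_le.trans hB)
  have h1 : (bezoutian A B).natDegree ≤ n - 1 := by
    rw [bezoutian, natDegree_divByMonic _ (monic_X_sub_C _), natDegree_X_sub_C]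
    omega
  rcases Nat.eq_zero_or_pos n with h0 | h0
  · have h2 : bezoutian A B = 0 := by
      rw [bezoutian, divByMonic_eq_zero_iff (monic_X_sub_C _), degree_X_sub_C]
      exact natDegree_eq_zero_iff_degree_le_zero.1 (Nat.le_zero.1 (hN.trans h0.le)) |>.trans_lt
        (by norm_num)
    rw [h2, coeff_zero]
  · exact coeff_eq_zero_of_natDegree_lt (by omega)

lemma coeff_coeff_bezoutian_eq_zero {n : ℕ} {A B : R[X]} (hA : A.natDegree ≤ n)
    (hB : B.natDegree ≤ n) {p : ℕ} (q : ℕ) (hp : n ≤ p) :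
    ((bezoutian A B).coeff q).coeff p = 0 := by
  rw [← swap_bezoutian, coeff_coeff_swap, coeff_bezoutian_eq_zero hA hB hp, coeff_zero]

lemma bezoutian_step {u v : R} (huv : u * v = 1) (A B : R[X]) :
    bezoutian (X * A - C v * B) (C u * A) = C (C u * A) * A.map C + bezoutian A B := by
  have huv' : C (C u) * C (C v) = (1 : R[X][X]) := by rw [← C_mul, ← C_mul, huv, C_1, C_1]
  apply bezoutian_eq
  rw [add_mul, bezoutian_mul]
  simp only [Polynomial.map_sub, Polynomial.map_mul, Polynomial.map_C, map_mul, map_sub, map_X]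
  linear_combination (C A * B.map C - A.map C * C B) * (-huv')

/-- The new Bézoutian is `u A(X) A(Y)` plus the old one. Written in the basis `A, 1, X, …, X ^ (n -
1)`, this is block diagonal, and since `A` is monic the change of basis is unipotent. -/
lemma bezoutMatrix_step {u v : R} (huv : u * v = 1) {n : ℕ} {A B : R[X]} (hA : A.natDegree ≤ n)
    (hB : B.natDegree ≤ n) (hm : A.coeff n = 1) :
    FormIso (dsum (single u) (bezoutMatrix n A B))
      (bezoutMatrix (n + 1) (X * A - C v * B) (C u * A)) ∧
    (bezoutMatrix (n + 1) (X * A - C v * B) (C u * A)).det = u * (bezoutMatrix n A B).det := by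
  let e : Unit ⊕ Fin n ≃ Fin (n + 1) := (Equiv.sumComm _ _).trans
    ((Equiv.optionEquivSumPUnit _).symm.trans finSuccEquivLast.symm)
  let L : Matrix (Unit ⊕ Fin n) (Unit ⊕ Fin n) R := fromBlocks 1 (of fun _ i => A.coeff i) 0 1
  let L' : Matrix (Unit ⊕ Fin n) (Unit ⊕ Fin n) R := fromBlocks 1 (of fun _ i => -A.coeff i) 0 1
  have h1 : L * L' = 1 := by
    simp only [L, L', fromBlocks_multiply, Matrix.mul_one, Matrix.one_mul, Matrix.mul_zero,
      Matrix.zero_mul, add_zero, zero_add, ← fromBlocks_one]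
    congr 1
    ext; simp
  have h2 : L' * L = 1 := by
    simp only [L, L', fromBlocks_multiply, Matrix.mul_one, Matrix.one_mul, Matrix.mul_zero,
      Matrix.zero_mul, add_zero, zero_add, ← fromBlocks_one]
    congr 1
    ext; simp
  have h3 : (bezoutMatrix (n + 1) (X * A - C v * B) (C u * A)).submatrix e e =
      Lᵀ * dsum (single u) (bezoutMatrix n A B) * L := by
    have hz1 := fun p => coeff_coeff_bezoutian_eq_zero hA hB (p := n) p le_rfl
    have hz2 := coeff_bezoutian_eq_zero hA hB (q := n) le_rfl
    have hc : ∀ p q, ((bezoutian (X * A - C v * B) (C u * A)).coeff q).coeff p =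
        u * A.coeff p * A.coeff q + ((bezoutian A B).coeff q).coeff p := by
      intro p q
      rw [bezoutian_step huv, coeff_add, coeff_add, coeff_C_mul, coeff_map, coeff_mul_C,
        coeff_C_mul]
    refine Matrix.ext fun i j => ?_
    rcases i with i | i <;> rcases j with j | j
    · simp [bezoutMatrix, hc, L, e, fromBlocks_transpose, fromBlocks_multiply, Matrix.mul_apply,
        single_apply, hm, hz2]
    · simp [bezoutMatrix, hc, L, e, fromBlocks_transpose, fromBlocks_multiply, Matrix.mul_apply,
        single_apply, hm, hz1]
    · simp [bezoutMatrix, hc, L, e, fromBlocks_transpose, fromBlocks_multiply, Matrix.mul_apply,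
        single_apply, hm, hz2]
      ring
    · simp only [bezoutMatrix, L, e, fromBlocks_transpose, fromBlocks_multiply]
      simp [hc, Matrix.mul_apply, single_apply]
      ring
  have h4 : FormIso (dsum (single u) (bezoutMatrix n A B))
      ((bezoutMatrix (n + 1) (X * A - C v * B) (C u * A)).submatrix e e) :=
    ⟨L, L', h1, h2, h3.symm⟩
  refine ⟨h4.trans (FormIso.submatrix _ e).symm, ?_⟩
  rw [← det_submatrix_equiv_self e, h3, det_mul, det_mul, det_transpose, det_fromBlocks_zero₂₁,
    det_fromBlocks_zero₂₁, det_single, det_one, det_one]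
  ring

lemma bezoutian_one_coeff (A : R[X]) (p q : ℕ) :
    ((bezoutian A 1).coeff q).coeff p = A.coeff (p + q + 1) := by
  have h : ∀ q, (bezoutian A 1).coeff (q + 1) * X - (bezoutian A 1).coeff q =
      - C (A.coeff (q + 1)) := by
    intro q
    have h1 := congrArg (coeff · (q + 1)) (bezoutian_mul A 1)
    simpa [mul_sub, coeff_C_succ] using h1
  induction p generalizing q with
  | zero =>
    have := congrArg (coeff · 0) (h q)
    simpa using this
  | succ p ih =>
    have := congrArg (coeff · (p + 1)) (h q)
    simp only [coeff_sub, coeff_mul_X, ih, coeff_neg, coeff_C_succ, neg_zero, sub_eq_zero] at this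
    rw [← this]
    congr 1
    ring

variable {k : Type u} [Field k]

/-- Let `Ω` contract the variable `Y` with a kernel vector. The Bézoutian of `(A, B)` is `B(X)`
times that of `(A, 1)` minus `A(X)` times that of `(B, 1)`. So coprimality makes `A` divide a
polynomial of smaller degree, which must vanish. The matrix for `(A, 1)` is triangular for the
antidiagonal, with the leading coefficient of `A` on it, so the kernel vector is zero. -/
lemma det_bezoutMatrix_ne_zero_of_coeff_ne_zero {n : ℕ} {A B : k[X]} (h : Good n A B)
    (hA : A.coeff n ≠ 0) : (bezoutMatrix n A B).det ≠ 0 := by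
  intro h0
  obtain ⟨w, hw, hw0⟩ := Matrix.exists_mulVec_eq_zero_iff.2 h0
  let Ω : k[X][X] → k[X] := fun δ => ∑ q : Fin n, C (w q) * δ.coeff q
  have hΩ : Ω (bezoutian A B) = 0 := by
    ext p
    simp only [Ω, finsetSum_coeff, coeff_C_mul, coeff_zero]
    rcases lt_or_ge p n with hp | hp
    · have := congrFun hw0 ⟨p, hp⟩
      simp only [mulVec, dotProduct, bezoutMatrix, of_apply, Pi.zero_apply] at this
      rw [← this]
      exact Finset.sum_congr rfl fun _ _ => mul_comm _ _
    · exact Finset.sum_eq_zero fun q _ => by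
        rw [coeff_coeff_bezoutian_eq_zero h.natDegree_left h.natDegree_right _ hp, mul_zero]
  have hbez : bezoutian A B = C (-A) * bezoutian B 1 + C B * bezoutian A 1 := by
    apply bezoutian_eq
    rw [add_mul, mul_assoc, mul_assoc, bezoutian_mul, bezoutian_mul]
    simp only [Polynomial.map_one, C_1, map_neg]
    ring
  have hΩ' : Ω (bezoutian A B) = -A * Ω (bezoutian B 1) + B * Ω (bezoutian A 1) := by
    simp only [hbez, Ω, coeff_add, coeff_C_mul, Finset.mul_sum, ← Finset.sum_add_distrib]
    exact Finset.sum_congr rfl fun _ _ => by ring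
  have hdvd : A ∣ Ω (bezoutian A 1) := by
    refine h.isCoprime.dvd_of_dvd_mul_left (Dvd.intro (Ω (bezoutian B 1)) ?_)
    linear_combination hΩ' - hΩ
  have hn : 0 < n := by
    rcases Nat.eq_zero_or_pos n with rfl | hn
    · exact absurd (_root_.funext fun i : Fin 0 => i.elim0) hw
    · exact hn
  have hzero : Ω (bezoutian A 1) = 0 := by
    refine eq_zero_of_dvd_of_degree_lt hdvd ?_
    rw [degree_eq_natDegree (p := A) (fun h => hA (by rw [h, coeff_zero])),
      natDegree_eq_of_le_of_coeff_ne_zero h.natDegree_left hA]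
    refine (degree_lt_iff_coeff_zero _ _).2 fun p hp => ?_
    simp only [Ω, finsetSum_coeff, coeff_C_mul]
    refine Finset.sum_eq_zero fun q _ => ?_
    rw [coeff_coeff_bezoutian_eq_zero h.natDegree_left (by simp) _ hp, mul_zero]
  refine hw (_root_.funext fun q => ?_)
  obtain ⟨q, hq⟩ := q
  induction q using Nat.strong_induction_on with
  | _ q ih =>
    have := congrArg (coeff · (n - 1 - q)) hzero
    simp only [Ω, finsetSum_coeff, coeff_C_mul, bezoutian_one_coeff, coeff_zero] at this
    rw [Finset.sum_eq_single ⟨q, hq⟩] at this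
    · have h1 : n - 1 - q + q + 1 = n := by omega
      rw [h1] at this
      exact (mul_eq_zero.1 this).resolve_right hA
    · rintro ⟨q', hq'⟩ - hne
      rcases lt_or_ge q' q with hlt | hge
      · rw [ih q' hlt hq', Pi.zero_apply, zero_mul]
      · have h2 : q' ≠ q := fun he => hne (Fin.ext he)
        rw [coeff_eq_zero_of_natDegree_lt (p := A), mul_zero]
        exact h.natDegree_left.trans_lt (by simp only; omega)
    · exact fun h => absurd (Finset.mem_univ _) h

lemma det_bezoutMatrix_ne_zero {n : ℕ} {A B : k[X]} (h : Good n A B) :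
    (bezoutMatrix n A B).det ≠ 0 := by
  rcases h.coeff_ne_zero with hA | hB
  · exact det_bezoutMatrix_ne_zero_of_coeff_ne_zero h hA
  · have h1 := det_bezoutMatrix_ne_zero_of_coeff_ne_zero h.symm hB
    have h2 := bezoutMatrix_linear n A B 0 1 1 0
    simp only [C_0, C_1, zero_mul, one_mul, zero_add, add_zero, mul_one, zero_sub] at h2
    rw [h2, det_smul] at h1
    exact right_ne_zero_of_mul h1

/-- The Bézout form of a pair without common zero is non-degenerate. -/
lemma isUnit_det_bezoutMatrix {n : ℕ} {A B : R[X]} (h : Good n A B) :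
    IsUnit (bezoutMatrix n A B).det := by
  by_contra hu
  obtain ⟨I, hI, hmem⟩ := exists_max_ideal_of_mem_nonunits hu
  let := Ideal.Quotient.field I
  -- Being a unit is tested at the residue fields, and goodness of a pair is stable under base
  -- change.
  have h1 := det_bezoutMatrix_ne_zero (k := R ⧸ I) (h.map (Ideal.Quotient.mk I))
  apply h1
  rw [bezoutMatrix_map, ← RingHom.mapMatrix_apply, ← RingHom.map_det]
  exact Ideal.Quotient.eq_zero_iff_mem.2 hmem

end Bezout

/-! ### Descent of the Bézout invariant to homotopy classes -/

section Invariant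

open Matrix Polynomial

variable {k : Type u} [Field k]

lemma SymmForm.toTarget_eq_iff {n : ℕ} {b b' : SymmForm k n} :
    b.toTarget = b'.toTarget ↔ StabIso b.gram b'.gram ∧
      ∃ s : kˣ, b'.gram.det = (s : k) ^ (2 * n) * b.gram.det := by
  have h1 : b.toTarget = b'.toTarget ↔ Quotient.mk (stableSetoid k n) b = Quotient.mk _ b' ∧
      (b.det : UnitsModPow k (2 * n)) = (b'.det : UnitsModPow k (2 * n)) :=
    Subtype.ext_iff.trans Prod.ext_iff
  have h2 : Quotient.mk (stableSetoid k n) b = Quotient.mk _ b' ↔ StabIso b.gram b'.gram :=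
    Quotient.eq.trans ⟨fun h => SymmForm.StablyIso.stabIso h, fun h => h.stablyIso⟩
  rw [h1, h2, QuotientGroup.eq]
  refine and_congr_right fun _ => ?_
  constructor
  · rintro ⟨s, hs⟩
    refine ⟨s, ?_⟩
    rw [eq_inv_mul_iff_mul_eq] at hs
    have := congrArg Units.val hs
    simp only [powMonoidHom_apply, SymmForm.det, Units.val_mul, IsUnit.unit_spec,
      Units.val_pow_eq_pow_val] at this
    rw [← this, mul_comm]
  · rintro ⟨s, hs⟩
    refine ⟨s, ?_⟩
    rw [eq_inv_mul_iff_mul_eq]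
    ext
    simp only [powMonoidHom_apply, SymmForm.det, Units.val_mul, IsUnit.unit_spec,
      Units.val_pow_eq_pow_val]
    rw [hs, mul_comm]

/-- The Bézout form of a pair without common zero. -/
def Good.form {n : ℕ} {A B : k[X]} (h : Good n A B) : SymmForm k n where
  gram := bezoutMatrix n A B
  isSymm := isSymm_bezoutMatrix n A B
  isUnit_det := isUnit_det_bezoutMatrix h

lemma FormIso.smul_sq {ι : Type} [Fintype ι] [DecidableEq ι] (M : Matrix ι ι k) {u : k}
    (hu : u ≠ 0) : FormIso M ((u ^ 2) • M) := by
  refine ⟨u • 1, u⁻¹ • 1, ?_, ?_, ?_⟩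
  · rw [smul_mul_smul_comm, mul_inv_cancel₀ hu, Matrix.one_mul, one_smul]
  · rw [smul_mul_smul_comm, inv_mul_cancel₀ hu, Matrix.one_mul, one_smul]
  · rw [transpose_smul, transpose_one, Matrix.smul_mul, Matrix.one_mul, smul_mul_smul_comm,
      Matrix.mul_one, pow_two]

lemma bezoutMatrix_smul (n : ℕ) (A B : k[X]) (u : k) :
    bezoutMatrix n (C u * A) (C u * B) = (u ^ 2) • bezoutMatrix n A B := by
  have := bezoutMatrix_linear n A B u 0 0 u
  simpa [pow_two] using this

lemma Good.toTarget_smul {n : ℕ} {A B : k[X]} (h : Good n A B) {u : k} (hu : u ≠ 0) :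
    (h.smul hu).form.toTarget = h.form.toTarget := by
  refine (SymmForm.toTarget_eq_iff.2 ⟨?_, Units.mk0 u hu, ?_⟩).symm
  · simp only [Good.form, bezoutMatrix_smul]
    exact (FormIso.smul_sq _ hu).stabIso
  · simp only [Good.form, bezoutMatrix_smul, det_smul, Fintype.card_fin, Units.val_mk0, pow_mul]

lemma Good.stabIso_map {n : ℕ} {A B : k[X][X]} (h : Good n A B) (s t : k) :
    StabIso (bezoutMatrix n (A.map (evalRingHom s)) (B.map (evalRingHom s)))
      (bezoutMatrix n (A.map (evalRingHom t)) (B.map (evalRingHom t))) := by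
  obtain ⟨l, -, hl⟩ := exists_forall_stabIso_diagForm n (bezoutMatrix n A B) (Fintype.card_fin n)
    (isSymm_bezoutMatrix n A B) (isUnit_det_bezoutMatrix h)
  rw [bezoutMatrix_map, bezoutMatrix_map]
  exact (hl s).trans (hl t).symm

/-- The determinant over `k[T]` is a unit, hence a constant, so along a path it is preserved exactly
and not merely up to squares. -/
lemma Good.det_map {n : ℕ} {A B : k[X][X]} (h : Good n A B) (s t : k) :
    (bezoutMatrix n (A.map (evalRingHom s)) (B.map (evalRingHom s))).det =
      (bezoutMatrix n (A.map (evalRingHom t)) (B.map (evalRingHom t))).det := by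
  obtain ⟨c, -, hc⟩ := Polynomial.isUnit_iff.1 (isUnit_det_bezoutMatrix h)
  have key : ∀ t : k,
      (bezoutMatrix n (A.map (evalRingHom t)) (B.map (evalRingHom t))).det = c := by
    intro t
    rw [bezoutMatrix_map, ← RingHom.mapMatrix_apply, ← RingHom.map_det, ← hc, coe_evalRingHom,
      eval_C]
  rw [key, key]

lemma Good.toTarget_map {n : ℕ} {A B : k[X][X]} (h : Good n A B) :
    (h.map (evalRingHom (0 : k))).form.toTarget = (h.map (evalRingHom (1 : k))).form.toTarget :=
  SymmForm.toTarget_eq_iff.2 ⟨h.stabIso_map 0 1, 1, by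
    rw [Units.val_one, one_pow, one_mul]; exact (h.det_map 0 1).symm⟩

/-- The map sending `A / B` to its Bézout form is well defined. -/
lemma exists_bezoutMap : ∃ Φ : NaiveClasses k → Σ n : ℕ, Target k n,
    ∀ (n : ℕ) (A B : k[X]) (h : Good n A B), Φ h.cls = ⟨n, h.form.toTarget⟩ :=
  NaiveClasses.exists_lift (T := Σ n : ℕ, Target k n) (fun n _ _ h => ⟨n, h.form.toTarget⟩)
    (fun n _ _ h _ hu => congrArg (Sigma.mk n) (h.toTarget_smul hu))
    (fun n _ _ h => congrArg (Sigma.mk n) h.toTarget_map)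

/-- The Bézout map on unpointed naive homotopy classes. -/
def bezoutMap : NaiveClasses k → Σ n : ℕ, Target k n := exists_bezoutMap.choose

lemma bezoutMap_cls {n : ℕ} {A B : k[X]} (h : Good n A B) :
    bezoutMap h.cls = ⟨n, h.form.toTarget⟩ := exists_bezoutMap.choose_spec n A B h

end Invariant

/-! ### Pointed functions and continued fractions -/

section Pointed

open Polynomial

/-- A pointed rational function of degree `n` over `R`, i.e. one sending `∞` to `∞`. -/
structure Pointed {R : Type u} [CommRing R] (n : ℕ) (A B : R[X]) : Prop where
  natDegree_le : A.natDegree ≤ n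
  coeff_eq_one : A.coeff n = 1
  degree_lt : B.degree < n
  isCoprime : IsCoprime A B

variable {R : Type u} [CommRing R]

lemma Pointed.good {n : ℕ} {A B : R[X]} (h : Pointed n A B) : Good n A B :=
  good_of_isUnit_coeff h.natDegree_le (natDegree_le_iff_degree_le.2 h.degree_lt.le) h.isCoprime
    (h.coeff_eq_one ▸ isUnit_one)

lemma isCoprime_linear {A B a b c d : R[X]} (h : IsCoprime A B) (hd : a * d - b * c = 1) :
    IsCoprime (a * A + b * B) (c * A + d * B) := by
  obtain ⟨x, y, hxy⟩ := h
  refine ⟨x * d - y * c, y * a - x * b, ?_⟩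
  linear_combination hxy + (x * A + y * B) * hd

lemma Pointed.map {R' : Type u} [CommRing R'] (φ : R →+* R') {n : ℕ} {A B : R[X]}
    (h : Pointed n A B) : Pointed n (A.map φ) (B.map φ) where
  natDegree_le := natDegree_map_le.trans h.natDegree_le
  coeff_eq_one := by rw [coeff_map, h.coeff_eq_one, map_one]
  degree_lt := degree_map_le.trans_lt h.degree_lt
  isCoprime := h.isCoprime.map (mapRingHom φ)

lemma pointed_of_sub {n : ℕ} {A A' B : R[X]} (hA : A.natDegree ≤ n) (hc : A.coeff n = 1)
    (hA' : A'.degree < n) (hB : B.degree < n) (h : IsCoprime (A - A') B) :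
    Pointed n (A - A') B where
  natDegree_le := (natDegree_sub_le _ _).trans
    (max_le hA (natDegree_le_iff_degree_le.2 hA'.le))
  coeff_eq_one := by rw [coeff_sub, hc, coeff_eq_zero_of_degree_lt hA', sub_zero]
  degree_lt := hB
  isCoprime := h

lemma degree_mul_lt {A B : R[X]} {a b c : ℕ} (hA : A.natDegree ≤ a) (hB : B.degree < b)
    (h : a + b ≤ c) : (A * B).degree < c := by
  rw [degree_lt_iff_coeff_zero] at hB ⊢
  intro m hm
  rw [coeff_mul]
  refine Finset.sum_eq_zero fun x hx => ?_
  have hx' := Finset.HasAntidiagonal.mem_antidiagonal.1 hx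
  rcases le_or_gt b x.2 with h1 | h1
  · rw [hB _ h1, mul_zero]
  · rw [coeff_eq_zero_of_natDegree_lt (by omega), zero_mul]

lemma degree_lt_of_natDegree_le {A : R[X]} {a b : ℕ} (hA : A.natDegree ≤ a) (h : a < b) :
    A.degree < b :=
  (degree_le_of_natDegree_le hA).trans_lt (by exact_mod_cast h)

/-- Left multiplication by a matrix of determinant one whose first column is `[monic, smaller]`
and whose second column is smaller. -/
lemma Pointed.linear {n e : ℕ} {A B a b c d : R[X]} (h : Pointed n A B) (ha : a.natDegree ≤ e)
    (ha1 : a.coeff e = 1) (hb : b.natDegree ≤ e) (hc : c.degree < e) (hd : d.natDegree ≤ e)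
    (hdet : a * d + b * c = 1) : Pointed (n + e) (a * A - b * B) (c * A + d * B) := by
  refine pointed_of_sub ?_ ?_ ?_ ?_ ?_
  · exact natDegree_mul_le.trans (by have := h.natDegree_le; omega)
  · rw [add_comm, coeff_mul_add_eq_of_natDegree_le ha h.natDegree_le, ha1, h.coeff_eq_one, one_mul]
  · exact degree_mul_lt hb h.degree_lt (by omega)
  · refine (degree_add_le _ _).trans_lt (max_lt ?_ ?_)
    · rw [mul_comm]
      exact degree_mul_lt h.natDegree_le hc le_rfl
    · exact degree_mul_lt hd h.degree_lt (by omega)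
  · have := isCoprime_linear (a := a) (b := -b) (c := c) (d := d) h.isCoprime
      (by linear_combination hdet)
    rwa [neg_mul, ← sub_eq_add_neg] at this

/-- The pair `(X A - u⁻¹ B, u A)`, i.e. the rational function `X / u - 1 / (u² (A / B))`. -/
def cfStep (u : Rˣ) (p : R[X] × R[X]) : R[X] × R[X] :=
  (X * p.1 - C (↑u⁻¹ : R) * p.2, C (u : R) * p.1)

lemma Pointed.cfStep (u : Rˣ) {n : ℕ} {p : R[X] × R[X]} (h : Pointed n p.1 p.2) :
    Pointed (n + 1) (cfStep u p).1 (cfStep u p).2 := by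
  have := h.linear (e := 1) (a := X) (b := C (↑u⁻¹ : R)) (c := C (u : R)) (d := 0)
    natDegree_X_le coeff_X_one (by simp) (degree_lt_of_natDegree_le (natDegree_C _).le one_pos)
    (by simp) (by rw [← C_mul, Units.inv_mul, C_1, mul_zero, zero_add])
  simpa [NaiveP1.cfStep] using this

/-- The pointed rational function with a given continued fraction expansion. -/
def cf : List Rˣ → R[X] × R[X]
  | [] => (1, 0)
  | u :: l => cfStep u (cf l)

lemma pointed_cf (l : List Rˣ) : Pointed l.length (cf l).1 (cf l).2 := by
  induction l with
  | nil => exact ⟨by simp [cf], by simp [cf], by simp [cf], isCoprime_one_left⟩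
  | cons u l ih => exact ih.cfStep u

variable {k : Type u} [Field k]

/-- Pointed naive homotopy of pointed rational functions. -/
inductive PointedEq (n : ℕ) : k[X] × k[X] → k[X] × k[X] → Prop
  | path {A B : k[X][X]} (h : Pointed n A B) :
      PointedEq n (A.map (evalRingHom 0), B.map (evalRingHom 0))
        (A.map (evalRingHom 1), B.map (evalRingHom 1))
  | refl {p : k[X] × k[X]} (h : Pointed n p.1 p.2) : PointedEq n p p
  | symm {p q : k[X] × k[X]} (h : PointedEq n p q) : PointedEq n q p
  | trans {p q r : k[X] × k[X]} (h : PointedEq n p q) (h' : PointedEq n q r) : PointedEq n p r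

lemma PointedEq.of_path {n : ℕ} {A B : k[X][X]} (h : Pointed n A B) {p q : k[X] × k[X]}
    (h1 : A.map (evalRingHom 0) = p.1) (h2 : B.map (evalRingHom 0) = p.2)
    (h3 : A.map (evalRingHom 1) = q.1) (h4 : B.map (evalRingHom 1) = q.2) : PointedEq n p q := by
  obtain ⟨_, _⟩ := p
  obtain ⟨_, _⟩ := q
  subst h1 h2 h3 h4
  exact .path h

lemma PointedEq.cls_eq {n : ℕ} {p q : k[X] × k[X]} (h : PointedEq n p q) :
    ∃ (hp : Pointed n p.1 p.2) (hq : Pointed n q.1 q.2), hp.good.cls = hq.good.cls := by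
  induction h with
  | path h => exact ⟨h.map _, h.map _, h.good.cls_map_eq⟩
  | refl h => exact ⟨h, h, rfl⟩
  | symm _ ih =>
    obtain ⟨hp, hq, h⟩ := ih
    exact ⟨hq, hp, h.symm⟩
  | trans _ _ ih1 ih2 =>
    obtain ⟨hp, _, h1⟩ := ih1
    obtain ⟨_, hr, h2⟩ := ih2
    exact ⟨hp, hr, h1.trans h2⟩

lemma PointedEq.stabIso {n : ℕ} {p q : k[X] × k[X]} (h : PointedEq n p q) :
    StabIso (bezoutMatrix n p.1 p.2) (bezoutMatrix n q.1 q.2) := by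
  induction h with
  | path h => exact h.good.stabIso_map 0 1
  | refl h => exact (FormIso.refl _).stabIso
  | symm _ ih => exact ih.symm
  | trans _ _ ih1 ih2 => exact ih1.trans ih2

lemma PointedEq.cfStep (u : kˣ) {n : ℕ} {p q : k[X] × k[X]} (h : PointedEq n p q) :
    PointedEq (n + 1) (cfStep u p) (cfStep u q) := by
  induction h with
  | @path A B h =>
    have h1 := Pointed.cfStep (Units.map (C : k →+* k[X]).toMonoidHom u) (p := (A, B)) h
    have h2 : ∀ (t : k) (v : kˣ), (evalRingHom t) (Units.map (C : k →+* k[X]).toMonoidHom v) = v := by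
      intro t v
      simp
    refine .of_path h1 ?_ ?_ ?_ ?_ <;>
    simp only [NaiveP1.cfStep, Polynomial.map_sub, Polynomial.map_mul, Polynomial.map_X,
      Polynomial.map_C, ← map_inv, h2]
  | refl h => exact .refl (h.cfStep u)
  | symm _ ih => exact ih.symm
  | trans _ _ ih1 ih2 => exact ih1.trans ih2

lemma bezoutMatrix_cf (l : List kˣ) :
    FormIso (diagForm l) (bezoutMatrix l.length (cf l).1 (cf l).2) ∧
      (bezoutMatrix l.length (cf l).1 (cf l).2).det = (l.prod : kˣ) := by
  induction l with
  | nil =>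
    refine ⟨.of_submatrix_eq (Equiv.refl _) (Matrix.ext fun i => i.elim0), ?_⟩
    simp [Matrix.det_fin_zero]
  | cons u l ih =>
    have hp := pointed_cf l
    obtain ⟨h1, h2⟩ := bezoutMatrix_step u.mul_inv hp.natDegree_le
      (natDegree_le_iff_degree_le.2 hp.degree_lt.le) hp.coeff_eq_one
    refine ⟨((FormIso.diagForm_cons u l).trans ((FormIso.refl _).dsum ih.1)).trans h1, ?_⟩
    rw [List.prod_cons, Units.val_mul, ← ih.2]
    exact h2

/-- One step of the Euclidean algorithm. -/
lemma Pointed.exists_euclid {n : ℕ} {A B : k[X]} (h : Pointed (n + 1) A B) :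
    ∃ (u : kˣ) (m e : ℕ) (Q A' B' : k[X]), m + e = n ∧ Pointed m A' B' ∧ Q.Monic ∧
      Q.natDegree = e + 1 ∧ A = Q * A' - C (↑u⁻¹ : k) * B' ∧ B = C (u : k) * A' := by
  have hAm : A.Monic := monic_of_natDegree_le_of_coeff_eq_one _ h.natDegree_le h.coeff_eq_one
  have hAd : A.natDegree = n + 1 := natDegree_eq_of_le_of_coeff_ne_zero h.natDegree_le
    (by rw [h.coeff_eq_one]; exact one_ne_zero)
  have hB0 : B ≠ 0 := by
    rintro rfl
    have := natDegree_eq_zero_of_isUnit (isCoprime_zero_right.1 h.isCoprime)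
    omega
  have hBd : B.natDegree < n + 1 := (natDegree_lt_iff_degree_lt hB0).2 h.degree_lt
  obtain ⟨e, he⟩ := Nat.exists_eq_add_of_le (Nat.lt_succ_iff.1 hBd)
  set u := Units.mk0 _ (leadingCoeff_ne_zero.2 hB0) with hu
  set A' := C (↑u⁻¹ : k) * B with hA'
  have hA'm : A'.Monic := by
    rw [hA', Monic, leadingCoeff_mul, leadingCoeff_C]
    exact u.inv_mul
  have hA'd : A'.natDegree = B.natDegree := by rw [hA', natDegree_C_mul (Units.ne_zero _)]
  have hQd : (A /ₘ A').natDegree = e + 1 := by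
    rw [natDegree_divByMonic _ hA'm, hAd, hA'd]; omega
  have hQm : (A /ₘ A').Monic := by
    have := leadingCoeff_divByMonic_of_monic (p := A) hA'm (by
      rw [degree_eq_natDegree hA'm.ne_zero, degree_eq_natDegree hAm.ne_zero, hAd, hA'd]
      exact_mod_cast hBd.le)
    rw [Monic, this, hAm]
  have hdiv := modByMonic_add_div A A'
  have huC : C (u : k) * C (↑u⁻¹ : k) = 1 := by rw [← C_mul, Units.mul_inv, C_1]
  have hBA : B = C (u : k) * A' := by rw [hA', ← mul_assoc, huC, one_mul]
  -- The remainder is rescaled by `-u` so that division takes the shape `A = Q A' - u⁻¹ B'` of a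
  -- continued fraction step.
  have hp : Pointed B.natDegree A' (C (u : k) * -(A %ₘ A')) := by
    refine ⟨hA'd.le, by rw [← hA'd]; exact hA'm, ?_, ?_⟩
    · rw [degree_C_mul u.ne_zero, degree_neg, ← hA'd, ← degree_eq_natDegree hA'm.ne_zero]
      exact degree_modByMonic_lt _ hA'm
    · obtain ⟨x, y, hxy⟩ := h.isCoprime
      refine ⟨x * (A /ₘ A') + y * C (u : k), -x * C (↑u⁻¹ : k), ?_⟩
      linear_combination hxy + x * hdiv - y * hBA + (x * (A %ₘ A')) * huC
  refine ⟨u, B.natDegree, e, _, A', _, he.symm, hp, hQm, hQd, ?_, hBA⟩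
  linear_combination -hdiv - (A %ₘ A') * huC

/-- A pointed function whose denominator has degree `n - 1` is a continued fraction step. -/
lemma Pointed.exists_cfStep {n : ℕ} {A B : k[X]} (h : Pointed (n + 1) A B) (hB : B.coeff n ≠ 0) :
    ∃ (u : kˣ) (A' B' : k[X]), Pointed n A' B' ∧
      PointedEq (n + 1) (A, B) (NaiveP1.cfStep u (A', B')) := by
  obtain ⟨u, m, e, Q, A', B', hme, hp, hQm, hQd, hA, hB'⟩ := h.exists_euclid
  obtain rfl : e = 0 := by
    by_contra he
    rw [hB', coeff_C_mul, coeff_eq_zero_of_natDegree_lt, mul_zero] at hB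
    · exact hB rfl
    · have := hp.natDegree_le
      omega
  obtain rfl : m = n := by omega
  have hQ := hQm.eq_X_add_C hQd
  set c := Q.coeff 0
  refine ⟨u, A', B', hp, ?_⟩
  -- Here the quotient is `X + c`; the path contracts the constant `c` to zero and keeps the matrix
  -- of determinant one.
  have h1 := (hp.map (C : k →+* k[X])).linear (e := 1) (a := X + C (C c * (1 - X)))
    (b := C (C (↑u⁻¹ : k))) (c := C (C (u : k))) (d := 0) (natDegree_X_add_C _).le
    (by simp [coeff_one]) (by simp) (degree_lt_of_natDegree_le (natDegree_C _).le one_pos)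
    (by simp) (by rw [← C_mul, ← C_mul, Units.inv_mul, C_1, C_1, mul_zero, zero_add])
  refine .of_path h1 ?_ ?_ ?_ ?_ <;>
    simp [map_C_map_evalRingHom, NaiveP1.cfStep, hA, hB', hQ]

/-- Every pointed function is homotopic to one whose denominator has maximal degree. -/
lemma Pointed.exists_coeff_ne_zero {n : ℕ} {A B : k[X]} (h : Pointed (n + 1) A B) :
    ∃ p : k[X] × k[X], PointedEq (n + 1) (A, B) p ∧ p.2.coeff n ≠ 0 := by
  by_cases hB : B.coeff n ≠ 0
  · exact ⟨_, .refl h, hB⟩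
  obtain ⟨u, m, e, Q, A', B', hme, hp, hQm, hQd, hA, hB'⟩ := h.exists_euclid
  rcases e with _ | j
  · refine absurd ?_ hB
    obtain rfl : m = n := by omega
    rw [hB', coeff_C_mul, hp.coeff_eq_one, mul_one]
    exact u.ne_zero
  obtain rfl : n = m + j + 1 := by omega
  have huu : C (C (↑u⁻¹ : k)) * C (C (u : k)) = (1 : k[X][X]) := by
    rw [← C_mul, ← C_mul, Units.inv_mul, C_1, C_1]
  -- First path: the monic quotient `Q` is moved linearly to `X ^ (j + 2)`.
  have h1 := (hp.map (C : k →+* k[X])).linear (e := j + 2)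
    (a := Q.map C * C (1 - X) + X ^ (j + 2) * C X) (b := C (C (↑u⁻¹ : k))) (c := C (C (u : k)))
    (d := 0)
    ((natDegree_add_le _ _).trans (max_le
      ((natDegree_mul_C_le _ _).trans (natDegree_map_le.trans hQd.le))
      ((natDegree_mul_C_le _ _).trans (natDegree_X_pow_le _))))
    (by
      have : Q.coeff (j + 2) = 1 := by rw [← hQd]; exact hQm
      rw [coeff_add, coeff_mul_C, coeff_mul_C, coeff_map, this, coeff_X_pow_self]
      simp)
    (by simp) (degree_lt_of_natDegree_le (natDegree_C _).le (by omega))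
    (by simp) (by rw [mul_zero, zero_add, huu])
  -- Second path, with parameter `T`: the lower left entry grows from `u` to `T X ^ (j + 1) + u`,
  -- and the other entries are adjusted to keep the determinant equal to `1`. At `T = 1` the
  -- denominator has full degree.
  have h2 := (hp.map (C : k →+* k[X])).linear (e := j + 2)
    (a := X ^ (j + 2)) (b := C (C (↑u⁻¹ : k)) - C (X * C (↑u⁻¹ : k) ^ 2) * X ^ (j + 1))
    (c := C X * X ^ (j + 1) + C (C (u : k)))
    (d := C ((X * C (↑u⁻¹ : k)) ^ 2) * X ^ j)
    (natDegree_X_pow_le _) (coeff_X_pow_self _)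
    ((natDegree_sub_le _ _).trans (max_le (by simp)
      ((natDegree_C_mul_le _ _).trans ((natDegree_X_pow_le _).trans (by omega)))))
    (degree_lt_of_natDegree_le (a := j + 1)
      ((natDegree_add_le _ _).trans (max_le
        ((natDegree_C_mul_le _ _).trans (natDegree_X_pow_le _)) (by simp))) (by omega))
    ((natDegree_C_mul_le _ _).trans ((natDegree_X_pow_le _).trans (by omega)))
    (by
      simp only [map_mul, map_pow]
      linear_combination (1 - C X * X ^ (j + 1) * C (C (↑u⁻¹ : k))) * huu)
  refine ⟨_, .trans (.of_path h1 (q := (X ^ (j + 2) * A' - C (↑u⁻¹ : k) * B', C (u : k) * A'))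
    ?_ ?_ ?_ ?_) (.of_path h2 (q := (X ^ (j + 2) * A' - (C (↑u⁻¹ : k) -
      C (↑u⁻¹ : k) ^ 2 * X ^ (j + 1)) * B', (X ^ (j + 1) + C (u : k)) * A' +
      C (↑u⁻¹ : k) ^ 2 * X ^ j * B')) ?_ ?_ ?_ ?_), ?_⟩
  · simp [map_C_map_evalRingHom, hA]
  · simp [map_C_map_evalRingHom, hB']
  · simp [map_C_map_evalRingHom]
  · simp [map_C_map_evalRingHom]
  · simp [map_C_map_evalRingHom]
  · simp [map_C_map_evalRingHom]
  · simp [map_C_map_evalRingHom]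
  · simp [map_C_map_evalRingHom]
  · have h3 : A'.coeff (m + j + 1) = 0 :=
      coeff_eq_zero_of_natDegree_lt (by have := hp.natDegree_le; omega)
    have h4 : B'.coeff (m + 1) = 0 := by
      refine coeff_eq_zero_of_degree_lt (hp.degree_lt.trans ?_)
      exact_mod_cast Nat.lt_succ_self m
    have h5 : m + j + 1 = m + (j + 1) := rfl
    have h6 : m + j + 1 = (m + 1) + j := by omega
    simp only
    rw [add_mul, coeff_add, coeff_add, coeff_C_mul, h3, mul_assoc, ← C_pow, coeff_C_mul]
    nth_rw 1 [h5]
    rw [coeff_X_pow_mul, hp.coeff_eq_one, h6, coeff_X_pow_mul, h4]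
    simp

/-- Every pointed function is homotopic to a continued fraction with linear partial quotients. -/
lemma Pointed.exists_cf (n : ℕ) : ∀ {A B : k[X]}, Pointed n A B →
    ∃ l : List kˣ, l.length = n ∧ PointedEq n (A, B) (cf l) := by
  induction n with
  | zero =>
    intro A B h
    have hA : A = 1 := by
      rw [eq_C_of_natDegree_le_zero h.natDegree_le, h.coeff_eq_one, C_1]
    have hB : B = 0 := by
      have := h.degree_lt
      rwa [Nat.cast_zero, Nat.WithBot.lt_zero_iff, degree_eq_bot] at this
    subst hA hB
    exact ⟨[], rfl, .refl (pointed_cf ([] : List kˣ))⟩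
  | succ n ih =>
    intro A B h
    obtain ⟨p, hp, hp0⟩ := h.exists_coeff_ne_zero
    obtain ⟨-, hp', -⟩ := hp.cls_eq
    obtain ⟨u, A', B', hA'B', h1⟩ := hp'.exists_cfStep hp0
    obtain ⟨l, hl, h2⟩ := ih hA'B'
    exact ⟨u :: l, by rw [List.length_cons, hl], (hp.trans h1).trans (h2.cfStep u)⟩

end Pointed

/-! ### Homotopies between continued fractions from moves of binary forms -/

section PairMoves

open Polynomial

/-- Two steps of a continued fraction, parametrized by a binary form of matrix `[c, d; d, p]` and
the inverse `D` of its determinant. For `d = 0` these are the steps with entries `c` and `p`. -/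
def pairStep {R : Type u} [CommRing R] (D p d c : R) (q : R[X] × R[X]) : R[X] × R[X] :=
  ((X ^ 2 - C (p * d * D) * X - C (p ^ 2 * D)) * q.1 -
      (C (c * D) * X - C (d * (p * c + (p * c - d ^ 2)) * D ^ 2)) * q.2,
    (C c * X + C d) * q.1 + C (-(c ^ 2 * D)) * q.2)

lemma Pointed.pairStep {R : Type u} [CommRing R] {n : ℕ} {D p d c : R} {q : R[X] × R[X]}
    (h : Pointed n q.1 q.2) (hD : (p * c - d ^ 2) * D = 1) :
    Pointed (n + 2) (NaiveP1.pairStep D p d c q).1 (NaiveP1.pairStep D p d c q).2 := by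
  have hD' : (C p * C c - C d ^ 2) * C D = (1 : R[X]) := by
    rw [← C_mul, ← C_pow, ← C_sub, ← C_mul, hD, C_1]
  refine h.linear (e := 2) ?_ ?_ ?_ ?_ ?_ ?_
  · compute_degree!
  · simp [-map_mul, -map_pow]
  · compute_degree!
  · exact degree_lt_of_natDegree_le (a := 1) (by compute_degree) one_lt_two
  · compute_degree!
  · simp only [map_mul, map_neg, map_pow, map_sub, map_add]
    linear_combination ((C p * C c - C d ^ 2) * C D + 1 - C c * C d * C D * X) * hD'

variable {k : Type u} [Field k]

lemma map_pairStep (t : k) (D p d c : k[X]) (q : k[X] × k[X]) :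
    (((pairStep D p d c (q.1.map C, q.2.map C)).1.map (evalRingHom t),
      (pairStep D p d c (q.1.map C, q.2.map C)).2.map (evalRingHom t)) : k[X] × k[X]) =
    pairStep (D.eval t) (p.eval t) (d.eval t) (c.eval t) q := by
  simp [pairStep, map_C_map_evalRingHom]

/-- Any polynomial path of binary forms with constant non-zero determinant is a homotopy; all later
moves are instances. -/
lemma PointedEq.pairStep {n : ℕ} {q : k[X] × k[X]} (h : Pointed n q.1 q.2) {D : k} (p d c : k[X])
    (hD : (p * c - d ^ 2) * C D = 1) :
    PointedEq (n + 2) (NaiveP1.pairStep D (p.eval 0) (d.eval 0) (c.eval 0) q)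
      (NaiveP1.pairStep D (p.eval 1) (d.eval 1) (c.eval 1) q) := by
  have h1 := (h.map (C : k →+* k[X])).pairStep (q := (q.1.map C, q.2.map C)) hD
  have h0 := map_pairStep 0 (C D) p d c q
  have h1' := map_pairStep 1 (C D) p d c q
  rw [eval_C] at h0 h1'
  rw [← h0, ← h1']
  exact .path h1

variable {n : ℕ} {q : k[X] × k[X]} {D p d c : k}

lemma PointedEq.pairStep_left (h : Pointed n q.1 q.2) (hD : (p * c - d ^ 2) * D = 1) (s : k)
    {p' d' : k} (hp : p' = p + 2 * s * d + s ^ 2 * c) (hd : d' = d + s * c) :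
    PointedEq (n + 2) (NaiveP1.pairStep D p d c q) (NaiveP1.pairStep D p' d' c q) := by
  have hD' : (C p * C c - C d ^ 2) * C D = (1 : k[X]) := by
    rw [← C_mul, ← C_pow, ← C_sub, ← C_mul, hD, C_1]
  have h1 := PointedEq.pairStep h (D := D) (C p + 2 * (C s * X) * C d + (C s * X) ^ 2 * C c)
    (C d + C s * X * C c) (C c) (by linear_combination hD')
  simpa [hp, hd] using h1

lemma PointedEq.pairStep_right (h : Pointed n q.1 q.2) (hD : (p * c - d ^ 2) * D = 1) (s : k)
    {c' d' : k} (hc : c' = c + 2 * s * d + s ^ 2 * p) (hd : d' = d + s * p) :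
    PointedEq (n + 2) (NaiveP1.pairStep D p d c q) (NaiveP1.pairStep D p d' c' q) := by
  have hD' : (C p * C c - C d ^ 2) * C D = (1 : k[X]) := by
    rw [← C_mul, ← C_pow, ← C_sub, ← C_mul, hD, C_1]
  have h1 := PointedEq.pairStep h (D := D) (C p) (C d + C s * X * C p)
    (C c + 2 * (C s * X) * C d + (C s * X) ^ 2 * C p) (by linear_combination hD')
  simpa [hc, hd] using h1

/-- With a zero diagonal entry the determinant `-d²` does not involve `c`, which can be moved
freely. Shears alone do not give this in characteristic two. -/
lemma PointedEq.pairStep_isotropic (h : Pointed n q.1 q.2) (hD : -d ^ 2 * D = 1) (c' : k) :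
    PointedEq (n + 2) (NaiveP1.pairStep D 0 d c q) (NaiveP1.pairStep D 0 d c' q) := by
  have hD' : (- C d ^ 2) * C D = (1 : k[X]) := by
    rw [← C_pow, ← C_neg, ← C_mul, hD, C_1]
  have h1 := PointedEq.pairStep h (D := D) 0 (C d) (C c + X * (C c' - C c))
    (by linear_combination hD')
  simpa using h1

lemma pairStep_cf (u v : kˣ) (l : List kˣ) {D : k} (hD : (v * u - 0 ^ 2) * D = 1) :
    pairStep D v 0 u (cf l) = cf (u :: v :: l) := by
  have hDe : D = ↑u⁻¹ * ↑v⁻¹ := by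
    have hu := u.mul_inv
    have hv := v.mul_inv
    linear_combination (↑u⁻¹ * ↑v⁻¹ : k) * hD - D * hu - D * u * ↑u⁻¹ * hv
  have hu : (C (u : k)) * C (↑u⁻¹ : k) = 1 := by rw [← C_mul, Units.mul_inv, C_1]
  have hv : (C (v : k)) * C (↑v⁻¹ : k) = 1 := by rw [← C_mul, Units.mul_inv, C_1]
  subst hDe
  simp only [cf, cfStep, pairStep]
  ext1
  · simp only [map_mul, mul_zero, zero_mul, map_zero, sub_zero, map_pow]
    linear_combination (-C (v : k) * C (↑u⁻¹ : k) * (cf l).1) * hv -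
      (X * C (↑v⁻¹ : k) * (cf l).2) * hu
  · simp only [map_mul, map_zero, add_zero, map_pow, map_neg]
    linear_combination (-C (u : k) * C (↑v⁻¹ : k) * (cf l).2) * hu

/-- Two lists of units of the same length and product with homotopic continued fractions. -/
structure CfEq (l l' : List kˣ) : Prop where
  length_eq : l.length = l'.length
  prod_eq : l.prod = l'.prod
  pointedEq : PointedEq l.length (cf l) (cf l')

lemma CfEq.refl (l : List kˣ) : CfEq l l := ⟨rfl, rfl, .refl (pointed_cf l)⟩

lemma CfEq.symm {l l' : List kˣ} (h : CfEq l l') : CfEq l' l :=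
  ⟨h.length_eq.symm, h.prod_eq.symm, h.length_eq ▸ h.pointedEq.symm⟩

lemma CfEq.trans {l l' l'' : List kˣ} (h : CfEq l l') (h' : CfEq l' l'') : CfEq l l'' :=
  ⟨h.length_eq.trans h'.length_eq, h.prod_eq.trans h'.prod_eq,
    h.pointedEq.trans (h.length_eq ▸ h'.pointedEq)⟩

lemma CfEq.cons (u : kˣ) {l l' : List kˣ} (h : CfEq l l') : CfEq (u :: l) (u :: l') :=
  ⟨by rw [List.length_cons, List.length_cons, h.length_eq],
    by rw [List.prod_cons, List.prod_cons, h.prod_eq], h.pointedEq.cfStep u⟩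

lemma exists_inv_det (u v : kˣ) : ∃ D : k, ((v : k) * u - 0 ^ 2) * D = 1 :=
  ⟨↑(v * u)⁻¹, by rw [zero_pow two_ne_zero, sub_zero, ← Units.val_mul, Units.mul_inv]⟩

lemma CfEq.of_pairStep {u v u' v' : kˣ} {l : List kˣ} (he : u * v = u' * v')
    (h : ∀ D : k, ((v : k) * u - 0 ^ 2) * D = 1 → PointedEq (l.length + 2)
      (NaiveP1.pairStep D v 0 u (cf l)) (NaiveP1.pairStep D v' 0 u' (cf l))) :
    CfEq (u :: v :: l) (u' :: v' :: l) := by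
  obtain ⟨D, hD⟩ := exists_inv_det u v
  have hD' : ((v' : k) * u' - 0 ^ 2) * D = 1 := by
    have := congrArg Units.val he
    simp only [Units.val_mul] at this
    linear_combination hD - D * this
  have h1 := h D hD
  rw [pairStep_cf u v l hD, pairStep_cf u' v' l hD'] at h1
  exact ⟨rfl, by rw [List.prod_cons, List.prod_cons, List.prod_cons, List.prod_cons, ← mul_assoc,
    ← mul_assoc, he], h1⟩

/-- Three shears, with parameters `t`, `-t⁻¹`, `t`, compose to a rotation by a monomial matrix of
determinant one. -/
lemma CfEq.swap_sq (u v : kˣ) (t : kˣ) (l : List kˣ) :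
    CfEq (u :: v :: l) (t⁻¹ ^ 2 * v :: t ^ 2 * u :: l) := by
  have ht := t.ne_zero
  refine .of_pairStep ?_ fun D hD => ?_
  · rw [mul_mul_mul_comm, inv_pow, inv_mul_cancel, one_mul, mul_comm]
  have hl := pointed_cf l
  have h1 := PointedEq.pairStep_left hl hD (t : k) (p' := v + t ^ 2 * u) (d' := t * u)
    (by ring) (by ring)
  have h2 := PointedEq.pairStep_right hl (D := D) (p := v + t ^ 2 * u) (d := t * u) (c := u)
    (by linear_combination hD) (-(t : k)⁻¹) (c' := ((t⁻¹ ^ 2 * v : kˣ) : k)) (d' := -(t : k)⁻¹ * v)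
    (by simp only [Units.val_mul, Units.val_pow_eq_pow_val, Units.val_inv_eq_inv_val]
        field_simp; ring)
    (by field_simp; ring)
  have h3 := PointedEq.pairStep_left hl (D := D) (p := v + t ^ 2 * u) (d := -(t : k)⁻¹ * v)
    (c := ((t⁻¹ ^ 2 * v : kˣ) : k))
    (by rw [← hD]
        simp only [Units.val_mul, Units.val_pow_eq_pow_val, Units.val_inv_eq_inv_val]
        field_simp; ring)
    (t : k) (p' := ((t ^ 2 * u : kˣ) : k)) (d' := 0)
    (by simp only [Units.val_mul, Units.val_pow_eq_pow_val, Units.val_inv_eq_inv_val]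
        field_simp; ring)
    (by simp only [Units.val_mul, Units.val_pow_eq_pow_val, Units.val_inv_eq_inv_val]
        field_simp; ring)
  exact (h1.trans h2).trans h3

lemma CfEq.swap (u v : kˣ) (l : List kˣ) : CfEq (u :: v :: l) (v :: u :: l) := by
  simpa using CfEq.swap_sq u v 1 l

lemma CfEq.mul_sq (u v : kˣ) (t : kˣ) (l : List kˣ) :
    CfEq (u :: v :: l) (t ^ 2 * u :: t⁻¹ ^ 2 * v :: l) :=
  (CfEq.swap_sq u v t l).trans (CfEq.swap _ _ l)

/-- One shear creates the diagonal value `w`, and a second clears the off-diagonal entry by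
completing the square; the determinant fixes the other entry. -/
lemma CfEq.add_sq (u v w : kˣ) (y : k) (hw : (w : k) = u + y ^ 2 * v) (l : List kˣ) :
    CfEq (u :: v :: l) (w :: u * v * w⁻¹ :: l) := by
  have hw0 := w.ne_zero
  refine .of_pairStep ?_ fun D hD => ?_
  · rw [mul_comm w, inv_mul_cancel_right]
  have hl := pointed_cf l
  have h1 := PointedEq.pairStep_right hl hD y (c' := w) (d' := y * v)
    (by rw [hw]; ring) (by ring)
  have h2 := PointedEq.pairStep_left hl (D := D) (p := v) (d := y * v) (c := w)
    (by rw [hw]; linear_combination hD) (-(y * v) / w) (p' := ((u * v * w⁻¹ : kˣ) : k)) (d' := 0)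
    (by simp only [Units.val_mul, Units.val_inv_eq_inv_val]
        field_simp; rw [hw]; ring)
    (by field_simp; ring)
  exact h1.trans h2

lemma CfEq.of_isotropic (u v w : kˣ) (δ : k) (hδ : δ ^ 2 = -(u * v)) (l : List kˣ) :
    CfEq (u :: v :: l) (w :: u * v * w⁻¹ :: l) := by
  have hw0 := w.ne_zero
  have hu0 := u.ne_zero
  refine .of_pairStep ?_ fun D hD => ?_
  · rw [mul_comm w, inv_mul_cancel_right]
  have hl := pointed_cf l
  -- The shear by `δ / u` brings an isotropic vector to a basis vector. The other diagonal value is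
  -- then free, and a last shear restores diagonal form.
  have h1 := PointedEq.pairStep_left hl hD (δ / u) (p' := 0) (d' := δ)
    (by field_simp; rw [hδ]; ring) (by field_simp; ring)
  have h2 := PointedEq.pairStep_isotropic hl (D := D) (d := δ) (c := u)
    (by rw [hδ, ← hD]; ring) w
  have h3 := PointedEq.pairStep_left hl (D := D) (p := 0) (d := δ) (c := w)
    (by rw [hδ, ← hD]; ring) (-δ / w) (p' := ((u * v * w⁻¹ : kˣ) : k)) (d' := 0)
    (by simp only [Units.val_mul, Units.val_inv_eq_inv_val]
        field_simp; rw [hδ]; ring)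
    (by field_simp; ring)
  exact (h1.trans h2).trans h3

/-- Changing the first entry of a list to another non-zero value of the first two entries. -/
lemma CfEq.exists_pair (u v w : kˣ) (x y : k) (hxy : x ≠ 0 ∨ y ≠ 0)
    (hw : x ^ 2 * u + y ^ 2 * v = w ∨ x ^ 2 * u + y ^ 2 * v = 0) (l : List kˣ) :
    ∃ v' : kˣ, CfEq (u :: v :: l) (w :: v' :: l) := by
  rcases hw with hw | hw
  · rcases eq_or_ne x 0 with rfl | hx
    · have hy := hxy.resolve_left (by simp)
      have h1 : w = Units.mk0 y hy ^ 2 * v := by ext; simpa using hw.symm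
      exact ⟨_, h1 ▸ (CfEq.swap u v l).trans (CfEq.mul_sq v u (Units.mk0 y hy) l)⟩
    · exact ⟨_, (CfEq.mul_sq u v (Units.mk0 x hx) l).trans
        (CfEq.add_sq _ _ w (x * y) (by
          simp only [Units.val_mul, Units.val_pow_eq_pow_val, Units.val_inv_eq_inv_val,
            Units.val_mk0]
          rw [← hw]
          field_simp) l)⟩
  · have hu0 := u.ne_zero
    have hv0 := v.ne_zero
    have hy : y ≠ 0 := by
      rintro rfl
      simp_all
    -- From `x² u = -y² v`, the element `x u / y` is a square root of `-u v`.
    refine ⟨_, CfEq.of_isotropic u v w (x / y * u) ?_ l⟩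
    field_simp
    linear_combination hw

/-- The value at a vector of the quadratic form with diagonal entries a given list. -/
def qval : List kˣ → List k → k
  | u :: l, x :: z => x ^ 2 * u + qval l z
  | _, _ => 0

/-- A list with a vector of value `w`, or with an isotropic vector, is equivalent to a list with
first entry `w`. -/
lemma CfEq.exists_cons (w : kˣ) : ∀ (l : List kˣ) (z : List k), 2 ≤ l.length →
    z.length = l.length → (∃ x ∈ z, x ≠ 0) → (qval l z = w ∨ qval l z = 0) →
    ∃ l', CfEq l (w :: l')
  | [u, v], [x, y], _, _, hz, hq => by
    obtain ⟨v', h⟩ := CfEq.exists_pair u v w x y (by simpa using hz) (by simpa [qval] using hq) []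
    exact ⟨_, h⟩
  | u :: v :: v₂ :: l, x :: z, _, hlen, hz, hq => by
    -- The tail is first moved to begin with its own value at `z`, or with `w` if that value is
    -- zero. In the first case a move of the leading two entries finishes; in the second a swap
    -- does.
    by_cases hz' : ∃ x ∈ z, x ≠ 0
    · have ih := fun w' => CfEq.exists_cons w' (v :: v₂ :: l) z (by simp)
        (by simpa using hlen) hz'
      rcases eq_or_ne (qval (v :: v₂ :: l) z) 0 with h0 | h0
      · rw [qval, h0, add_zero] at hq
        obtain ⟨l', h1⟩ := ih w (Or.inr h0)
        exact ⟨_, (h1.cons u).trans (CfEq.swap u w l')⟩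
      · obtain ⟨l', h1⟩ := ih (Units.mk0 _ h0) (Or.inl rfl)
        obtain ⟨v', h2⟩ := CfEq.exists_pair u (Units.mk0 _ h0) w x 1 (by simp)
          (by simpa [qval] using hq) l'
        exact ⟨_, (h1.cons u).trans h2⟩
    · push Not at hz'
      have hx : x ≠ 0 := by
        obtain ⟨x', hx', hx0⟩ := hz
        rcases List.mem_cons.1 hx' with rfl | hx'
        · exact hx0
        · exact absurd (hz' _ hx') hx0
      have hq0 : ∀ (l : List kˣ) (z : List k), (∀ x ∈ z, x = 0) → qval l z = 0 := by
        intro l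
        induction l with
        | nil => intro z _; cases z <;> rfl
        | cons u l ih =>
          intro z hz
          rcases z with _ | ⟨x, z⟩
          · rfl
          · rw [qval, hz x (by simp), ih z fun x hx => hz x (by simp [hx])]
            ring
      rw [qval, hq0 _ z hz', add_zero] at hq
      obtain ⟨v', h⟩ := CfEq.exists_pair u v w x 0 (Or.inl hx) (by simpa using hq) (v₂ :: l)
      exact ⟨_, h⟩

end PairMoves

/-! ### Common values of stably isomorphic forms and classification of lists -/

section Classification

open Matrix

variable {k : Type u} [Field k] {ι κ τ : Type} [Fintype ι] [DecidableEq ι] [Fintype κ]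
  [DecidableEq κ] [Fintype τ] [DecidableEq τ]

omit [DecidableEq ι] [DecidableEq τ] in
lemma dotProduct_dsum (M : Matrix ι ι k) (C : Matrix τ τ k) (z z' : ι ⊕ τ → k) :
    z ⬝ᵥ dsum M C *ᵥ z' = (z ∘ Sum.inl) ⬝ᵥ M *ᵥ (z' ∘ Sum.inl) +
      (z ∘ Sum.inr) ⬝ᵥ C *ᵥ (z' ∘ Sum.inr) := by
  rw [fromBlocks_mulVec, zero_mulVec, zero_mulVec, add_zero, zero_add]
  conv_lhs => rw [← Sum.elim_comp_inl_inr z]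
  rw [sumElim_dotProduct_sumElim]

/-- Two stably isomorphic forms, the first of which is not totally isotropic, have a common value,
taken by the second one at a non-zero vector. -/
lemma exists_eq_of_formIso {M : Matrix ι ι k} {N : Matrix κ κ k} {C : Matrix τ τ k}
    (h : FormIso (dsum M C) (dsum N C)) (hd : IsUnit C.det) {e : ι → k} (he : e ⬝ᵥ M *ᵥ e ≠ 0) :
    ∃ (x : κ → k) (y : ι → k), x ≠ 0 ∧ x ⬝ᵥ N *ᵥ x = y ⬝ᵥ M *ᵥ y := by
  by_contra! hcon
  have hcard := h.card_eq
  rw [Fintype.card_sum, Fintype.card_sum, add_left_inj] at hcard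
  obtain ⟨P, Q, -, -, hP⟩ := h
  have hiso : ∀ z z', z ⬝ᵥ dsum N C *ᵥ z' = (P *ᵥ z) ⬝ᵥ dsum M C *ᵥ (P *ᵥ z') := by
    intro z z'
    rw [← hP, ← mulVec_mulVec, ← mulVec_mulVec, dotProduct_mulVec z, vecMul_transpose]
  -- `ψ` measures how far the isometry moves the `C`-component. Where it vanishes, the
  -- `C`-contributions cancel and `N` and `M` take a common value, so under the contradiction
  -- hypothesis the `N`-component is zero.
  let ψ : (κ ⊕ τ → k) →ₗ[k] (τ → k) :=
    LinearMap.funLeft k k Sum.inr ∘ₗ P.mulVecLin - LinearMap.funLeft k k Sum.inr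
  have hψ : ∀ z, ψ z = (P *ᵥ z) ∘ Sum.inr - z ∘ Sum.inr := fun z => rfl
  have hψ0 : ∀ z, ψ z = 0 → z ∘ Sum.inl = 0 := by
    intro z hz
    by_contra hz0
    refine hcon _ ((P *ᵥ z) ∘ Sum.inl) hz0 ?_
    have h1 := hiso z z
    rw [hψ, sub_eq_zero] at hz
    rw [dotProduct_dsum, dotProduct_dsum, hz, add_left_inj] at h1
    exact h1
  let S : (κ ⊕ τ → k) →ₗ[k] (ι → k) × LinearMap.range ψ :=
    LinearMap.prod (LinearMap.funLeft k k Sum.inl ∘ₗ P.mulVecLin) ψ.rangeRestrict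
  have hS : ∀ z, z ∈ LinearMap.ker S ↔ (P *ᵥ z) ∘ Sum.inl = 0 ∧ ψ z = 0 := by
    intro z
    rw [LinearMap.mem_ker, Prod.ext_iff]
    exact and_congr_right fun _ => Subtype.ext_iff
  -- A vector in the kernel of `S` lies in the summand `C` and is fixed by the isometry, hence is
  -- orthogonal to the range of `ψ`. Non-degeneracy of `C` makes this embedding injective and bounds
  -- the kernel.
  let θ : LinearMap.ker S →ₗ[k] (LinearMap.range ψ).dualAnnihilator :=
    LinearMap.codRestrict _ ((Matrix.toLinearMap₂' k C ∘ₗ LinearMap.funLeft k k Sum.inr) ∘ₗ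
      (LinearMap.ker S).subtype) (by
      rintro ⟨z, hz⟩
      obtain ⟨hz1, hz2⟩ := (hS z).1 hz
      rw [Submodule.mem_dualAnnihilator]
      rintro _ ⟨z', rfl⟩
      change Matrix.toLinearMap₂' k C (z ∘ Sum.inr) (ψ z') = 0
      have h1 := hiso z z'
      have h2 := hψ0 z hz2
      rw [hψ, sub_eq_zero] at hz2
      rw [dotProduct_dsum, dotProduct_dsum, hz1, hz2, h2, zero_dotProduct, zero_dotProduct,
        zero_add, zero_add] at h1
      rw [Matrix.toLinearMap₂'_apply', hψ, mulVec_sub, dotProduct_sub, h1, sub_self])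
  have hθ : Function.Injective θ := by
    refine (injective_iff_map_eq_zero θ).2 ?_
    rintro ⟨z, hz⟩ h0
    obtain ⟨hz1, hz2⟩ := (hS z).1 hz
    have h1 : ∀ w, (z ∘ Sum.inr) ⬝ᵥ C *ᵥ w = 0 := by
      intro w
      have := LinearMap.congr_fun (congrArg Subtype.val h0) w
      rw [← Matrix.toLinearMap₂'_apply']
      exact this
    have h2 : z ∘ Sum.inr = 0 := by
      apply Matrix.eq_zero_of_vecMul_eq_zero hd.ne_zero
      refine dotProduct_eq_zero _ fun w => ?_
      rw [← dotProduct_mulVec, h1]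
    ext i
    rcases i with i | i
    · exact congrFun (hψ0 z hz2) i
    · exact congrFun h2 i
  have h1 := LinearMap.finrank_le_finrank_of_injective hθ
  have h2 := Subspace.finrank_add_finrank_dualAnnihilator_eq (LinearMap.range ψ)
  have h3 := S.finrank_range_add_finrank_ker
  rw [Module.finrank_fintype_fun_eq_card] at h2 h3
  rw [Fintype.card_sum] at h3
  -- The bound on the kernel forces `S` to be onto. A preimage of `(e, 0)` has zero `N`-component,
  -- so `M` vanishes at `e`, contrary to the choice of `e`.
  have h4 : LinearMap.range S = ⊤ := by
    apply Submodule.eq_top_of_finrank_eq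
    refine le_antisymm (Submodule.finrank_le _) ?_
    rw [Module.finrank_prod, Module.finrank_fintype_fun_eq_card]
    omega
  obtain ⟨z, hz⟩ := LinearMap.range_eq_top.1 h4 (e, 0)
  have hz1 : (P *ᵥ z) ∘ Sum.inl = e := congrArg Prod.fst hz
  have hz2 : ψ z = 0 := congrArg Subtype.val (congrArg Prod.snd hz)
  have h5 := hiso z z
  have h6 := hψ0 z hz2
  rw [hψ, sub_eq_zero] at hz2
  rw [dotProduct_dsum, dotProduct_dsum, hz1, hz2, h6, add_left_inj, zero_dotProduct] at h5
  exact he h5.symm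

lemma qval_ofFn (l : List kˣ) (x : Fin l.length → k) :
    qval l (List.ofFn x) = x ⬝ᵥ diagForm l *ᵥ x := by
  have h : ∀ (l : List kˣ) (x : Fin l.length → k),
      x ⬝ᵥ diagForm l *ᵥ x = ∑ i, x i ^ 2 * (l.get i : k) := by
    intro l x
    rw [dotProduct]
    refine Finset.sum_congr rfl fun i _ => ?_
    rw [diagForm, mulVec_diagonal]
    ring
  rw [h]
  induction l with
  | nil => simp [qval]
  | cons u l ih =>
    rw [List.ofFn_succ, qval, ih]
    exact (Fin.sum_univ_succ (n := l.length) fun i => x i ^ 2 * ((u :: l).get i : k)).symm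

lemma CfEq.exists_cons_of_ne_zero (w : kˣ) {l : List kˣ} (hl : 2 ≤ l.length)
    {x : Fin l.length → k} (hx : x ≠ 0)
    (hw : x ⬝ᵥ diagForm l *ᵥ x = w ∨ x ⬝ᵥ diagForm l *ᵥ x = 0) : ∃ l', CfEq l (w :: l') := by
  rw [← qval_ofFn] at hw
  refine CfEq.exists_cons w l (List.ofFn x) hl List.length_ofFn ?_ hw
  obtain ⟨i, hi⟩ := Function.ne_iff.1 hx
  exact ⟨x i, List.mem_ofFn.2 ⟨i, rfl⟩, hi⟩

lemma exists_diagForm_ne_zero (l : List kˣ) (hl : l ≠ []) :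
    ∃ e : Fin l.length → k, e ⬝ᵥ diagForm l *ᵥ e ≠ 0 := by
  refine ⟨Pi.single ⟨0, List.length_pos_iff.2 hl⟩ 1, ?_⟩
  rw [diagForm, mulVec_single_one, single_one_dotProduct]
  simp

lemma stabIso_bezoutMatrix_cf {l : List kˣ} {n : ℕ} (hl : l.length = n) :
    StabIso (diagForm l) (bezoutMatrix n (cf l).1 (cf l).2) := by
  subst hl
  exact (bezoutMatrix_cf l).1.stabIso

lemma CfEq.stabIso {l l' : List kˣ} (h : CfEq l l') : StabIso (diagForm l) (diagForm l') :=
  (stabIso_bezoutMatrix_cf rfl).trans (h.pointedEq.stabIso.trans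
    (stabIso_bezoutMatrix_cf h.length_eq.symm).symm)

/-- Continued fractions are classified by their stable diagonal forms and products. -/
theorem cfEq_of_stabIso (n : ℕ) : ∀ {l l' : List kˣ}, l.length = n → l'.length = n →
    l.prod = l'.prod → StabIso (diagForm l) (diagForm l') → CfEq l l' := by
  induction n with
  | zero =>
    intro l l' hl hl' _ _
    rw [List.length_eq_zero_iff.1 hl, List.length_eq_zero_iff.1 hl']
    exact .refl _
  | succ n ih =>
    intro l l' hl hl' hp hs
    -- In rank one no move is available, but the exact product already determines the entry.
    rcases Nat.eq_zero_or_pos n with rfl | hn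
    · obtain ⟨u, rfl⟩ := List.length_eq_one_iff.1 hl
      obtain ⟨u', rfl⟩ := List.length_eq_one_iff.1 hl'
      rw [List.prod_singleton, List.prod_singleton] at hp
      rw [hp]
      exact .refl _
    have hl0 : l ≠ [] := fun h => by simp [h] at hl
    have hl0' : l' ≠ [] := fun h => by simp [h] at hl'
    obtain ⟨e, he⟩ := exists_diagForm_ne_zero l hl0
    obtain ⟨e', he'⟩ := exists_diagForm_ne_zero l' hl0'
    obtain ⟨m, C, -, hC, hiso⟩ := id hs
    obtain ⟨x, y, hx, hxy⟩ := exists_eq_of_formIso hiso hC he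
    obtain ⟨x', y', hx', hxy'⟩ := exists_eq_of_formIso hiso.symm hC he'
    obtain ⟨w, ⟨l₁, h₁⟩, ⟨l₁', h₁'⟩⟩ : ∃ w : kˣ, (∃ l₁, CfEq l (w :: l₁)) ∧
        ∃ l₁', CfEq l' (w :: l₁') := by
      have key : ∀ {l l' : List kˣ}, 2 ≤ l.length → 2 ≤ l'.length → ∀ {x : Fin l'.length → k}
          {y : Fin l.length → k}, x ≠ 0 → x ⬝ᵥ diagForm l' *ᵥ x = y ⬝ᵥ diagForm l *ᵥ y →
          x ⬝ᵥ diagForm l' *ᵥ x ≠ 0 → ∃ w : kˣ, (∃ l₁, CfEq l (w :: l₁)) ∧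
            ∃ l₁', CfEq l' (w :: l₁') := by
        intro l l' hl hl' x y hx hxy h0
        refine ⟨Units.mk0 _ h0, CfEq.exists_cons_of_ne_zero _ hl (x := y) ?_ (Or.inl hxy.symm),
          CfEq.exists_cons_of_ne_zero _ hl' hx (Or.inl rfl)⟩
        rintro rfl
        rw [zero_dotProduct] at hxy
        exact h0 hxy
      -- A zero common value shows only that the form with the non-zero vector is isotropic, which
      -- is why the comparison was made in both directions. If both forms are isotropic, any unit
      -- serves as first entry, here `1`.
      by_cases h0 : x ⬝ᵥ diagForm l' *ᵥ x = 0
      · by_cases h0' : x' ⬝ᵥ diagForm l *ᵥ x' = 0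
        · exact ⟨1, CfEq.exists_cons_of_ne_zero _ (by omega) hx' (Or.inr h0'),
            CfEq.exists_cons_of_ne_zero _ (by omega) hx (Or.inr h0)⟩
        · obtain ⟨w, h1, h2⟩ := key (by omega) (by omega) hx' hxy' h0'
          exact ⟨w, h2, h1⟩
      · exact key (by omega) (by omega) hx hxy h0
    have hlen := h₁.length_eq
    have hlen' := h₁'.length_eq
    rw [List.length_cons] at hlen hlen'
    have hprod : l₁.prod = l₁'.prod := by
      have h2 := h₁.prod_eq
      rw [hp, h₁'.prod_eq, List.prod_cons, List.prod_cons] at h2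
      exact (mul_left_cancel h2).symm
    have hst : StabIso (diagForm l₁) (diagForm l₁') := by
      refine StabIso.cancel (u := w) ?_
      exact (FormIso.diagForm_cons w l₁).symm.stabIso.trans (h₁.stabIso.symm.trans
        (hs.trans (h₁'.stabIso.trans (FormIso.diagForm_cons w l₁').stabIso)))
    exact h₁.trans (((ih (by omega) (by omega) hprod hst).cons w).trans h₁'.symm)

end Classification

/-! ### Unpointed moves and bijectivity -/

section Unpointed

open Polynomial

lemma Good.linear {R : Type u} [CommRing R] {n : ℕ} {A B : R[X]} (h : Good n A B) {a b c d : R}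
    (hd : a * d - b * c = 1) : Good n (C a * A + C b * B) (C c * A + C d * B) := by
  have hd' : C a * C d - C b * C c = (1 : R[X]) := by rw [← C_mul, ← C_mul, ← C_sub, hd, C_1]
  refine ⟨?_, ?_, isCoprime_linear h.isCoprime hd', ?_⟩
  · exact (natDegree_add_le _ _).trans (max_le ((natDegree_C_mul_le _ _).trans h.natDegree_left)
      ((natDegree_C_mul_le _ _).trans h.natDegree_right))
  · exact (natDegree_add_le _ _).trans (max_le ((natDegree_C_mul_le _ _).trans h.natDegree_left)
      ((natDegree_C_mul_le _ _).trans h.natDegree_right))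
  · rw [reflect_add, reflect_add, reflect_C_mul, reflect_C_mul, reflect_C_mul, reflect_C_mul]
    exact isCoprime_linear h.isCoprime_reflect hd'

variable {k : Type u} [Field k]

lemma Good.cls_congr_of_eq {n : ℕ} {A B A' B' : k[X]} (h : Good n A B) (h' : Good n A' B')
    (hA : A = A') (hB : B = B') : h.cls = h'.cls := by
  subst hA hB
  rfl

/-- The elementary matrix with entry `s` is joined to the identity by the line of those with entry
`s T`. Such moves on the target need not fix `∞`. -/
lemma Good.exists_cls_add_left {n : ℕ} {A B : k[X]} (h : Good n A B) (s : k) :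
    ∃ h' : Good n (A + C s * B) B, h'.cls = h.cls := by
  have h1 : Good n (A + C s * B) B := by
    simpa using h.linear (a := 1) (b := s) (c := 0) (d := 1) (by simp)
  refine ⟨h1, ?_⟩
  have g := (h.map (C : k →+* k[X])).linear (a := 1) (b := C s * X) (c := 0) (d := 1) (by simp)
  have e0 : (g.map (evalRingHom (0 : k))).cls = h.cls := Good.cls_congr_of_eq _ _
    (by simp [map_C_map_evalRingHom]) (by simp [map_C_map_evalRingHom])
  have e1 : (g.map (evalRingHom (1 : k))).cls = h1.cls := Good.cls_congr_of_eq _ _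
    (by simp [map_C_map_evalRingHom]) (by simp [map_C_map_evalRingHom])
  rw [← e0, ← e1, g.cls_map_eq]

lemma Good.exists_cls_add_right {n : ℕ} {A B : k[X]} (h : Good n A B) (s : k) :
    ∃ h' : Good n A (B + C s * A), h'.cls = h.cls := by
  have h1 : Good n A (B + C s * A) := by
    simpa [add_comm] using h.linear (a := 1) (b := 0) (c := s) (d := 1) (by simp)
  refine ⟨h1, ?_⟩
  have g := (h.map (C : k →+* k[X])).linear (a := 1) (b := 0) (c := C s * X) (d := 1) (by simp)
  have e0 : (g.map (evalRingHom (0 : k))).cls = h.cls := Good.cls_congr_of_eq _ _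
    (by simp [map_C_map_evalRingHom]) (by simp [map_C_map_evalRingHom])
  have e1 : (g.map (evalRingHom (1 : k))).cls = h1.cls := Good.cls_congr_of_eq _ _
    (by simp [map_C_map_evalRingHom]) (by simp [map_C_map_evalRingHom, add_comm])
  rw [← e0, ← e1, g.cls_map_eq]

lemma Good.exists_cls_rotate {n : ℕ} {A B : k[X]} (h : Good n A B) (u : kˣ) :
    ∃ h' : Good n (C (u : k) * B) (-(C (↑u⁻¹ : k) * A)), h'.cls = h.cls := by
  -- The factorization of a monomial matrix of determinant one into three elementary matrices.
  obtain ⟨h1, e1⟩ := h.exists_cls_add_left u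
  obtain ⟨h2, e2⟩ := h1.exists_cls_add_right (-(↑u⁻¹ : k))
  obtain ⟨h3, e3⟩ := h2.exists_cls_add_left u
  have hu : C (u : k) * C (↑u⁻¹ : k) = 1 := by rw [← C_mul, Units.mul_inv, C_1]
  have hA : A + C (u : k) * B + C (u : k) * (B + C (-(↑u⁻¹ : k)) * (A + C (u : k) * B)) =
      C (u : k) * B := by
    rw [C_neg]
    linear_combination (-A - C (u : k) * B) * hu
  have hB : B + C (-(↑u⁻¹ : k)) * (A + C (u : k) * B) = -(C (↑u⁻¹ : k) * A) := by
    rw [C_neg]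
    linear_combination (-B) * hu
  have h4 : Good n (C (u : k) * B) (-(C (↑u⁻¹ : k) * A)) := by
    rw [hA, hB] at h3
    exact h3
  refine ⟨h4, Eq.trans (Good.cls_congr _ h3 ?_) (e3.trans (e2.trans e1))⟩
  rw [hA, hB]
  ring

/-- Multiplying by a square does not change the unpointed class. -/
lemma Good.exists_cls_sq {n : ℕ} {A B : k[X]} (h : Good n A B) (u : kˣ) :
    ∃ h' : Good n A (C ((u : k) ^ 2) * B), h'.cls = h.cls := by
  obtain ⟨h1, e1⟩ := h.exists_cls_rotate u
  -- Two rotations give `(u⁻¹ A, u B)`, and the common scalar `u` turns this into `(A, u² B)`.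
  obtain ⟨h2, e2⟩ := h1.exists_cls_rotate (-1)
  have hu : C (u : k) * C (↑u⁻¹ : k) = 1 := by rw [← C_mul, Units.mul_inv, C_1]
  have h3 := h2.smul u.ne_zero
  have hA : C (u : k) * (C (((-1 : kˣ) : k)) * -(C (↑u⁻¹ : k) * A)) = A := by
    rw [Units.val_neg, Units.val_one, C_neg, C_1]
    linear_combination A * hu
  have hB : C (u : k) * -(C (((-1 : kˣ)⁻¹ : kˣ) : k) * (C (u : k) * B)) = C ((u : k) ^ 2) * B := by
    rw [inv_neg, inv_one, Units.val_neg, Units.val_one, C_neg, C_1, C_pow]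
    ring
  have h4 : Good n A (C ((u : k) ^ 2) * B) := by
    rw [hA, hB] at h3
    exact h3
  refine ⟨h4, Eq.trans (Good.cls_congr _ h2 ?_) (e2.trans e1)⟩
  rw [inv_neg, inv_one, Units.val_neg, Units.val_one, C_neg, C_1, C_pow]
  linear_combination (-A * C (u : k) * B) * hu

lemma Good.exists_pointed {n : ℕ} {A B : k[X]} (h : Good n A B) :
    ∃ (A' B' : k[X]) (h' : Pointed n A' B'), h'.good.cls = h.cls := by
  have key : ∀ {A B : k[X]} (h : Good n A B), A.coeff n ≠ 0 →
      ∃ (A' B' : k[X]) (h' : Pointed n A' B'), h'.good.cls = h.cls := by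
    intro A B h hA
    -- This translation makes the denominator vanish at `∞`; a scalar then makes the numerator
    -- monic.
    obtain ⟨h1, e1⟩ := h.exists_cls_add_right (-(B.coeff n / A.coeff n))
    have hc := inv_ne_zero hA
    have h2 := h1.smul hc
    have h3 : Pointed n (C (A.coeff n)⁻¹ * A)
        (C (A.coeff n)⁻¹ * (B + C (-(B.coeff n / A.coeff n)) * A)) := by
      refine ⟨h2.natDegree_left, ?_, ?_, h2.isCoprime⟩
      · rw [coeff_C_mul, inv_mul_cancel₀ hA]
      · rw [degree_lt_iff_coeff_zero]
        intro m hm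
        rcases hm.eq_or_lt with rfl | hm
        · rw [coeff_C_mul, coeff_add, coeff_C_mul]
          field_simp
          ring
        · exact coeff_eq_zero_of_natDegree_lt (h2.natDegree_right.trans_lt hm)
    exact ⟨_, _, h3, (Good.cls_congr _ h1 (by ring)).trans e1⟩
  by_cases hA : A.coeff n = 0
  · have hB := h.coeff_ne_zero.resolve_left (not_not.2 hA)
    obtain ⟨h1, e1⟩ := h.exists_cls_add_left 1
    obtain ⟨A', B', h2, e2⟩ := key h1 (by simpa [hA] using hB)
    exact ⟨A', B', h2, e2.trans e1⟩
  · exact key h hA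

/-- The naive homotopy class of a continued fraction. -/
def cfCls (l : List kˣ) : NaiveClasses k := (pointed_cf l).good.cls

lemma exists_cfCls (c : NaiveClasses k) : ∃ l : List kˣ, c = cfCls l := by
  obtain ⟨n, A, B, h, rfl⟩ := NaiveClasses.exists_cls c
  obtain ⟨A', B', h', e⟩ := h.exists_pointed
  obtain ⟨l, hl, hp⟩ := Pointed.exists_cf n h'
  obtain ⟨h1, h2, e'⟩ := hp.cls_eq
  exact ⟨l, e.symm.trans (e'.trans (Good.cls_congr _ _ (mul_comm _ _)))⟩

lemma CfEq.cfCls_eq {l l' : List kˣ} (h : CfEq l l') : cfCls l = cfCls l' := by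
  obtain ⟨h1, h2, e⟩ := h.pointedEq.cls_eq
  exact e.trans (Good.cls_congr _ _ (mul_comm _ _))

/-- Scaling every entry by `u` scales the denominator alone: in each step the factors `u⁻¹` and `u`
cancel in the numerator. -/
lemma cf_map_mul (u : kˣ) (l : List kˣ) :
    cf (l.map (u * ·)) = ((cf l).1, C (u : k) * (cf l).2) := by
  induction l with
  | nil => simp [cf]
  | cons v l ih =>
    have hu : C (u : k) * C (↑u⁻¹ : k) = 1 := by rw [← C_mul, Units.mul_inv, C_1]
    rw [List.map_cons, cf, ih, cf]
    simp only [cfStep, mul_inv, Units.val_mul, C_mul]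
    ext1
    · simp only
      linear_combination (-C (↑v⁻¹ : k) * (cf l).2) * hu
    · simp only
      ring

lemma cfCls_map_sq (u : kˣ) (l : List kˣ) : cfCls (l.map (u ^ 2 * ·)) = cfCls l := by
  obtain ⟨h, e⟩ := (pointed_cf l).good.exists_cls_sq u
  refine Eq.trans (Good.cls_congr _ h ?_) e
  rw [cf_map_mul, Units.val_pow_eq_pow_val]
  ring

lemma FormIso.single_sq (u v : kˣ) : FormIso (single (v : k)) (single ((u ^ 2 * v : kˣ) : k)) := by
  have := FormIso.smul_sq (single (v : k)) u.ne_zero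
  have h : ((u : k) ^ 2) • single (v : k) = single ((u ^ 2 * v : kˣ) : k) := by
    ext
    simp [single]
  rwa [h] at this

lemma FormIso.diagForm_map_sq (u : kˣ) (l : List kˣ) :
    FormIso (diagForm l) (diagForm (l.map (u ^ 2 * ·))) := by
  induction l with
  | nil => exact FormIso.refl _
  | cons v l ih =>
    exact (FormIso.diagForm_cons v l).trans (((FormIso.single_sq u v).dsum ih).trans
      (FormIso.diagForm_cons (u ^ 2 * v) (l.map (u ^ 2 * ·))).symm)

lemma eq_of_bezoutMap_eq {n m : ℕ} {A B A' B' : k[X]} (h : Good n A B) (h' : Good m A' B')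
    (he : bezoutMap h.cls = bezoutMap h'.cls) :
    n = m ∧ StabIso (bezoutMatrix n A B) (bezoutMatrix m A' B') ∧
      ∃ s : kˣ, (bezoutMatrix m A' B').det = (s : k) ^ (2 * n) * (bezoutMatrix n A B).det := by
  have he' := ((bezoutMap_cls h).symm.trans he).trans (bezoutMap_cls h')
  obtain ⟨rfl, h2⟩ := Sigma.mk.inj he'
  have h3 := SymmForm.toTarget_eq_iff.1 (eq_of_heq h2)
  exact ⟨rfl, h3.1, h3.2⟩

lemma bezoutMap_injective : Function.Injective (bezoutMap (k := k)) := by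
  intro c c' he
  obtain ⟨l, rfl⟩ := exists_cfCls c
  obtain ⟨l', rfl⟩ := exists_cfCls c'
  obtain ⟨hn, hst, s, hs⟩ := eq_of_bezoutMap_eq _ _ he
  rw [(bezoutMatrix_cf l).2, (bezoutMatrix_cf l').2, ← Units.val_pow_eq_pow_val, ← Units.val_mul,
    Units.val_inj] at hs
  have h1 : StabIso (diagForm l) (diagForm l') :=
    (bezoutMatrix_cf l).1.stabIso.trans (hst.trans (bezoutMatrix_cf l').1.symm.stabIso)
  -- The products differ by `s²ⁿ`. Scaling all `n` entries of `l` by `s²` makes them equal without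
  -- changing the isometry class of the diagonal form.
  have h2 : CfEq (l.map (s ^ 2 * ·)) l' := by
    refine cfEq_of_stabIso l.length (by simp) hn.symm ?_
      ((FormIso.diagForm_map_sq s l).symm.stabIso.trans h1)
    rw [hs, List.prod_map_mul, List.map_id', List.map_const', List.prod_replicate, pow_mul]
  rw [← cfCls_map_sq s l, h2.cfCls_eq]

lemma good_cf {l : List kˣ} {n : ℕ} (hl : l.length = n) : Good n (cf l).1 (cf l).2 :=
  hl ▸ (pointed_cf l).good

lemma det_form_cf {l : List kˣ} {n : ℕ} (hl : l.length = n) :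
    (good_cf hl).form.det = l.prod := by
  subst hl
  exact Units.ext (bezoutMatrix_cf l).2

lemma stablyIso_form_cf {l : List kˣ} {n : ℕ} (hl : l.length = n) {b : SymmForm k n}
    (h : StabIso b.gram (diagForm l)) : (good_cf hl).form.StablyIso b := by
  have h1 : StabIso (good_cf hl).form.gram b.gram :=
    (h.trans (stabIso_bezoutMatrix_cf hl)).symm
  exact StabIso.stablyIso h1

/-- A stable class and a compatible determinant are realized by a diagonal form. -/
lemma exists_list_of_disc_eq {n : ℕ} (b : SymmForm k n) (δ : kˣ)
    (hdisc : (b.det : UnitsModPow k 2) = (δ : UnitsModPow k 2))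
    (h0 : n = 0 → (δ : UnitsModPow k (2 * n)) = 1) :
    ∃ l : List kˣ, l.length = n ∧ StabIso b.gram (diagForm l) ∧
      (l.prod : UnitsModPow k (2 * n)) = δ := by
  obtain ⟨l, hl, hst⟩ := exists_stabIso_diagForm b.gram b.isSymm b.isUnit_det
  rw [Fintype.card_fin] at hl
  rcases l with _ | ⟨v, l⟩
  · refine ⟨[], hl, hst, ?_⟩
    rw [h0 hl.symm]
    rfl
  · have h1 := (stablyIso_form_cf hl hst).det_eq
    rw [det_form_cf hl] at h1
    obtain ⟨s, hs⟩ := QuotientGroup.eq.1 (h1.trans hdisc)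
    rw [powMonoidHom_apply, eq_inv_mul_iff_mul_eq] at hs
    -- The prescribed determinant agrees with the product of the list up to a square `s²`, and one
    -- entry absorbs it.
    refine ⟨s ^ 2 * v :: l, hl, hst.trans (FormIso.stabIso ?_), ?_⟩
    · exact (FormIso.diagForm_cons v l).trans (((FormIso.single_sq s v).dsum (FormIso.refl _)).trans
        (FormIso.diagForm_cons (s ^ 2 * v) l).symm)
    · rw [← hs, List.prod_cons, List.prod_cons, mul_assoc, mul_comm (s ^ 2)]

lemma bezoutMap_surjective : Function.Surjective (bezoutMap (k := k)) := by
  rintro ⟨n, p⟩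
  obtain ⟨b, hb⟩ := Quotient.exists_rep (s := stableSetoid k n) p.1.1
  obtain ⟨δ, hδ⟩ := QuotientGroup.mk_surjective p.1.2
  have hdisc : (b.det : UnitsModPow k 2) = (δ : UnitsModPow k 2) := by
    have h1 := p.2.1
    rw [← hb, ← hδ] at h1
    exact h1
  obtain ⟨l, hl, h1, h2⟩ := exists_list_of_disc_eq b δ hdisc fun h => hδ.trans (p.2.2 h)
  refine ⟨(good_cf hl).cls, (bezoutMap_cls _).trans ?_⟩
  have e1 : Quotient.mk (stableSetoid k n) (good_cf hl).form = p.1.1 :=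
    (Quotient.sound (s := stableSetoid k n) (stablyIso_form_cf hl h1)).trans hb
  have e2 : ((good_cf hl).form.det : UnitsModPow k (2 * n)) = p.1.2 := by
    rw [det_form_cf hl, h2]
    exact hδ
  have e3 : (good_cf hl).form.toTarget = p := Subtype.ext (Prod.ext e1 e2)
  rw [e3]

end Unpointed

end NaiveP1

end

/-! ### The theorem -/

theorem theorem4p3 {k : Type u} [Field k] :
    ∃ Φ : NaiveP1.NaiveClasses k → Σ n : ℕ, NaiveP1.Target k n,
      Function.Bijective Φ ∧
      (∀ f : NaiveP1.Endo k, ∃ (n : ℕ) (r : NaiveP1.RatFun k n), f.IsFraction r) ∧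
      ∀ (n : ℕ) (r : NaiveP1.RatFun k n),
        (∃! f : NaiveP1.Endo k, f.IsFraction r) ∧
        ∃ b : NaiveP1.SymmForm k n,
          b.gram = NaiveP1.bezoutMatrix n r.A r.B ∧
          ∀ f : NaiveP1.Endo k, f.IsFraction r → Φ f.toClass = ⟨n, b.toTarget⟩ := by
  refine ⟨NaiveP1.bezoutMap, ⟨NaiveP1.bezoutMap_injective, NaiveP1.bezoutMap_surjective⟩, ?_, ?_⟩
  · intro f
    obtain ⟨n, A, B, h, e⟩ := f.exists_good
    exact ⟨n, h.ratFun, e⟩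
  · intro n r
    refine ⟨⟨r.good.endo, r.good.chart_comp_endo, fun f hf => r.good.eq_endo hf⟩,
      r.good.form, rfl, fun f hf => ?_⟩
    rw [r.good.eq_endo hf]
    exact NaiveP1.bezoutMap_cls r.good
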